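/- **Model.** Fix $\lambda_{\rm L},\lambda,\bar\sigma,\alpha,G_{\rm t},A_{\rm e},P,R,R_{\rm P}>0$, $p\in[0,1]$, $\beta_{\rm SF}\in[0,1)$ and a half-beamwidth $\Omega\in(0,\pi/4]$; put $\gamma=\frac{G_{\rm t}A_{\rm e}}{(4\pi)^2}$. The line with parameters $(\theta,r)$ is $\{(x,y):x\cos\theta+y\sin\theta=r\}$, with direction $\mathbf a_\theta=(-\sin\theta,\cos\theta)$. Streets are the lines whose parameters form a Poisson process of intensity $\lambda_{\rm L}\,{\rm d}\theta\,{\rm d}r$ on $[0,\pi)\times\mathbb R$, together with the ego street $L_0=(0,0)$ (the $y$-axis). Given the streets, the vehicles form independent one-dimensional Poisson processes of intensity $\lambda$ on all of them; $\Phi_{{\rm P}_0}$ denotes the resulting (reduced Palm) Poisson line Cox process. The sector of a radar at $z\in\mathbb R^2$ with boresight $\mathbf a$ is $$\mathcal R(z,\mathbf a)=\Big\{x:\ \frac{(x-z)\cdot\mathbf a}{\|x-z\|}>\cos\Omega,\ \|x-z\|\le R_{\rm P}\Big\}.$$ The ego radar is at the origin with boresight $(0,1)$. A vehicle at $\mathbf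 w$ on a street with angle $\theta$ interferes if $\mathbf w\in\mathcal R(0,(0,1))$ and $0\in\mathcal R(\mathbf w,\mathbf a_\theta)\cup\mathcal R(\mathbf w,-\mathbf a_\theta)$. Each vehicle transmits with probability $p$ (ALOHA) and has an exponential fading power $h_{\mathbf w}$ of mean $1$ (Rayleigh fading); the target's radar cross-section $\sigma_{\mathbf c}$ is exponential with mean $\bar\sigma$; all of these are independent of each other and of $\Phi_{{\rm P}_0}$. Let $$\mathrm{SF}=\frac{\gamma\sigma_{\mathbf c}PR^{-2\alpha}}{\gamma\sigma_{\mathbf c}PR^{-2\alpha}+\sum_{\mathbf w}4\pi\gamma P\,h_{\mathbf w}\|\mathbf w\|^{-\alpha}},$$ the sum being over the interfering vehicles that transmit, and let $p_{\rm SF,P}(\beta_{\rm SF})=\mathbb P(\mathrm{SF}>\beta_{\rm SF}\mid\Phi_{{\rm P}_0})$ and $\beta_{\rm SF}'=\frac{4\pi\beta_{\rm SF}}{\bar\sigma R^{-2\alpha}(1-\beta_{\rm SF})}$. **Interfering section.** For $r>0$ and $\sin\theta\ne0$ the street $(\theta,r)$ meets the ego street at $(0,d)$ with $d=r/\sin\theta$.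 Let $v$ be the signed distance along the street from this point, oriented so that $y$ does not decrease (if $\cos\theta=0$, in the direction $\mathbf a_\theta$); the distance to the ego radar is $$\|\mathbf w_{\rm P}\|=\sqrt{(d+v|\cos\theta|)^2+(v\sin\theta)^2}.$$ Put $\psi=\arcsin|\sin\theta|$ and $\rho=\sqrt{\max(R_{\rm P}^2-r^2,0)}$. Define $a_{\rm P}=r\cot\Omega-d|\cos\theta|$ if $\sin\theta>0$ and $a_{\rm P}=r\cot(\Omega-\psi)-d|\cos\theta|$ if $\sin\theta<0$ (with $\cot 0:=0$). Define $b_{\rm P}=\max(a_{\rm P},\,m-d|\cos\theta|)$, where $m=\rho$ if $\psi<\Omega$ or ($\psi=\Omega$ and $\sin\theta>0$), and $m=\min(\rho,\,r\cot(\psi-\Omega))$ if $\psi>\Omega$ and $\sin\theta>0$; if $\sin\theta<0$ and $\psi\ge\Omega$, put $b_{\rm P}=a_{\rm P}$. **Claim.** (i) For all $r>0$ and $\theta$ with $\sin\theta\neq0$, the set of $v$ at which a vehicle on the street $(\theta,r)$ interferes contains $(a_{\rm P},b_{\rm P})$ and is contained in $[a_{\rm P},b_{\rm P}]$. (ii)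 Let $b\in\mathbb C$. If $p<1$ or $\alpha\,\mathrm{Re}\,b>-1$, then $p_{\rm SF,P}(\beta_{\rm SF})^b$ is integrable. Whenever it is integrable, the $b$-th moment is $$\mathbb E\big[p_{\rm SF,P}(\beta_{\rm SF})^b\big]=\exp\Bigg(-\lambda\int_0^{R_{\rm P}}\Big[1-\Big(\tfrac{p}{1+\beta_{\rm SF}'v^{-\alpha}}+1-p\Big)^b\Big]{\rm d}v-\lambda_{\rm L}\int_0^\infty\!\int_0^{2\pi}\Big[1-\exp\Big(-\lambda\int_{a_{\rm P}}^{b_{\rm P}}\Big[1-\Big(\tfrac{p}{1+\beta_{\rm SF}'\|\mathbf w_{\rm P}\|^{-\alpha}}+1-p\Big)^b\Big]{\rm d}v\Big)\Big]{\rm d}\theta\,{\rm d}r\Bigg).$$ -/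

import Mathlib

open MeasureTheory ProbabilityTheory Set

noncomputable section

namespace RadarPLCP

/-! ### Poisson point processes -/

/-- Number of points of the enumerated random point set `X` that lie in `S`. -/
def count {Ω E : Type*} (X : ℕ → Ω → E) (S : Set E) (ω : Ω) : ℕ∞ :=
  {n : ℕ | X n ω ∈ S}.encard

/-- The points `X 0, X 1, …` form a Poisson point process with intensity measure `μ`: the number
of points in a set of finite intensity is Poisson distributed, and the numbers of points in
disjoint sets are independent. -/
structure IsPoissonProcess {Ω E : Type*} [MeasurableSpace Ω] [MeasurableSpace E]
    (P : Measure Ω) (X : ℕ → Ω → E) (μ : Measure E) : Prop where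
  measurable : ∀ n, Measurable (X n)
  count_law : ∀ S : Set E, MeasurableSet S → μ S < ⊤ → ∀ k : ℕ,
    P {ω | count X S ω = (k : ℕ∞)} = poissonMeasure (μ S).toNNReal {k}
  count_indep : ∀ (m : ℕ) (S : Fin m → Set E), (∀ i, MeasurableSet (S i)) →
    Pairwise (fun i j => Disjoint (S i) (S j)) → iIndepFun (fun i => count X (S i)) P

/-! ### Geometry of streets and radar sectors -/

/-- The Euclidean plane. -/
abbrev Plane : Type := EuclideanSpace ℝ (Fin 2)

/-- The direction `(-sin θ, cos θ)` of a street whose normal makes the angle `θ` with the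
`x`-axis; the radars of a vehicle on this street look along it and against it. -/
def direction (θ : ℝ) : Plane := !₂[-Real.sin θ, Real.cos θ]

/-- The point of the street `{(x, y) | x cos θ + y sin θ = r}` at signed distance `t` from the
foot of the perpendicular dropped from the origin. -/
def streetPoint (θ r t : ℝ) : Plane := r • !₂[Real.cos θ, Real.sin θ] + t • direction θ

/-- The sector seen by a radar at `z` with boresight `a`, half-beamwidth `bw` and range `RP`. -/
def sector (bw RP : ℝ) (z a : Plane) : Set Plane :=
  {x | Real.cos bw < inner ℝ (x - z) a / ‖x - z‖ ∧ ‖x - z‖ ≤ RP}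

/-- A vehicle at `z` on a street with normal angle `θ` interferes with the ego radar (at the
origin, with boresight along the positive `y`-axis): it lies in the sector of the ego radar, and
the ego radar lies in the sector of its front or of its rear radar. -/
def Interferes (bw RP θ : ℝ) (z : Plane) : Prop :=
  z ∈ sector bw RP 0 (direction 0) ∧
    (0 ∈ sector bw RP z (direction θ) ∨ 0 ∈ sector bw RP z (-direction θ))

/-- Signed position along the ego street (the `y`-axis) of its intersection with the street
`(θ, r)`. -/
def crossing (θ r : ℝ) : ℝ := r / Real.sin θ

/-- The point of the street `(θ, r)` at signed distance `v` from its intersection with the ego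
street; `v` increases in the direction in which `y` does not decrease. -/
def crossingPoint (θ r v : ℝ) : Plane :=
  !₂[0, crossing θ r] + v • (if 0 ≤ Real.cos θ then direction θ else -direction θ)

/-- The section of the street `(θ, r)` on which a vehicle interferes with the ego radar. -/
def interferingSection (bw RP θ r : ℝ) : Set ℝ :=
  {v | Interferes bw RP θ (crossingPoint θ r v)}

/-- Distance from the ego radar to the point of the street `(θ, r)` at signed distance `v` from
its intersection with the ego street. -/
def interfererDist (θ r v : ℝ) : ℝ :=
  √((crossing θ r + v * |Real.cos θ|) ^ 2 + (v * Real.sin θ) ^ 2)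

/-- The acute angle between the street with normal angle `θ` and the ego street. -/
def streetAngle (θ : ℝ) : ℝ := Real.arcsin |Real.sin θ|

/-- The lower bound `a_P` of the interfering section of the street `(θ, r)`. -/
def sectionStart (bw θ r : ℝ) : ℝ :=
  (if 0 < Real.sin θ then r * Real.cot bw else r * Real.cot (bw - streetAngle θ))
    - crossing θ r * |Real.cos θ|

/-- The upper bound `b_P` of the interfering section of the street `(θ, r)`; it is equal to `a_P`
when no vehicle of this street can interfere. -/
def sectionEnd (bw RP θ r : ℝ) : ℝ :=
  if 0 < Real.sin θ then
    max (sectionStart bw θ r)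
      ((if streetAngle θ ≤ bw then √(RP ^ 2 - r ^ 2)
        else min (√(RP ^ 2 - r ^ 2)) (r * Real.cot (streetAngle θ - bw)))
        - crossing θ r * |Real.cos θ|)
  else if streetAngle θ < bw then
    max (sectionStart bw θ r) (√(RP ^ 2 - r ^ 2) - crossing θ r * |Real.cos θ|)
  else sectionStart bw θ r

/-! ### The network seen from the ego radar -/

/-- Parameters `(θ, r)` of the streets: street `0` is the ego street `(0, 0)`, and street `i + 1`
is the `i`-th street of the Poisson line process. -/
def street {Ω : Type*} (q : ℕ → Ω → ℝ × ℝ) : ℕ → Ω → ℝ × ℝ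
  | 0, _ => (0, 0)
  | i + 1, ω => q i ω

/-- Location of the `j`-th vehicle on the `i`-th street. -/
def vehicle {Ω : Type*} (q : ℕ → Ω → ℝ × ℝ) (t : ℕ → ℕ → Ω → ℝ) (i j : ℕ) (ω : Ω) : Plane :=
  streetPoint (street q i ω).1 (street q i ω).2 (t i j ω)

/-- The independent sources of randomness: the Poisson line process, the vehicles of street `i`,
the radar cross-section of the target, and for the `j`-th vehicle of street `i` its fading power
and its channel access decision. -/
inductive Source : Type
  | lines : Source
  | vehicles (i : ℕ) : Source
  | rcs : Source
  | fading (i j : ℕ) : Source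
  | access (i j : ℕ) : Source

/-- The σ-algebra generated by each source of randomness. -/
@[reducible] def sourceSigma {Ω : Type*} (q : ℕ → Ω → ℝ × ℝ) (t : ℕ → ℕ → Ω → ℝ) (rcs : Ω → ℝ)
    (h : ℕ → ℕ → Ω → ℝ) (act : ℕ → ℕ → Ω → Bool) : Source → MeasurableSpace Ω
  | .lines => ⨆ n, MeasurableSpace.comap (q n) inferInstance
  | .vehicles i => ⨆ j, MeasurableSpace.comap (t i j) inferInstance
  | .rcs => MeasurableSpace.comap rcs inferInstance
  | .fading i j => MeasurableSpace.comap (h i j) inferInstance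
  | .access i j => MeasurableSpace.comap (act i j) inferInstance

/-- The σ-algebra generated by the Palm version of the Cox process, that is, by the streets and
the vehicles on them. -/
@[reducible] def processSigma {Ω : Type*} (q : ℕ → Ω → ℝ × ℝ) (t : ℕ → ℕ → Ω → ℝ) : MeasurableSpace Ω :=
  (⨆ n, MeasurableSpace.comap (q n) inferInstance) ⊔
    ⨆ i, ⨆ j, MeasurableSpace.comap (t i j) inferInstance

/-- The network: streets form a Poisson line process of intensity `lamL` on `[0, π) × ℝ`, to
which the ego street is added; vehicles form Poisson processes of intensity `lam` on all these
streets; the radar cross-section is exponential with mean `sbar`; fading powers are exponential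
with mean one (Rayleigh fading); every vehicle transmits with probability `p` (ALOHA); all of
these are independent. -/
structure IsNetwork {Ω : Type*} [MeasurableSpace Ω] (P : Measure Ω) (lamL lam p sbar : ℝ)
    (q : ℕ → Ω → ℝ × ℝ) (t : ℕ → ℕ → Ω → ℝ) (rcs : Ω → ℝ)
    (h : ℕ → ℕ → Ω → ℝ) (act : ℕ → ℕ → Ω → Bool) : Prop where
  lines : IsPoissonProcess P q
    (ENNReal.ofReal lamL • (volume : Measure (ℝ × ℝ)).restrict (Ico 0 Real.pi ×ˢ univ))
  vehicles : ∀ i, IsPoissonProcess P (t i) (ENNReal.ofReal lam • (volume : Measure ℝ))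
  rcs_measurable : Measurable rcs
  rcs_law : P.map rcs = expMeasure (1 / sbar)
  fading_measurable : ∀ i j, Measurable (h i j)
  fading_law : ∀ i j, P.map (h i j) = expMeasure 1
  access_measurable : ∀ i j, Measurable (act i j)
  access_law : ∀ i j, P {ω | act i j ω = true} = ENNReal.ofReal p
  indep : iIndep (sourceSigma q t rcs h act) P

/-! ### Signal fraction -/

/-- The constant `γ = G_t A_e / (4 π)²`. -/
def gainConst (Gt Ae : ℝ) : ℝ := Gt / (4 * Real.pi) ^ 2 * Ae

/-- Power reflected by the target at distance `R`. -/
def signal {Ω : Type*} (γ Ptx α R : ℝ) (rcs : Ω → ℝ) (ω : Ω) : ℝ :=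
  γ * rcs ω * Ptx * R ^ (-2 * α)

open Classical in
/-- Total power received from the interfering vehicles that transmit. -/
def interference {Ω : Type*} (γ Ptx α bw RP : ℝ) (q : ℕ → Ω → ℝ × ℝ) (t : ℕ → ℕ → Ω → ℝ)
    (h : ℕ → ℕ → Ω → ℝ) (act : ℕ → ℕ → Ω → Bool) (ω : Ω) : ℝ :=
  ∑' ij : ℕ × ℕ,
    if Interferes bw RP (street q ij.1 ω).1 (vehicle q t ij.1 ij.2 ω) ∧ act ij.1 ij.2 ω = true
    then 4 * Real.pi * γ * Ptx * h ij.1 ij.2 ω * ‖vehicle q t ij.1 ij.2 ω‖ ^ (-α)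
    else 0

/-- The signal fraction at the ego radar. -/
def signalFraction {Ω : Type*} (γ Ptx α R bw RP : ℝ) (q : ℕ → Ω → ℝ × ℝ) (t : ℕ → ℕ → Ω → ℝ)
    (rcs : Ω → ℝ) (h : ℕ → ℕ → Ω → ℝ) (act : ℕ → ℕ → Ω → Bool) (ω : Ω) : ℝ :=
  signal γ Ptx α R rcs ω /
    (signal γ Ptx α R rcs ω + interference γ Ptx α bw RP q t h act ω)

/-- The conditional success probability: the conditional probability, given the Cox process, that
the signal fraction exceeds the threshold `β`. -/
def condSuccess {Ω : Type*} [MeasurableSpace Ω] (P : Measure Ω) (γ Ptx α R bw RP β : ℝ)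
    (q : ℕ → Ω → ℝ × ℝ) (t : ℕ → ℕ → Ω → ℝ) (rcs : Ω → ℝ) (h : ℕ → ℕ → Ω → ℝ)
    (act : ℕ → ℕ → Ω → Bool) : Ω → ℝ :=
  P⟦{ω | β < signalFraction γ Ptx α R bw RP q t rcs h act ω} | processSigma q t⟧

/-- The scaled threshold `β' = 4 π β / (sbar R^(-2α) (1 - β))`. -/
def scaledThreshold (α R sbar β : ℝ) : ℝ :=
  4 * Real.pi * β / (sbar * R ^ (-2 * α) * (1 - β))

/-- The factor `p / (1 + β' w^(-α)) + 1 - p` contributed by an interferer at distance `w`. -/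
def factor (p α β' w : ℝ) : ℝ := p / (1 + β' * w ^ (-α)) + 1 - p

end RadarPLCP

end

/-!
Given the streets and the vehicles, the radar cross-section is exponential, so the signal fraction
exceeds the threshold with a probability that is the Laplace transform of the interference. Fading
powers and access decisions are independent between vehicles, hence this Laplace transform
factorizes, and the conditional success probability is the product over all vehicles of
`vehicleFactor`, which is `factor` at the distance of an interfering vehicle and `1` otherwise
(`IsNetwork.condSuccess_ae_eq`). Its power `b` is the product of the powers `powFactor`.

The expectation of a product over the points of a Poisson process `X` is the probability generating
functional `E ∏ g (X n) = exp (∫ (g - 1) dμ)`. It holds for simple functions by independence of the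
counts in the level sets, and in general by monotone or dominated convergence
(`IsPoissonProcess.lintegral_finprod`, `IsPoissonProcess.integrable_and_integral_finprod`). For the
Cox process it is applied twice: on each street, which gives `streetMoment`, and then to the
streets (`IsNetwork.integrable_and_integral_finprod`). Only streets and vehicles within the range
matter, almost surely finitely many, and the product over them is approached by the products over
the first `N` streets.

The moment is integrable exactly if the integral over the ego street of
`max 1 (factor ^ Re b)` is finite. This is sufficient because a vehicle on another street is never
closer than its distance to the foot point of the perpendicular (`powBound_le`), so that the ego
street dominates every street up to a constant. It is necessary because all factors have modulus at
least `1` when `Re b < 0`, so that the product over the ego street alone must have a finite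
expectation (`IsNetwork.lintegral_boundAt_lt_top_of_integrable`). It holds if `p < 1`, where the
factors are bounded below, and if `α Re b > -1`, where the singularity at the origin is integrable.

The moment of a street is made explicit by polar coordinates: relative to the street, the ego radar
is seen under an angle `φ`, in terms of which the two sectors are intervals
(`interferingSection_bounds`). Finally, `(θ + π, r)` and `(θ, -r)` are the same street, so that the
integral over `[0, π) × ℝ` is an integral over a full turn and `r > 0` (`integral_strip_eq`).
-/

set_option linter.unusedSectionVars false

noncomputable section

namespace RadarPLCP

open Filter Topology
open scoped ENNReal NNReal

/-! ### Finitary products of random functions -/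

/-- A countable finitary product is measurable, including where infinitely many factors differ from
`1` and it takes its default value `1`: there are only countably many finite supports. -/
theorem measurable_finprod {ι A R : Type*} [Countable ι] [MeasurableSpace A] [CommMonoid R]
    [MeasurableSpace R] [MeasurableMul₂ R] [MeasurableSingletonClass R] {u : ι → A → R}
    (hu : ∀ i, Measurable (u i)) : Measurable fun a => ∏ᶠ i, u i a := by
  classical
  have hF : ∀ F : Finset ι, MeasurableSet {a | (Function.mulSupport fun i => u i a) = F} := by
    intro F
    have : {a | (Function.mulSupport fun i => u i a) = F}
        = ⋂ i, if i ∈ F then (u i ⁻¹' {1})ᶜ else u i ⁻¹' {1} := by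
      ext a
      simp only [mem_ofPred_eq, Set.ext_iff, Function.mem_mulSupport, Finset.mem_coe, mem_iInter]
      refine forall_congr' fun i => ?_
      split_ifs with h <;> simp [h]
    rw [this]
    refine MeasurableSet.iInter fun i => ?_
    split_ifs
    · exact (hu i (measurableSet_singleton 1)).compl
    · exact hu i (measurableSet_singleton 1)
  intro B hB
  have : (fun a => ∏ᶠ i, u i a) ⁻¹' B
      = (⋃ F : Finset ι, {a | (Function.mulSupport fun i => u i a) = F}
          ∩ {a | ∏ i ∈ F, u i a ∈ B})
        ∪ ((⋃ F : Finset ι, {a | (Function.mulSupport fun i => u i a) = F})ᶜ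
          ∩ {_a | (1 : R) ∈ B}) := by
    ext a
    simp only [mem_preimage, mem_union, mem_iUnion, mem_inter_iff, mem_ofPred_eq, mem_compl_iff,
      not_exists]
    by_cases h : (Function.mulSupport fun i => u i a).Finite
    · have h1 : ∏ᶠ i, u i a = ∏ i ∈ h.toFinset, u i a := finprod_eq_prod _ h
      constructor
      · intro h2
        exact Or.inl ⟨h.toFinset, by simp, h1 ▸ h2⟩
      · rintro (⟨F, hF, h2⟩ | ⟨h2, -⟩)
        · rwa [finprod_eq_prod_of_mulSupport_subset _ hF.subset]
        · exact absurd (by simp) (h2 h.toFinset)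
    · rw [finprod_of_infinite_mulSupport h]
      constructor
      · intro h2
        refine Or.inr ⟨fun F hF => h (hF ▸ F.finite_toSet), h2⟩
      · rintro (⟨F, hF, -⟩ | ⟨-, h2⟩)
        · exact absurd (hF ▸ F.finite_toSet) h
        · exact h2
  rw [this]
  refine (MeasurableSet.iUnion fun F => (hF F).inter ?_).union
    ((MeasurableSet.iUnion hF).compl.inter (MeasurableSet.const _))
  exact (F.measurable_prod fun i _ => hu i) hB

theorem measurable_mulIndicator {A R : Type*} [MeasurableSpace A] [MeasurableSpace R] [One R]
    {g : A → R} (hg : Measurable g) {S : Set A} (hS : MeasurableSet S) :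
    Measurable (S.mulIndicator g) := by
  classical
  rw [← Set.piecewise_eq_mulIndicator]
  exact hg.piecewise hS measurable_const

theorem finprod_mulIndicator_eq_prod {ι F R : Type*} [CommMonoid R] {x : ι → F} {S : Set F}
    (hfin : {n | x n ∈ S}.Finite) (g : F → R) :
    ∏ᶠ n, S.mulIndicator g (x n) = ∏ n ∈ hfin.toFinset, g (x n) := by
  rw [finprod_eq_prod_of_mulSupport_subset (s := hfin.toFinset)]
  · refine Finset.prod_congr rfl fun n hn => ?_
    exact mulIndicator_of_mem (by simpa using hn) _
  · intro n hn
    by_contra h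
    exact hn (mulIndicator_of_notMem (by simpa using h) _)

/-! ### The number of points of a Poisson process -/

section Poisson

variable {Ω E : Type*} [MeasurableSpace Ω] [MeasurableSpace E] {P : Measure Ω}
  [IsProbabilityMeasure P] {X : ℕ → Ω → E} {μ : Measure E}

theorem measurable_count (hX : ∀ n, Measurable (X n)) {S : Set E} (hS : MeasurableSet S) :
    Measurable (count X S) := by
  have h1 : ∀ ω, ((count X S ω : ℕ∞) : ℝ≥0∞) = ∑' n, S.indicator (fun _ => (1 : ℝ≥0∞)) (X n ω) := by
    intro ω
    rw [count, ← ENNReal.tsum_set_one, tsum_subtype {n | X n ω ∈ S} (fun _ => (1 : ℝ≥0∞))]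
    rfl
  have h2 : Measurable fun ω => ((count X S ω : ℕ∞) : ℝ≥0∞) := by
    simp_rw [h1]
    exact Measurable.tsum fun n => (measurable_const.indicator hS).comp (hX n)
  refine measurable_to_countable' fun k => ?_
  have : count X S ⁻¹' {k} = (fun ω => ((count X S ω : ℕ∞) : ℝ≥0∞)) ⁻¹' {(k : ℝ≥0∞)} := by
    ext ω
    simp
  rw [this]
  exact h2 (measurableSet_singleton _)

theorem IsPoissonProcess.ae_count_ne_top (hX : IsPoissonProcess P X μ) {S : Set E}
    (hS : MeasurableSet S) (hμ : μ S < ⊤) : ∀ᵐ ω ∂P, count X S ω ≠ ⊤ := by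
  have h1 : P (⋃ k : ℕ, {ω | count X S ω = (k : ℕ∞)}) = 1 := by
    rw [measure_iUnion]
    · simp_rw [hX.count_law S hS hμ]
      have := measure_iUnion (μ := poissonMeasure (μ S).toNNReal) (f := fun k : ℕ => {k})
        (fun i j hij => by simpa using hij) (fun i => measurableSet_singleton i)
      rw [← this, iUnion_of_singleton, measure_univ]
    · intro i j hij
      refine Set.disjoint_left.2 fun ω h1 h2 => hij ?_
      exact_mod_cast h1.symm.trans h2
    · exact fun k => measurable_count hX.measurable hS (measurableSet_singleton _)
  have h2 : MeasurableSet (⋃ k : ℕ, {ω | count X S ω = (k : ℕ∞)}) :=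
    MeasurableSet.iUnion fun k => measurable_count hX.measurable hS (measurableSet_singleton _)
  rw [ae_iff]
  refine measure_mono_null ?_ ((prob_compl_eq_zero_iff h2).2 h1)
  intro ω hω
  simp only [ne_eq, not_not, mem_ofPred_eq] at hω
  simp [hω]

theorem IsPoissonProcess.ae_finite (hX : IsPoissonProcess P X μ) {S : Set E}
    (hS : MeasurableSet S) (hμ : μ S < ⊤) : ∀ᵐ ω ∂P, {n | X n ω ∈ S}.Finite := by
  filter_upwards [hX.ae_count_ne_top hS hμ] with ω hω
  exact Set.encard_ne_top_iff.1 hω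

theorem measurable_toNat_count (hX : ∀ n, Measurable (X n)) {S : Set E} (hS : MeasurableSet S) :
    Measurable fun ω => (count X S ω).toNat :=
  (Measurable.of_discrete (f := ENat.toNat)).comp (measurable_count hX hS)

theorem IsPoissonProcess.map_toNat_count (hX : IsPoissonProcess P X μ) {S : Set E}
    (hS : MeasurableSet S) (hμ : μ S < ⊤) :
    P.map (fun ω => (count X S ω).toNat) = poissonMeasure (μ S).toNNReal := by
  refine Measure.ext_of_singleton fun k => ?_
  rw [Measure.map_apply (measurable_toNat_count hX.measurable hS) (measurableSet_singleton k),
    ← hX.count_law S hS hμ k]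
  refine measure_congr ?_
  filter_upwards [hX.ae_count_ne_top hS hμ] with ω hω
  refine propext ?_
  change (count X S ω).toNat = k ↔ count X S ω = k
  lift count X S ω to ℕ using hω with m
  simp

theorem IsPoissonProcess.iIndepFun_count (hX : IsPoissonProcess P X μ) {ι : Type*} [Fintype ι]
    (S : ι → Set E) (hS : ∀ i, MeasurableSet (S i))
    (hd : Pairwise fun i j => Disjoint (S i) (S j)) :
    iIndepFun (fun i ω => (count X (S i) ω).toNat) P := by
  have e := Fintype.equivFin ι
  have h1 := hX.count_indep _ (fun k => S (e.symm k)) (fun k => hS _)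
    (fun i j hij => hd (e.symm.injective.ne hij))
  have h2 := (h1.precomp e.injective).comp (fun _ => ENat.toNat) (fun _ => Measurable.of_discrete)
  simpa [Function.comp_def] using h2

theorem lintegral_pow_poissonMeasure (m : ℝ≥0) {c : ℝ} (hc : 0 ≤ c) :
    ∫⁻ k, ENNReal.ofReal c ^ k ∂(poissonMeasure m) = ENNReal.ofReal (Real.exp (m * (c - 1))) := by
  have h1 : ∀ k : ℕ, ENNReal.ofReal c ^ k * poissonMeasure m {k}
      = ENNReal.ofReal (Real.exp (-m) * ((m * c) ^ k / k.factorial)) := by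
    intro k
    rw [poissonMeasure_singleton, ← ENNReal.ofReal_pow hc, ← ENNReal.ofReal_mul (by positivity)]
    congr 1
    rw [mul_pow]
    ring
  have h2 : HasSum (fun k : ℕ => Real.exp (-m) * ((m * c) ^ k / k.factorial))
      (Real.exp (m * (c - 1))) := by
    have := (NormedSpace.expSeries_div_hasSum_exp ((m : ℝ) * c)).mul_left (Real.exp (-m))
    rwa [← Real.exp_eq_exp_ℝ, ← Real.exp_add, show -(m : ℝ) + m * c = m * (c - 1) by ring] at this
  rw [lintegral_countable']
  simp_rw [h1]
  rw [← ENNReal.ofReal_tsum_of_nonneg (fun k => by positivity) h2.summable, h2.tsum_eq]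

theorem integral_pow_poissonMeasure (m : ℝ≥0) (c : ℂ) :
    ∫ k, c ^ k ∂(poissonMeasure m) = Complex.exp (m * (c - 1)) := by
  rw [integral_poissonMeasure]
  have := (NormedSpace.expSeries_div_hasSum_exp ((m : ℂ) * c)).mul_left (Complex.exp (-m))
  rw [← Complex.exp_eq_exp_ℂ, ← Complex.exp_add, show -(m : ℂ) + m * c = m * (c - 1) by ring]
    at this
  rw [← this.tsum_eq]
  congr 1
  ext k
  rw [Complex.real_smul, mul_pow]
  push_cast
  ring

/-! ### The probability generating functional of a Poisson process -/

/-- Grouping the points by the value of a simple function reduces the product to finitely many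
counts. -/
theorem finprod_mulIndicator_simpleFunc {R : Type*} [CommMonoid R] (g : SimpleFunc E R) {S : Set E}
    {ω : Ω} (hfin : {n | X n ω ∈ S}.Finite) :
    ∏ᶠ n, S.mulIndicator g (X n ω)
      = ∏ c ∈ g.range, c ^ (count X (S ∩ g ⁻¹' {c}) ω).toNat := by
  classical
  rw [finprod_mulIndicator_eq_prod hfin,
    ← Finset.prod_fiberwise_of_maps_to' (t := g.range) (g := fun n => g (X n ω))
    (fun n _ => SimpleFunc.mem_range_self g _) (fun c => c)]
  refine Finset.prod_congr rfl fun c _ => ?_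
  rw [Finset.prod_const]
  congr 1
  have : {n | X n ω ∈ S ∩ g ⁻¹' {c}} = ↑(Finset.filter (fun n => g (X n ω) = c) hfin.toFinset) := by
    ext n
    simp
  rw [count, this, Set.encard_coe_eq_coe_finsetCard]
  simp

theorem IsPoissonProcess.iIndepFun_count_fiber (hX : IsPoissonProcess P X μ) {R : Type*}
    (g : SimpleFunc E R) {S : Set E} (hS : MeasurableSet S) :
    iIndepFun (fun (c : g.range) ω => (count X (S ∩ g ⁻¹' {(c : R)}) ω).toNat) P := by
  refine hX.iIndepFun_count _ (fun c => hS.inter (g.measurableSet_fiber _)) fun c d hcd => ?_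
  refine Set.disjoint_left.2 fun x h1 h2 => hcd (Subtype.ext ?_)
  exact h1.2.symm.trans h2.2

/-- Splitting `S` into the level sets of `g` gives independent Poisson counts. The right-hand side
is written as a product of two extended exponentials because it stays meaningful when
`∫⁻ x in S, g x ∂μ` is infinite. -/
theorem IsPoissonProcess.lintegral_finprod_simpleFunc (hX : IsPoissonProcess P X μ)
    (g : SimpleFunc E ℝ≥0∞) (hg : ∀ x, g x ≠ ⊤) {S : Set E} (hS : MeasurableSet S)
    (hμ : μ S < ⊤) :
    ∫⁻ ω, ∏ᶠ n, S.mulIndicator g (X n ω) ∂P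
      = EReal.exp (∫⁻ x in S, g x ∂μ : ℝ≥0∞) * EReal.exp (-(μ S).toReal : ℝ) := by
  have hm : ∀ c, μ (S ∩ g ⁻¹' {c}) < ⊤ := fun c => (measure_mono inter_subset_left).trans_lt hμ
  have hmS : ∀ c, MeasurableSet (S ∩ g ⁻¹' {c}) := fun c => hS.inter (g.measurableSet_fiber _)
  have hc : ∀ c ∈ g.range, c ≠ ⊤ := by
    intro c hc
    obtain ⟨x, rfl⟩ := SimpleFunc.mem_range.1 hc
    exact hg x
  have h1 : ∫⁻ ω, ∏ᶠ n, S.mulIndicator g (X n ω) ∂P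
      = ∫⁻ ω, ∏ c : g.range, (c : ℝ≥0∞) ^ (count X (S ∩ g ⁻¹' {(c : ℝ≥0∞)}) ω).toNat ∂P := by
    refine lintegral_congr_ae ?_
    filter_upwards [hX.ae_finite hS hμ] with ω hω
    rw [finprod_mulIndicator_simpleFunc g hω]
    exact (Finset.prod_coe_sort g.range
      fun c => c ^ (count X (S ∩ g ⁻¹' {c}) ω).toNat).symm
  have hind := (hX.iIndepFun_count_fiber g hS).comp
    (fun c k => (c : ℝ≥0∞) ^ k) (fun _ => Measurable.of_discrete)
  have h2 := lintegral_prod_eq_prod_lintegral_of_indepFun Finset.univ _ hind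
    (fun c => (Measurable.of_discrete (f := fun k : ℕ => (c : ℝ≥0∞) ^ k)).comp
      (measurable_toNat_count hX.measurable (hmS c)))
  have h3 : ∀ c ∈ g.range, ∫⁻ ω, c ^ (count X (S ∩ g ⁻¹' {c}) ω).toNat ∂P
      = ENNReal.ofReal (Real.exp (μ.real (S ∩ g ⁻¹' {c}) * (c.toReal - 1))) := by
    intro c hcr
    have := lintegral_pow_poissonMeasure (μ (S ∩ g ⁻¹' {c})).toNNReal (c := c.toReal)
      ENNReal.toReal_nonneg
    rw [ENNReal.ofReal_toReal (hc c hcr), ← hX.map_toNat_count (hmS c) (hm c),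
      lintegral_map Measurable.of_discrete (measurable_toNat_count hX.measurable (hmS c))] at this
    exact this
  have h4 : (∫⁻ x in S, g x ∂μ) = ∑ c ∈ g.range, c * μ (S ∩ g ⁻¹' {c}) := by
    refine (SimpleFunc.lintegral_eq_lintegral g _).trans ?_
    rw [SimpleFunc.lintegral]
    refine Finset.sum_congr rfl fun c _ => ?_
    rw [Measure.restrict_apply (g.measurableSet_fiber _), inter_comm]
  have h5 : (∫⁻ x in S, g x ∂μ) ≠ ⊤ := by
    rw [h4]
    exact ENNReal.sum_ne_top.2 fun c h => ENNReal.mul_ne_top (hc c h) (hm c).ne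
  have h6 : (∫⁻ x in S, g x ∂μ).toReal = ∑ c ∈ g.range, μ.real (S ∩ g ⁻¹' {c}) * c.toReal := by
    rw [h4, ENNReal.toReal_sum fun c h => ENNReal.mul_ne_top (hc c h) (hm c).ne]
    refine Finset.sum_congr rfl fun c _ => ?_
    rw [ENNReal.toReal_mul, mul_comm, measureReal_def]
  have h7 : (μ S).toReal = ∑ c ∈ g.range, μ.real (S ∩ g ⁻¹' {c}) := by
    rw [← measureReal_biUnion_finset (fun c _ d _ hcd => ?_) (fun c _ => hmS c)
      (fun c _ => (hm c).ne)]
    · rw [measureReal_def]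
      congr 2
      ext x
      simp
    · refine Set.disjoint_left.2 fun x h1 h2 => hcd ?_
      exact h1.2.symm.trans h2.2
  rw [h1]
  simp only [Function.comp_apply] at h2
  rw [h2, Finset.prod_coe_sort g.range
      fun c => ∫⁻ ω, c ^ (count X (S ∩ g ⁻¹' {c}) ω).toNat ∂P, Finset.prod_congr rfl h3,
    ← ENNReal.ofReal_prod_of_nonneg fun _ _ => (Real.exp_pos _).le, ← Real.exp_sum,
    ← EReal.coe_toReal (x := ((∫⁻ x in S, g x ∂μ : ℝ≥0∞) : EReal)) (by simpa using h5) (by simp),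
    EReal.exp_coe, EReal.exp_coe, ← ENNReal.ofReal_mul (Real.exp_pos _).le, ← Real.exp_add,
    EReal.toReal_coe_ennreal, h6, h7, ← sub_eq_add_neg, ← Finset.sum_sub_distrib]
  simp_rw [mul_sub, mul_one]

theorem IsPoissonProcess.integral_finprod_simpleFunc (hX : IsPoissonProcess P X μ)
    (g : SimpleFunc E ℂ) {S : Set E} (hS : MeasurableSet S) (hμ : μ S < ⊤) :
    ∫ ω, ∏ᶠ n, S.mulIndicator g (X n ω) ∂P = Complex.exp (∫ x in S, (g x - 1) ∂μ) := by
  have hm : ∀ c, μ (S ∩ g ⁻¹' {c}) < ⊤ := fun c => (measure_mono inter_subset_left).trans_lt hμ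
  have hmS : ∀ c, MeasurableSet (S ∩ g ⁻¹' {c}) := fun c => hS.inter (g.measurableSet_fiber _)
  have : IsFiniteMeasure (μ.restrict S) := ⟨by simpa using hμ⟩
  have h1 : ∫ ω, ∏ᶠ n, S.mulIndicator g (X n ω) ∂P
      = ∫ ω, ∏ c : g.range, (c : ℂ) ^ (count X (S ∩ g ⁻¹' {(c : ℂ)}) ω).toNat ∂P := by
    refine integral_congr_ae ?_
    filter_upwards [hX.ae_finite hS hμ] with ω hω
    rw [finprod_mulIndicator_simpleFunc g hω]
    exact (Finset.prod_coe_sort g.range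
      fun c => c ^ (count X (S ∩ g ⁻¹' {c}) ω).toNat).symm
  have h2 := (hX.iIndepFun_count_fiber g hS).integral_fun_prod_comp
    (f := fun (c : g.range) k => (c : ℂ) ^ k)
    (fun c => (measurable_toNat_count hX.measurable (hmS c)).aemeasurable)
    (fun c => Measurable.of_discrete.aestronglyMeasurable)
  have h3 : ∀ c, ∫ ω, c ^ (count X (S ∩ g ⁻¹' {c}) ω).toNat ∂P
      = Complex.exp (μ.real (S ∩ g ⁻¹' {c}) * (c - 1)) := by
    intro c
    have := integral_pow_poissonMeasure (μ (S ∩ g ⁻¹' {c})).toNNReal c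
    rw [← hX.map_toNat_count (hmS c) (hm c),
      integral_map (measurable_toNat_count hX.measurable (hmS c)).aemeasurable
        Measurable.of_discrete.aestronglyMeasurable] at this
    exact this
  have hgi : Integrable g (μ.restrict S) := SimpleFunc.integrable_of_isFiniteMeasure g
  have h4 : ∫ x in S, g x ∂μ = ∑ c ∈ g.range, μ.real (S ∩ g ⁻¹' {c}) * c := by
    rw [← SimpleFunc.integral_eq_integral g hgi, SimpleFunc.integral_eq]
    refine Finset.sum_congr rfl fun c _ => ?_
    rw [measureReal_restrict_apply (g.measurableSet_fiber _), inter_comm, Complex.real_smul]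
  have h7 : μ.real S = ∑ c ∈ g.range, μ.real (S ∩ g ⁻¹' {c}) := by
    rw [← measureReal_biUnion_finset (fun c _ d _ hcd => ?_) (fun c _ => hmS c)
      (fun c _ => (hm c).ne)]
    · congr 1
      ext x
      simp
    · refine Set.disjoint_left.2 fun x h1 h2 => hcd ?_
      exact h1.2.symm.trans h2.2
  rw [h1, h2, Finset.prod_coe_sort g.range
      fun c => ∫ ω, c ^ (count X (S ∩ g ⁻¹' {c}) ω).toNat ∂P,
    Finset.prod_congr rfl fun c _ => h3 c, ← Complex.exp_sum,
    integral_sub hgi (integrable_const _), h4]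
  congr 1
  simp only [integral_const, measureReal_restrict_apply MeasurableSet.univ, univ_inter, h7,
    Complex.real_smul, mul_one, Complex.ofReal_sum]
  rw [← Finset.sum_sub_distrib]
  simp_rw [mul_sub, mul_one]

/-- The probability generating functional on nonnegative functions; both sides may be infinite. It
follows from simple functions by monotone convergence. -/
theorem IsPoissonProcess.lintegral_finprod (hX : IsPoissonProcess P X μ) {g : E → ℝ≥0∞}
    (hg : Measurable g) (hg' : ∀ x, g x ≠ ⊤) {S : Set E} (hS : MeasurableSet S) (hμ : μ S < ⊤) :
    ∫⁻ ω, ∏ᶠ n, S.mulIndicator g (X n ω) ∂P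
      = EReal.exp (∫⁻ x in S, g x ∂μ : ℝ≥0∞) * EReal.exp (-(μ S).toReal : ℝ) := by
  have hle : ∀ k x, SimpleFunc.eapprox g k x ≤ g x := fun k x => by
    rw [← SimpleFunc.iSup_eapprox_apply hg x]
    exact le_iSup (fun k => SimpleFunc.eapprox g k x) k
  have hk : ∀ k x, SimpleFunc.eapprox g k x ≠ ⊤ := fun k x =>
    ((hle k x).trans_lt (lt_top_iff_ne_top.2 (hg' x))).ne
  have hlim : ∀ x, Tendsto (fun k => SimpleFunc.eapprox g k x) atTop (𝓝 (g x)) := fun x => by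
    rw [← SimpleFunc.iSup_eapprox_apply hg x]
    exact tendsto_atTop_iSup fun i j hij => SimpleFunc.monotone_eapprox g hij x
  have h1 : Tendsto (fun k => ∫⁻ ω, ∏ᶠ n, S.mulIndicator (SimpleFunc.eapprox g k) (X n ω) ∂P) atTop
      (𝓝 (∫⁻ ω, ∏ᶠ n, S.mulIndicator g (X n ω) ∂P)) := by
    refine lintegral_tendsto_of_tendsto_of_monotone (fun k => Measurable.aemeasurable ?_) ?_ ?_
    · exact measurable_finprod fun n =>
        (measurable_mulIndicator (SimpleFunc.eapprox g k).measurable hS).comp (hX.measurable n)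
    · filter_upwards [hX.ae_finite hS hμ] with ω hω i j hij
      simp only [finprod_mulIndicator_eq_prod hω]
      exact Finset.prod_le_prod' fun n _ => SimpleFunc.monotone_eapprox g hij _
    · filter_upwards [hX.ae_finite hS hμ] with ω hω
      simp only [finprod_mulIndicator_eq_prod hω]
      exact ENNReal.tendsto_finsetProd_of_ne_top _ (fun n _ => hlim _) (fun n _ => hg' _)
  have h2 : Tendsto (fun k => ∫⁻ x in S, SimpleFunc.eapprox g k x ∂μ) atTop
      (𝓝 (∫⁻ x in S, g x ∂μ)) :=
    lintegral_tendsto_of_tendsto_of_monotone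
      (fun k => (SimpleFunc.eapprox g k).measurable.aemeasurable)
      (ae_of_all _ fun x i j hij => SimpleFunc.monotone_eapprox g hij x) (ae_of_all _ hlim)
  simp_rw [hX.lintegral_finprod_simpleFunc _ (hk _) hS hμ] at h1
  refine tendsto_nhds_unique h1 ?_
  refine ENNReal.Tendsto.mul_const ?_ (Or.inr ?_)
  · exact (ENNReal.continuous_exp.tendsto _).comp
      ((continuous_coe_ennreal_ereal.tendsto _).comp h2)
  · simp

theorem IsPoissonProcess.lintegral_finprod_lt_top (hX : IsPoissonProcess P X μ) {g : E → ℝ≥0∞}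
    (hg : Measurable g) (hg' : ∀ x, g x ≠ ⊤) {S : Set E} (hS : MeasurableSet S) (hμ : μ S < ⊤)
    (hi : ∫⁻ x in S, g x ∂μ < ⊤) :
    ∫⁻ ω, ∏ᶠ n, S.mulIndicator g (X n ω) ∂P < ⊤ := by
  rw [hX.lintegral_finprod hg hg' hS hμ]
  refine ENNReal.mul_lt_top ?_ (by simp only [EReal.exp_coe, ENNReal.ofReal_lt_top])
  rw [EReal.exp_lt_top_iff]
  exact (EReal.coe_ennreal_lt_coe_ennreal_iff (y := ⊤)).2 hi

/-- The probability generating functional on complex functions, with its integrability. It follows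
from simple functions by dominated convergence. -/
theorem IsPoissonProcess.integrable_and_integral_finprod (hX : IsPoissonProcess P X μ) {g : E → ℂ}
    (hg : Measurable g) {S : Set E} (hS : MeasurableSet S) (hμ : μ S < ⊤)
    (hi : IntegrableOn g S μ) :
    Integrable (fun ω => ∏ᶠ n, S.mulIndicator g (X n ω)) P ∧
      ∫ ω, ∏ᶠ n, S.mulIndicator g (X n ω) ∂P = Complex.exp (∫ x in S, (g x - 1) ∂μ) := by
  have : IsFiniteMeasure (μ.restrict S) := ⟨by simpa using hμ⟩
  -- The approximating simple functions are bounded by `2 ‖g‖`, whose product dominates.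
  set M : E → ℝ≥0∞ := fun x => ‖g x‖ₑ + ‖g x‖ₑ with hM
  have hMm : Measurable M := by fun_prop
  have hM' : ∀ x, M x ≠ ⊤ := fun x => by simp [hM]
  have hMi : ∫⁻ ω, ∏ᶠ n, S.mulIndicator M (X n ω) ∂P < ⊤ := by
    refine hX.lintegral_finprod_lt_top hMm hM' hS hμ ?_
    rw [hM, lintegral_add_left (by fun_prop)]
    exact ENNReal.add_lt_top.2 ⟨hi.2, hi.2⟩
  have hmeas : ∀ f : E → ℂ, Measurable f →
      Measurable fun ω => ∏ᶠ n, S.mulIndicator f (X n ω) := fun f hf =>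
    measurable_finprod fun n => (measurable_mulIndicator hf hS).comp (hX.measurable n)
  have hbound : ∀ f : E → ℂ, (∀ x, ‖f x‖ₑ ≤ M x) → ∀ᵐ ω ∂P,
      ‖∏ᶠ n, S.mulIndicator f (X n ω)‖ₑ ≤ ∏ᶠ n, S.mulIndicator M (X n ω) := by
    intro f hf
    filter_upwards [hX.ae_finite hS hμ] with ω hω
    simp only [finprod_mulIndicator_eq_prod hω]
    rw [← ofReal_norm, norm_prod, ENNReal.ofReal_prod_of_nonneg fun _ _ => norm_nonneg _]
    exact Finset.prod_le_prod' fun n _ => by rw [ofReal_norm]; exact hf _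
  have hMae : AEMeasurable (fun ω => ∏ᶠ n, S.mulIndicator M (X n ω)) P :=
    (measurable_finprod fun n =>
      (measurable_mulIndicator hMm hS).comp (hX.measurable n)).aemeasurable
  have hMr : Integrable (fun ω => (∏ᶠ n, S.mulIndicator M (X n ω)).toReal) P :=
    integrable_toReal_of_lintegral_ne_top hMae hMi.ne
  have hMfin : ∀ᵐ ω ∂P, ∏ᶠ n, S.mulIndicator M (X n ω) < ⊤ := ae_lt_top' hMae hMi.ne
  have hbound' : ∀ f : E → ℂ, (∀ x, ‖f x‖ₑ ≤ M x) → ∀ᵐ ω ∂P,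
      ‖∏ᶠ n, S.mulIndicator f (X n ω)‖ ≤ (∏ᶠ n, S.mulIndicator M (X n ω)).toReal := by
    intro f hf
    filter_upwards [hbound f hf, hMfin] with ω h1 h2
    rw [← toReal_enorm]
    exact ENNReal.toReal_mono h2.ne h1
  refine ⟨hMr.mono' (hmeas g hg).aestronglyMeasurable (hbound' g fun x => le_self_add), ?_⟩
  set G : ℕ → SimpleFunc E ℂ := fun k => SimpleFunc.approxOn g hg univ 0 (mem_univ _) k with hG
  have hGb : ∀ k x, ‖G k x‖ ≤ ‖g x‖ + ‖g x‖ := fun k x =>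
    SimpleFunc.norm_approxOn_zero_le hg (mem_univ _) x k
  have hGb' : ∀ k x, ‖G k x‖ₑ ≤ M x := fun k x => by
    change _ ≤ ‖g x‖ₑ + ‖g x‖ₑ
    rw [← ofReal_norm, ← ofReal_norm, ← ENNReal.ofReal_add (norm_nonneg _) (norm_nonneg _)]
    exact ENNReal.ofReal_le_ofReal (hGb k x)
  have hlim : ∀ x, Tendsto (fun k => G k x) atTop (𝓝 (g x)) := fun x =>
    SimpleFunc.tendsto_approxOn hg (mem_univ _) (by simp)
  have h1 : Tendsto (fun k => ∫ ω, ∏ᶠ n, S.mulIndicator (G k) (X n ω) ∂P) atTop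
      (𝓝 (∫ ω, ∏ᶠ n, S.mulIndicator g (X n ω) ∂P)) := by
    refine tendsto_integral_of_dominated_convergence _
      (fun k => (hmeas _ (G k).measurable).aestronglyMeasurable) hMr
      (fun k => hbound' _ (hGb' k)) ?_
    filter_upwards [hX.ae_finite hS hμ] with ω hω
    simp only [finprod_mulIndicator_eq_prod hω]
    exact tendsto_finsetProd _ fun n _ => hlim _
  have h2 : Tendsto (fun k => ∫ x in S, (G k x - 1) ∂μ) atTop (𝓝 (∫ x in S, (g x - 1) ∂μ)) := by
    refine tendsto_integral_of_dominated_convergence (fun x => ‖g x‖ + ‖g x‖ + 1)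
      (fun k => ((G k).measurable.sub_const 1).aestronglyMeasurable) ?_ (fun k => ?_) ?_
    · exact (hi.norm.add hi.norm).add (integrable_const _)
    · refine ae_of_all _ fun x => (norm_sub_le _ _).trans ?_
      simpa using hGb k x
    · exact ae_of_all _ fun x => (hlim x).sub_const 1
  simp_rw [hX.integral_finprod_simpleFunc _ hS hμ] at h1
  exact tendsto_nhds_unique h1 ((Complex.continuous_exp.tendsto _).comp h2)

end Poisson

/-! ### The interfering section of a street -/

theorem streetPoint_apply_zero (θ r t : ℝ) :
    streetPoint θ r t 0 = r * Real.cos θ - t * Real.sin θ := by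
  simp [streetPoint, direction]
  ring

theorem streetPoint_apply_one (θ r t : ℝ) :
    streetPoint θ r t 1 = r * Real.sin θ + t * Real.cos θ := by
  simp [streetPoint, direction]

theorem norm_streetPoint (θ r t : ℝ) : ‖streetPoint θ r t‖ = √(r ^ 2 + t ^ 2) := by
  rw [EuclideanSpace.norm_eq, Fin.sum_univ_two, streetPoint_apply_zero, streetPoint_apply_one]
  congr 1
  simp only [Real.norm_eq_abs, sq_abs]
  linear_combination (r ^ 2 + t ^ 2) * Real.sin_sq_add_cos_sq θ

theorem inner_streetPoint_direction (θ r t : ℝ) :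
    inner ℝ (streetPoint θ r t) (direction θ) = t := by
  rw [PiLp.inner_apply, Fin.sum_univ_two, streetPoint_apply_zero, streetPoint_apply_one]
  simp [direction]
  linear_combination t * Real.sin_sq_add_cos_sq θ

/-- Interference in the coordinates `(θ, r, t)`: the bearing from the ego radar, the range, and the
bearing from the front or the rear radar of the vehicle. -/
theorem interferes_streetPoint_iff (bw RP θ r t : ℝ) :
    Interferes bw RP θ (streetPoint θ r t) ↔
      Real.cos bw < (r * Real.sin θ + t * Real.cos θ) / √(r ^ 2 + t ^ 2) ∧ √(r ^ 2 + t ^ 2) ≤ RP ∧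
        (Real.cos bw < -t / √(r ^ 2 + t ^ 2) ∨ Real.cos bw < t / √(r ^ 2 + t ^ 2)) := by
  have h0 : inner ℝ (streetPoint θ r t) (direction 0) = r * Real.sin θ + t * Real.cos θ := by
    rw [PiLp.inner_apply, Fin.sum_univ_two, streetPoint_apply_zero, streetPoint_apply_one]
    simp [direction]
  simp only [Interferes, sector, mem_ofPred_eq, sub_zero, zero_sub, norm_neg, inner_neg_left,
    inner_neg_right, neg_neg, inner_streetPoint_direction, norm_streetPoint, h0]
  tauto

theorem measurableSet_interferes (bw RP : ℝ) :
    MeasurableSet {x : (ℝ × ℝ) × ℝ | Interferes bw RP x.1.1 (streetPoint x.1.1 x.1.2 x.2)} := by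
  simp only [interferes_streetPoint_iff]
  have h1 : MeasurableSet {x : (ℝ × ℝ) × ℝ | Real.cos bw <
      (x.1.2 * Real.sin x.1.1 + x.2 * Real.cos x.1.1) / √(x.1.2 ^ 2 + x.2 ^ 2)} :=
    measurableSet_lt (by fun_prop) (by fun_prop)
  have h2 : MeasurableSet {x : (ℝ × ℝ) × ℝ | √(x.1.2 ^ 2 + x.2 ^ 2) ≤ RP} :=
    measurableSet_le (by fun_prop) (by fun_prop)
  have h3 : MeasurableSet {x : (ℝ × ℝ) × ℝ | Real.cos bw < -x.2 / √(x.1.2 ^ 2 + x.2 ^ 2)} :=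
    measurableSet_lt (by fun_prop) (by fun_prop)
  have h4 : MeasurableSet {x : (ℝ × ℝ) × ℝ | Real.cos bw < x.2 / √(x.1.2 ^ 2 + x.2 ^ 2)} :=
    measurableSet_lt (by fun_prop) (by fun_prop)
  exact h1.inter (h2.inter (h3.union h4))

theorem crossingPoint_eq_streetPoint {θ : ℝ} (r v : ℝ) (hθ : Real.sin θ ≠ 0) :
    crossingPoint θ r v = streetPoint θ r
      ((if 0 ≤ Real.cos θ then 1 else -1) * (v + crossing θ r * |Real.cos θ|)) := by
  have hd : crossing θ r * Real.sin θ = r := div_mul_cancel₀ r hθ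
  have h2 := Real.sin_sq_add_cos_sq θ
  ext i
  fin_cases i
  · simp only [Fin.zero_eta, streetPoint_apply_zero]
    split_ifs with h
    · rw [abs_of_nonneg h]
      simp [crossingPoint, direction, h]
      linear_combination Real.cos θ * hd
    · rw [abs_of_neg (not_le.1 h)]
      simp [crossingPoint, direction, h]
      linear_combination Real.cos θ * hd
  · simp only [Fin.mk_one, streetPoint_apply_one]
    split_ifs with h
    · rw [abs_of_nonneg h]
      simp [crossingPoint, direction, h]
      linear_combination Real.sin θ * hd - crossing θ r * h2
    · rw [abs_of_neg (not_le.1 h)]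
      simp [crossingPoint, direction, h]
      linear_combination Real.sin θ * hd - crossing θ r * h2

/-- Completing the square: the distance in terms of the foot of the perpendicular. -/
theorem interfererDist_eq {θ : ℝ} (r v : ℝ) (hθ : Real.sin θ ≠ 0) :
    interfererDist θ r v = √(r ^ 2 + (v + crossing θ r * |Real.cos θ|) ^ 2) := by
  have hd : crossing θ r * Real.sin θ = r := div_mul_cancel₀ r hθ
  have h2 := Real.sin_sq_add_cos_sq θ
  rw [interfererDist]
  congr 1
  have h3 := sq_abs (Real.cos θ)
  generalize crossing θ r = d at *
  rw [← hd]
  linear_combination (v ^ 2 - d ^ 2) * h2 + (v ^ 2 - d ^ 2) * h3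

theorem sin_streetAngle (θ : ℝ) : Real.sin (streetAngle θ) = |Real.sin θ| :=
  Real.sin_arcsin (by linarith [abs_nonneg (Real.sin θ)]) (Real.abs_sin_le_one θ)

theorem cos_streetAngle (θ : ℝ) : Real.cos (streetAngle θ) = |Real.cos θ| := by
  rw [streetAngle, Real.cos_arcsin, sq_abs, ← Real.abs_cos_eq_sqrt_one_sub_sin_sq]

theorem streetAngle_pos {θ : ℝ} (hθ : Real.sin θ ≠ 0) : 0 < streetAngle θ :=
  Real.arcsin_pos.2 (abs_pos.2 hθ)

theorem streetAngle_le (θ : ℝ) : streetAngle θ ≤ Real.pi / 2 := Real.arcsin_le_pi_div_two _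

/-- Polar coordinates of the point `(t, r)` of the upper half-plane. -/
theorem exists_polar {r : ℝ} (hr : 0 < r) (t : ℝ) :
    ∃ N φ : ℝ, 0 < N ∧ √(r ^ 2 + t ^ 2) = N ∧ 0 < φ ∧ φ < Real.pi ∧
      t = N * Real.cos φ ∧ r = N * Real.sin φ := by
  have hN : 0 < √(r ^ 2 + t ^ 2) := Real.sqrt_pos.2 (by positivity)
  have hsq : √(r ^ 2 + t ^ 2) ^ 2 = r ^ 2 + t ^ 2 := Real.sq_sqrt (by positivity)
  set N := √(r ^ 2 + t ^ 2)
  have h1 : |t / N| < 1 := by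
    rw [abs_div, abs_of_pos hN, div_lt_one hN]
    exact abs_lt_of_sq_lt_sq (by nlinarith) hN.le
  obtain ⟨h2, h3⟩ := abs_lt.1 h1
  refine ⟨N, Real.arccos (t / N), hN, rfl, Real.arccos_pos.2 h3, ?_, ?_, ?_⟩
  · refine lt_of_le_of_ne (Real.arccos_le_pi _) fun h => ?_
    exact absurd (Real.arccos_eq_pi.1 h) (not_le.2 h2)
  · rw [Real.cos_arccos h2.le h3.le]
    field_simp
  · rw [Real.sin_arccos, ← Real.sqrt_sq hN.le, ← Real.sqrt_mul (by positivity),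
      Real.sqrt_sq hN.le, mul_sub, div_pow, hsq, ← Real.sqrt_sq hr.le]
    congr 1
    rw [Real.sqrt_sq hr.le]
    have : r ^ 2 + t ^ 2 ≠ 0 := by positivity
    field_simp
    ring

/-- The cotangent compares the polar angle `φ` of `(t, r)` with an angle `x`. -/
theorem mul_cot_lt_iff {N φ x : ℝ} (hN : 0 < N) (hφ0 : 0 < φ) (hφ1 : φ < Real.pi) (hx0 : 0 < x)
    (hx1 : x < Real.pi) :
    N * Real.sin φ * Real.cot x < N * Real.cos φ ↔ φ < x := by
  have hs : 0 < Real.sin x := Real.sin_pos_of_pos_of_lt_pi hx0 hx1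
  have h1 : N * Real.sin φ * Real.cot x < N * Real.cos φ ↔ 0 < Real.sin (x - φ) := by
    rw [Real.cot_eq_cos_div_sin, ← mul_div_assoc, div_lt_iff₀ hs, Real.sin_sub]
    constructor
    · intro h
      refine pos_of_mul_pos_right (a := N) ?_ hN.le
      linarith
    · intro h
      have := mul_pos hN h
      linarith
  rw [h1]
  constructor
  · intro h
    by_contra hc
    have := Real.sin_nonpos_of_nonpos_of_neg_pi_le (x := x - φ) (by linarith) (by linarith)
    linarith
  · intro h
    exact Real.sin_pos_of_pos_of_lt_pi (by linarith) (by linarith)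

theorem lt_mul_cot_iff {N φ x : ℝ} (hN : 0 < N) (hφ0 : 0 < φ) (hφ1 : φ < Real.pi) (hx0 : 0 < x)
    (hx1 : x < Real.pi) :
    N * Real.cos φ < N * Real.sin φ * Real.cot x ↔ x < φ := by
  have hs : 0 < Real.sin x := Real.sin_pos_of_pos_of_lt_pi hx0 hx1
  have h1 : N * Real.cos φ < N * Real.sin φ * Real.cot x ↔ 0 < Real.sin (φ - x) := by
    rw [Real.cot_eq_cos_div_sin, ← mul_div_assoc, lt_div_iff₀ hs, Real.sin_sub]
    constructor
    · intro h
      refine pos_of_mul_pos_right (a := N) ?_ hN.le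
      linarith
    · intro h
      have := mul_pos hN h
      linarith
  rw [h1]
  constructor
  · intro h
    by_contra hc
    have := Real.sin_nonpos_of_nonpos_of_neg_pi_le (x := φ - x) (by linarith) (by linarith)
    linarith
  · intro h
    exact Real.sin_pos_of_pos_of_lt_pi (by linarith) (by linarith)

theorem cos_lt_cos_iff_of_mem {x y : ℝ} (hx0 : 0 ≤ x) (hx1 : x ≤ Real.pi) (hy0 : 0 ≤ y)
    (hy1 : y ≤ Real.pi) : Real.cos x < Real.cos y ↔ y < x :=
  Real.strictAntiOn_cos.lt_iff_gt ⟨hx0, hx1⟩ ⟨hy0, hy1⟩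

/-- Interference at the point of polar coordinates `(N, φ)` relative to the street. -/
theorem mem_interferingSection_iff {bw RP θ r v N φ : ℝ} (hθ : Real.sin θ ≠ 0) (hN0 : 0 < N)
    (hN : √(r ^ 2 + (v + crossing θ r * |Real.cos θ|) ^ 2) = N)
    (ht : v + crossing θ r * |Real.cos θ| = N * Real.cos φ) (hr : r = N * Real.sin φ) :
    v ∈ interferingSection bw RP θ r ↔
      Real.cos bw < Real.sin φ * Real.sin θ + Real.cos φ * |Real.cos θ| ∧ N ≤ RP ∧
        (Real.cos bw < -Real.cos φ ∨ Real.cos bw < Real.cos φ) := by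
  have hN' : N ≠ 0 := hN0.ne'
  change Interferes _ _ _ _ ↔ _
  rw [crossingPoint_eq_streetPoint r v hθ, interferes_streetPoint_iff]
  have h1 : (N * Real.sin φ * Real.sin θ + N * Real.cos φ * |Real.cos θ|) / N
      = Real.sin φ * Real.sin θ + Real.cos φ * |Real.cos θ| := by
    field_simp
  have h2 : N * Real.cos φ / N = Real.cos φ := by field_simp
  have h3 : -(N * Real.cos φ) / N = -Real.cos φ := by field_simp
  split_ifs with h
  · rw [one_mul, hN, ht]
    nth_rewrite 1 [hr]
    nth_rewrite 1 [← abs_of_nonneg h]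
    rw [h1, h2, h3]
  · have h4 : -1 * (v + crossing θ r * |Real.cos θ|) * Real.cos θ
        = N * Real.cos φ * |Real.cos θ| := by
      rw [ht, abs_of_neg (not_le.1 h)]
      ring
    rw [h4, mul_pow, neg_one_sq, one_mul, hN, ht]
    nth_rewrite 1 [hr]
    rw [h1, neg_one_mul, neg_neg, h2, h3, or_comm]

theorem cot_pos_of_le {x : ℝ} (hx0 : 0 < x) (hx1 : x ≤ Real.pi / 4) : 0 < Real.cot x := by
  have := Real.pi_pos
  rw [Real.cot_eq_cos_div_sin]
  exact div_pos (Real.cos_pos_of_mem_Ioo ⟨by linarith, by linarith⟩)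
    (Real.sin_pos_of_pos_of_lt_pi hx0 (by linarith))

theorem norm_le_range_iff {r t RP : ℝ} (ht : 0 < t) (hRP : 0 < RP) :
    √(r ^ 2 + t ^ 2) ≤ RP ↔ t ≤ √(RP ^ 2 - r ^ 2) := by
  rw [Real.sqrt_le_left hRP.le, Real.le_sqrt' ht]
  constructor <;> intro h <;> linarith

/-- The interfering section is an interval up to its end points: in terms of the polar angle `φ` and
the street angle `ψ` the sectors say `ψ - bw < φ < bw` if `sin θ > 0` and `φ < bw - ψ` if
`sin θ < 0`, and the cotangent translates these conditions to the position `v`. -/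
theorem interferingSection_bounds {RP bw : ℝ} (hRP : 0 < RP) (hbw0 : 0 < bw)
    (hbw1 : bw ≤ Real.pi / 4) (θ r : ℝ) (hr : 0 < r) (hθ : Real.sin θ ≠ 0) :
    Ioo (sectionStart bw θ r) (sectionEnd bw RP θ r) ⊆ interferingSection bw RP θ r ∧
      interferingSection bw RP θ r ⊆ Icc (sectionStart bw θ r) (sectionEnd bw RP θ r) := by
  have hpi := Real.pi_pos
  have hψ0 := streetAngle_pos hθ
  have hψ1 := streetAngle_le θ
  have hcb : 0 < Real.cos bw := Real.cos_pos_of_mem_Ioo ⟨by linarith, by linarith⟩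
  have key : ∀ v, (v ∈ Ioo (sectionStart bw θ r) (sectionEnd bw RP θ r) →
      v ∈ interferingSection bw RP θ r) ∧ (v ∈ interferingSection bw RP θ r →
      v ∈ Icc (sectionStart bw θ r) (sectionEnd bw RP θ r)) := by
    intro v
    obtain ⟨N, φ, hN0, hN, hφ0, hφ1, ht, hrN⟩ := exists_polar hr (v + crossing θ r * |Real.cos θ|)
    rw [mem_interferingSection_iff hθ hN0 hN ht hrN]
    have hψs := sin_streetAngle θ
    have hψc := cos_streetAngle θ
    set ψ := streetAngle θ with hψ
    set w := crossing θ r * |Real.cos θ| with hw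
    have hcot : ∀ x, 0 < x → x < Real.pi → (r * Real.cot x - w < v ↔ φ < x) := by
      intro x hx0 hx1
      rw [← mul_cot_lt_iff hN0 hφ0 hφ1 hx0 hx1, ← ht, ← hrN, sub_lt_iff_lt_add]
    have hcot' : ∀ x, 0 < x → x < Real.pi → (v < r * Real.cot x - w ↔ x < φ) := by
      intro x hx0 hx1
      rw [← lt_mul_cot_iff hN0 hφ0 hφ1 hx0 hx1, ← ht, ← hrN, lt_sub_iff_add_lt]
    have hrange : 0 < v + w → (N ≤ RP ↔ v ≤ √(RP ^ 2 - r ^ 2) - w) := by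
      intro h
      rw [← hN, norm_le_range_iff h hRP, le_sub_iff_add_le]
    rcases lt_or_gt_of_ne hθ with hneg | hpos
    · have hs : ¬ 0 < Real.sin θ := not_lt.2 hneg.le
      have hcos : Real.sin φ * Real.sin θ + Real.cos φ * |Real.cos θ| = Real.cos (φ + ψ) := by
        rw [Real.cos_add, hψs, hψc, abs_of_neg hneg]
        ring
      have hlt : Real.cos bw < Real.cos (φ + ψ) ↔ φ + ψ < bw := by
        by_cases h : φ + ψ ≤ Real.pi
        · exact cos_lt_cos_iff_of_mem hbw0.le (by linarith) (by linarith) h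
        · have := Real.cos_neg_of_pi_div_two_lt_of_lt (x := φ + ψ) (by linarith) (by linarith)
          constructor <;> intro h' <;> linarith
      rw [hcos, hlt]
      simp only [sectionStart, sectionEnd, if_neg hs, ← hψ, ← hw]
      split_ifs with hb
      -- The front and rear radars add no condition here, since `φ < bw - ψ` implies `φ < bw`.
      · have hx := hcot (bw - ψ) (by linarith) (by linarith)
        have hp : 0 < r * Real.cot (bw - ψ) :=
          mul_pos hr (cot_pos_of_le (by linarith) (by linarith))
        constructor
        · rintro ⟨h1, h2⟩
          rcases lt_max_iff.1 h2 with h3 | h3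
          · linarith
          · have h4 := hx.1 h1
            refine ⟨by linarith, (hrange (by linarith)).2 h3.le, Or.inr ?_⟩
            rw [cos_lt_cos_iff_of_mem] <;> linarith
        · rintro ⟨h1, h2, -⟩
          have h3 := hx.2 (by linarith)
          exact ⟨h3.le, le_max_of_le_right ((hrange (by linarith)).1 h2)⟩
      · constructor
        · rintro ⟨h1, h2⟩
          linarith
        · rintro ⟨h1, -⟩
          linarith
    · have hcos : Real.sin φ * Real.sin θ + Real.cos φ * |Real.cos θ| = Real.cos (φ - ψ) := by
        rw [Real.cos_sub, hψs, hψc, abs_of_pos hpos]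
        ring
      have hlt : Real.cos bw < Real.cos (φ - ψ) ↔ |φ - ψ| < bw := by
        rw [← Real.cos_abs (φ - ψ)]
        exact cos_lt_cos_iff_of_mem hbw0.le (by linarith) (abs_nonneg _)
          (abs_le.2 ⟨by linarith, by linarith⟩)
      have hlt2 : Real.cos bw < Real.cos φ ↔ φ < bw :=
        cos_lt_cos_iff_of_mem hbw0.le (by linarith) hφ0.le hφ1.le
      have hlt3 : Real.cos bw < -Real.cos φ ↔ Real.pi - φ < bw := by
        rw [← Real.cos_pi_sub]
        exact cos_lt_cos_iff_of_mem hbw0.le (by linarith) (by linarith) (by linarith)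
      -- The case `π - φ < bw` of the rear radar is excluded by `φ < ψ + bw`, as `bw ≤ π / 4`.
      rw [hcos, hlt, hlt2, hlt3, abs_lt]
      have hx := hcot bw hbw0 (by linarith)
      have hp : 0 < r * Real.cot bw := mul_pos hr (cot_pos_of_le hbw0 hbw1)
      simp only [sectionStart, sectionEnd, if_pos hpos, ← hψ, ← hw]
      split_ifs with hb
      · constructor
        · rintro ⟨h1, h2⟩
          have h4 := hx.1 h1
          rcases lt_max_iff.1 h2 with h3 | h3
          · linarith
          · exact ⟨⟨by linarith, by linarith⟩, (hrange (by linarith)).2 h3.le, Or.inr h4⟩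
        · rintro ⟨⟨h1, h2⟩, h3, h4⟩
          have h5 : φ < bw := by rcases h4 with h4 | h4 <;> linarith
          have h6 := hx.2 h5
          exact ⟨h6.le, le_max_of_le_right ((hrange (by linarith)).1 h3)⟩
      · have hy := hcot' (ψ - bw) (by linarith) (by linarith)
        constructor
        · rintro ⟨h1, h2⟩
          have h4 := hx.1 h1
          rcases lt_max_iff.1 h2 with h3 | h3
          · linarith
          · rw [← min_sub_sub_right, lt_min_iff] at h3
            have h5 := hy.1 h3.2
            exact ⟨⟨by linarith, by linarith⟩, (hrange (by linarith)).2 h3.1.le, Or.inr h4⟩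
        · rintro ⟨⟨h1, h2⟩, h3, h4⟩
          have h5 : φ < bw := by rcases h4 with h4 | h4 <;> linarith
          have h6 := hx.2 h5
          refine ⟨h6.le, le_max_of_le_right ?_⟩
          rw [← min_sub_sub_right]
          exact le_min ((hrange (by linarith)).1 h3) (hy.2 (by linarith)).le
  exact ⟨fun v => (key v).1, fun v => (key v).2⟩

/-! ### Exponential random variables -/

theorem expMeasure_Ioi {r y : ℝ} (hr : 0 < r) (hy : 0 ≤ y) :
    expMeasure r (Ioi y) = ENNReal.ofReal (Real.exp (-(r * y))) := by
  have : IsProbabilityMeasure (expMeasure r) := isProbabilityMeasure_expMeasure hr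
  have h1 := cdf_expMeasure_eq hr y
  rw [cdf_eq_real, if_pos hy] at h1
  rw [← compl_Iic, prob_compl_eq_one_sub measurableSet_Iic, ← ofReal_measureReal, h1,
    ← ENNReal.ofReal_one, ← ENNReal.ofReal_sub _ (by
      rw [sub_nonneg, Real.exp_le_one_iff]
      have := mul_nonneg hr.le hy
      linarith)]
  congr 1
  ring

theorem lintegral_expMeasure_exp_neg {s : ℝ} (hs : 0 ≤ s) :
    ∫⁻ y, ENNReal.ofReal (Real.exp (-(s * y))) ∂(expMeasure 1) = ENNReal.ofReal (1 / (1 + s)) := by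
  have hs' : 0 < 1 + s := by linarith
  change ∫⁻ y, ENNReal.ofReal (Real.exp (-(s * y))) ∂(volume.withDensity (exponentialPDF 1)) = _
  rw [lintegral_withDensity_eq_lintegral_mul _
    (show Measurable (exponentialPDF 1) from (measurable_exponentialPDFReal 1).ennreal_ofReal)
    (by fun_prop)]
  have h1 : ∀ y, (exponentialPDF 1 * fun y => ENNReal.ofReal (Real.exp (-(s * y)))) y
      = ENNReal.ofReal (1 / (1 + s)) * exponentialPDF (1 + s) y := by
    intro y
    rw [Pi.mul_apply]
    rcases lt_or_ge y 0 with hy | hy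
    · rw [exponentialPDF_of_neg hy, exponentialPDF_of_neg hy, zero_mul, mul_zero]
    · rw [exponentialPDF_of_nonneg hy, exponentialPDF_of_nonneg hy,
        ← ENNReal.ofReal_mul (by positivity), ← ENNReal.ofReal_mul (by positivity)]
      congr 1
      have h2 : Real.exp (-((1 + s) * y)) = Real.exp (-(1 * y)) * Real.exp (-(s * y)) := by
        rw [← Real.exp_add]
        congr 1
        ring
      rw [h2]
      field_simp
  simp_rw [h1]
  rw [lintegral_const_mul _ (show Measurable (exponentialPDF (1 + s)) from
    (measurable_exponentialPDFReal _).ennreal_ofReal),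
    lintegral_exponentialPDF_eq_one hs', mul_one]

theorem ae_expMeasure_pos {r : ℝ} (hr : 0 < r) : ∀ᵐ y ∂(expMeasure r), 0 < y := by
  have : IsProbabilityMeasure (expMeasure r) := isProbabilityMeasure_expMeasure hr
  have h1 : expMeasure r (Ioi 0) = 1 := by rw [expMeasure_Ioi hr le_rfl]; simp
  exact (mem_ae_iff_prob_eq_one measurableSet_Ioi).2 h1

/-! ### Independence of the sources of randomness -/

section Network

variable {Ω : Type*} [MeasurableSpace Ω] {P : Measure Ω} [IsProbabilityMeasure P]
  {lamL lam p sbar : ℝ} {q : ℕ → Ω → ℝ × ℝ} {t : ℕ → ℕ → Ω → ℝ} {rcs : Ω → ℝ}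
  {h : ℕ → ℕ → Ω → ℝ} {act : ℕ → ℕ → Ω → Bool}

/-- The σ-algebra generated by a set of sources of randomness. -/
@[reducible] def sourcesSigma {Ω : Type*} (q : ℕ → Ω → ℝ × ℝ) (t : ℕ → ℕ → Ω → ℝ) (rcs : Ω → ℝ)
    (h : ℕ → ℕ → Ω → ℝ) (act : ℕ → ℕ → Ω → Bool) (S : Set Source) : MeasurableSpace Ω :=
  ⨆ s ∈ S, sourceSigma q t rcs h act s

theorem sourceSigma_le_sourcesSigma {S : Set Source} {s : Source} (hs : s ∈ S) :
    sourceSigma q t rcs h act s ≤ sourcesSigma q t rcs h act S :=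
  le_biSup (sourceSigma q t rcs h act) hs

theorem IsNetwork.sourceSigma_le (hnet : IsNetwork P lamL lam p sbar q t rcs h act) (s : Source) :
    sourceSigma q t rcs h act s ≤ ‹MeasurableSpace Ω› := by
  cases s with
  | lines => exact iSup_le fun n => (hnet.lines.measurable n).comap_le
  | vehicles i => exact iSup_le fun j => ((hnet.vehicles i).measurable j).comap_le
  | rcs => exact hnet.rcs_measurable.comap_le
  | fading i j => exact (hnet.fading_measurable i j).comap_le
  | access i j => exact (hnet.access_measurable i j).comap_le

theorem IsNetwork.indep_of_disjoint (hnet : IsNetwork P lamL lam p sbar q t rcs h act)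
    {S T : Set Source} (hST : Disjoint S T) :
    Indep (sourcesSigma q t rcs h act S) (sourcesSigma q t rcs h act T) P :=
  indep_iSup_of_disjoint hnet.sourceSigma_le hnet.indep hST

theorem IsNetwork.sourcesSigma_le (hnet : IsNetwork P lamL lam p sbar q t rcs h act)
    (S : Set Source) : sourcesSigma q t rcs h act S ≤ ‹MeasurableSpace Ω› :=
  iSup₂_le fun s _ => hnet.sourceSigma_le s

theorem measurable_line_of_mem {S : Set Source} (hS : Source.lines ∈ S) (n : ℕ) :
    Measurable[sourcesSigma q t rcs h act S] (q n) :=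
  (comap_measurable (q n)).mono
    ((le_iSup (fun n => MeasurableSpace.comap (q n) inferInstance) n).trans
      (sourceSigma_le_sourcesSigma hS)) le_rfl

theorem measurable_vehicles_of_mem {S : Set Source} {i : ℕ} (hS : Source.vehicles i ∈ S) (j : ℕ) :
    Measurable[sourcesSigma q t rcs h act S] (t i j) :=
  (comap_measurable (t i j)).mono
    ((le_iSup (fun j => MeasurableSpace.comap (t i j) inferInstance) j).trans
      (sourceSigma_le_sourcesSigma hS)) le_rfl

theorem measurable_rcs_of_mem {S : Set Source} (hS : Source.rcs ∈ S) :
    Measurable[sourcesSigma q t rcs h act S] rcs :=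
  (comap_measurable rcs).mono (sourceSigma_le_sourcesSigma hS) le_rfl

theorem measurable_fading_of_mem {S : Set Source} {i j : ℕ} (hS : Source.fading i j ∈ S) :
    Measurable[sourcesSigma q t rcs h act S] (h i j) :=
  (comap_measurable (h i j)).mono (sourceSigma_le_sourcesSigma hS) le_rfl

theorem measurable_access_of_mem {S : Set Source} {i j : ℕ} (hS : Source.access i j ∈ S) :
    Measurable[sourcesSigma q t rcs h act S] (act i j) :=
  (comap_measurable (act i j)).mono (sourceSigma_le_sourcesSigma hS) le_rfl

/-! ### Success probability for a fixed configuration of interferers -/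

theorem IsNetwork.ae_rcs_pos (hnet : IsNetwork P lamL lam p sbar q t rcs h act) (hs : 0 < sbar) :
    ∀ᵐ ω ∂P, 0 < rcs ω := by
  have h1 := ae_expMeasure_pos (one_div_pos.2 hs)
  rw [← hnet.rcs_law] at h1
  exact ae_of_ae_map hnet.rcs_measurable.aemeasurable h1

theorem IsNetwork.ae_fading_pos (hnet : IsNetwork P lamL lam p sbar q t rcs h act) :
    ∀ᵐ ω ∂P, ∀ i j, 0 < h i j ω := by
  refine ae_all_iff.2 fun i => ae_all_iff.2 fun j => ?_
  have h1 := ae_expMeasure_pos one_pos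
  rw [← hnet.fading_law i j] at h1
  exact ae_of_ae_map (hnet.fading_measurable i j).aemeasurable h1

theorem measurable_fading_term {Ω' : Type*} {_ : MeasurableSpace Ω'} {f : Ω' → ℝ} {a : Ω' → Bool}
    (hf : Measurable f) (ha : Measurable a) (c : ℝ) :
    Measurable fun ω => if a ω = true then f ω * c else 0 :=
  Measurable.ite (ha (measurableSet_singleton true)) (hf.mul_const c) measurable_const

theorem measurable_indicator_access {Ω' : Type*} {_ : MeasurableSpace Ω'} {a : Ω' → Bool}
    (ha : Measurable a) : Measurable ({ω | a ω = true}.indicator (1 : Ω' → ℝ≥0∞)) :=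
  measurable_one.indicator (ha (measurableSet_singleton true))

theorem factor_pos {α β' w : ℝ} (hp0 : 0 ≤ p) (hp1 : p ≤ 1) (hβ : 0 ≤ β') (hw : 0 ≤ w) :
    0 < factor p α β' w := by
  have h1 : 0 ≤ β' * w ^ (-α) := mul_nonneg hβ (Real.rpow_nonneg hw _)
  rw [factor]
  rcases hp1.lt_or_eq with hp | rfl
  · have := div_nonneg hp0 (by linarith : 0 ≤ 1 + β' * w ^ (-α))
    linarith
  · have := div_pos one_pos (by linarith : 0 < 1 + β' * w ^ (-α))
    linarith

theorem factor_le_one {α β' w : ℝ} (hp0 : 0 ≤ p) (hβ : 0 ≤ β') (hw : 0 ≤ w) :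
    factor p α β' w ≤ 1 := by
  have h1 : 0 ≤ β' * w ^ (-α) := mul_nonneg hβ (Real.rpow_nonneg hw _)
  have := div_le_self hp0 (by linarith : 1 ≤ 1 + β' * w ^ (-α))
  rw [factor]
  linarith

/-- The Laplace transform at `x` of the contribution of one vehicle: it transmits with
probability `p`, with an exponential fading. -/
theorem IsNetwork.lintegral_exp_neg_term (hnet : IsNetwork P lamL lam p sbar q t rcs h act)
    (hp0 : 0 ≤ p) (hp1 : p ≤ 1) {x c : ℝ} (hx : 0 ≤ x) (hc : 0 ≤ c) (i j : ℕ) :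
    ∫⁻ ω, ENNReal.ofReal (Real.exp (-(x * if act i j ω = true then h i j ω * c else 0))) ∂P
      = ENNReal.ofReal (p / (1 + x * c) + 1 - p) := by
  have hA : MeasurableSet {ω | act i j ω = true} :=
    hnet.access_measurable i j (measurableSet_singleton true)
  have hind : Indep (sourcesSigma q t rcs h act ({Source.fading i j} : Set Source))
      (sourcesSigma q t rcs h act ({Source.access i j} : Set Source)) P :=
    hnet.indep_of_disjoint (by simp)
  have hxc : 0 ≤ x * c := mul_nonneg hx hc
  set f : Ω → ℝ≥0∞ := fun ω => ENNReal.ofReal (Real.exp (-(x * c * h i j ω))) with hf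
  have h1 : ∀ ω, ENNReal.ofReal (Real.exp (-(x * if act i j ω = true then h i j ω * c else 0)))
      = f ω * {ω | act i j ω = true}.indicator 1 ω + {ω | act i j ω = true}ᶜ.indicator 1 ω := by
    intro ω
    by_cases ha : act i j ω = true
    · simp [ha, hf, mul_comm, mul_left_comm]
    · simp [ha]
  have hfm : Measurable[sourcesSigma q t rcs h act ({Source.fading i j} : Set Source)] f := by
    have : Measurable fun y : ℝ => ENNReal.ofReal (Real.exp (-(x * c * y))) := by fun_prop
    exact this.comp (measurable_fading_of_mem (mem_singleton _))
  have hfm' : Measurable f := hfm.mono (hnet.sourcesSigma_le _) le_rfl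
  have ham : Measurable[sourcesSigma q t rcs h act {Source.access i j}] (act i j) :=
    measurable_access_of_mem (mem_singleton _)
  have hgm : Measurable[sourcesSigma q t rcs h act ({Source.access i j} : Set Source)]
      ({ω | act i j ω = true}.indicator (1 : Ω → ℝ≥0∞)) :=
    measurable_indicator_access ham
  have hint : ∫⁻ ω, f ω ∂P = ENNReal.ofReal (1 / (1 + x * c)) := by
    rw [← lintegral_expMeasure_exp_neg hxc, ← hnet.fading_law i j,
      lintegral_map (by fun_prop) (hnet.fading_measurable i j)]
  have hp1' : ENNReal.ofReal p ≤ 1 := ENNReal.ofReal_le_one.2 hp1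
  simp_rw [h1]
  rw [lintegral_add_right _ (measurable_one.indicator hA.compl),
    lintegral_mul_eq_lintegral_mul_lintegral_of_independent_measurableSpace
      (hnet.sourcesSigma_le _) (hnet.sourcesSigma_le _) hind hfm hgm,
    lintegral_indicator_one hA, lintegral_indicator_one hA.compl, prob_compl_eq_one_sub hA,
    hnet.access_law, hint, ← ENNReal.ofReal_one, ← ENNReal.ofReal_sub _ hp0,
    ← ENNReal.ofReal_mul (by positivity), ← ENNReal.ofReal_add (by positivity) (by linarith)]
  congr 1
  ring

/-- The contributions of finitely many vehicles are independent, so that their Laplace transforms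
multiply. -/
theorem IsNetwork.lintegral_exp_neg_sum (hnet : IsNetwork P lamL lam p sbar q t rcs h act)
    (hp0 : 0 ≤ p) (hp1 : p ≤ 1) {x : ℝ} (hx : 0 ≤ x) (D : Finset (ℕ × ℕ)) {c : ℕ × ℕ → ℝ}
    (hc : ∀ ij, 0 ≤ c ij) :
    ∫⁻ ω, ENNReal.ofReal (Real.exp
        (-(x * ∑ ij ∈ D, if act ij.1 ij.2 ω = true then h ij.1 ij.2 ω * c ij else 0))) ∂P
      = ∏ ij ∈ D, ENNReal.ofReal (p / (1 + x * c ij) + 1 - p) := by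
  classical
  have hexp : Measurable fun y : ℝ => ENNReal.ofReal (Real.exp (-(x * y))) := by fun_prop
  induction D using Finset.induction_on with
  | empty => simp
  | insert a D ha ih =>
    rw [Finset.prod_insert ha, ← ih, ← hnet.lintegral_exp_neg_term hp0 hp1 hx (hc a) a.1 a.2]
    simp_rw [Finset.sum_insert ha, mul_add, neg_add, Real.exp_add,
      ENNReal.ofReal_mul (Real.exp_pos _).le]
    have hdisj : Disjoint ({Source.fading a.1 a.2, Source.access a.1 a.2} : Set Source)
        (⋃ ij ∈ D, {Source.fading ij.1 ij.2, Source.access ij.1 ij.2}) := by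
      refine Set.disjoint_left.2 fun s h1 h2 => ?_
      simp only [mem_iUnion, mem_insert_iff, mem_singleton_iff] at h1 h2
      obtain ⟨ij, hij, h3⟩ := h2
      refine ha ?_
      have : a = ij := by
        rcases h1 with rfl | rfl <;> rcases h3 with h3 | h3 <;> simp at h3 <;>
          exact Prod.ext h3.1 h3.2
      rwa [this]
    refine lintegral_mul_eq_lintegral_mul_lintegral_of_independent_measurableSpace
      (hnet.sourcesSigma_le _) (hnet.sourcesSigma_le _) (hnet.indep_of_disjoint hdisj)
      (hexp.comp ?_) (hexp.comp ?_)
    · exact measurable_fading_term (measurable_fading_of_mem (by simp))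
        (measurable_access_of_mem (by simp)) _
    · refine Finset.measurable_fun_sum _ fun ij hij => ?_
      refine measurable_fading_term (measurable_fading_of_mem ?_) (measurable_access_of_mem ?_) _
      · exact mem_biUnion hij (by simp)
      · exact mem_biUnion hij (by simp)

/-- The radar cross-section exceeds a weighted sum of the fading powers of finitely many
transmitting vehicles with a probability that factorizes over the vehicles. -/
theorem IsNetwork.measure_sum_lt_rcs (hnet : IsNetwork P lamL lam p sbar q t rcs h act)
    (hp0 : 0 ≤ p) (hp1 : p ≤ 1) (hs : 0 < sbar) {x : ℝ} (hx : 0 ≤ x) (D : Finset (ℕ × ℕ))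
    {c : ℕ × ℕ → ℝ} (hc : ∀ ij, 0 ≤ c ij) :
    P {ω | sbar * (x * ∑ ij ∈ D, if act ij.1 ij.2 ω = true then h ij.1 ij.2 ω * c ij else 0)
        < rcs ω}
      = ∏ ij ∈ D, ENNReal.ofReal (p / (1 + x * c ij) + 1 - p) := by
  set J : Ω → ℝ := fun ω =>
    sbar * (x * ∑ ij ∈ D, if act ij.1 ij.2 ω = true then h ij.1 ij.2 ω * c ij else 0) with hJ
  have hJ0 : ∀ᵐ ω ∂P, 0 ≤ J ω := by
    filter_upwards [hnet.ae_fading_pos] with ω hω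
    refine mul_nonneg hs.le (mul_nonneg hx (Finset.sum_nonneg fun ij _ => ?_))
    split_ifs
    · exact mul_nonneg (hω _ _).le (hc _)
    · exact le_rfl
  have hJm' : Measurable[sourcesSigma q t rcs h act ({Source.rcs}ᶜ : Set Source)] J := by
    refine Measurable.const_mul (Measurable.const_mul
      (Finset.measurable_fun_sum _ fun ij _ => ?_) _) _
    exact measurable_fading_term (measurable_fading_of_mem (by simp))
      (measurable_access_of_mem (by simp)) _
  have hJm : Measurable J := hJm'.mono (hnet.sourcesSigma_le _) le_rfl
  have hind : J ⟂ᵢ[P] rcs := by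
    rw [IndepFun_iff_Indep]
    have hrm : Measurable[sourcesSigma q t rcs h act {Source.rcs}] rcs :=
      measurable_rcs_of_mem (mem_singleton _)
    exact indep_of_indep_of_le_left (indep_of_indep_of_le_right
      (hnet.indep_of_disjoint (disjoint_compl_left (a := ({Source.rcs} : Set Source))))
      hrm.comap_le) hJm'.comap_le
  have hset : MeasurableSet {z : ℝ × ℝ | z.1 < z.2} :=
    measurableSet_lt measurable_fst measurable_snd
  have : IsProbabilityMeasure (P.map rcs) :=
    Measure.isProbabilityMeasure_map hnet.rcs_measurable.aemeasurable
  have h1 : P {ω | J ω < rcs ω} = P.map (fun ω => (J ω, rcs ω)) {z : ℝ × ℝ | z.1 < z.2} := by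
    rw [Measure.map_apply (hJm.prodMk hnet.rcs_measurable) hset]
    rfl
  rw [h1, (indepFun_iff_map_prod_eq_prod_map_map hJm.aemeasurable
    hnet.rcs_measurable.aemeasurable).1 hind, Measure.prod_apply hset,
    lintegral_map (measurable_measure_prodMk_left hset) hJm,
    ← hnet.lintegral_exp_neg_sum hp0 hp1 hx D hc]
  refine lintegral_congr_ae ?_
  -- Conditionally on `J`, the exponential tail of the cross-section is a Laplace transform of `J`.
  filter_upwards [hJ0] with ω hω
  change P.map rcs (Ioi (J ω)) = _
  rw [hnet.rcs_law, expMeasure_Ioi (one_div_pos.2 hs) hω, hJ]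
  congr 3
  field_simp

end Network

/-! ### The conditional success probability -/

open Classical in
/-- The factor of the conditional success probability that is due to a vehicle at signed distance
`t` from the foot point on the street `s = (θ, r)`; it is `1` if the vehicle does not interfere. -/
def vehicleFactor (bw RP p α β' : ℝ) (s : ℝ × ℝ) (t : ℝ) : ℝ :=
  if Interferes bw RP s.1 (streetPoint s.1 s.2 t) then factor p α β' ‖streetPoint s.1 s.2 t‖ else 1

theorem measurable_norm_streetPoint :
    Measurable fun x : (ℝ × ℝ) × ℝ => ‖streetPoint x.1.1 x.1.2 x.2‖ := by
  simp_rw [norm_streetPoint]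
  fun_prop

theorem measurable_factor (p α β' : ℝ) : Measurable (factor p α β') := by
  unfold factor
  fun_prop

theorem measurable_vehicleFactor (bw RP p α β' : ℝ) :
    Measurable fun x : (ℝ × ℝ) × ℝ => vehicleFactor bw RP p α β' x.1 x.2 :=
  Measurable.ite (measurableSet_interferes bw RP)
    ((measurable_factor p α β').comp measurable_norm_streetPoint) measurable_const

theorem vehicleFactor_pos {bw RP p α β' : ℝ} (hp0 : 0 ≤ p) (hp1 : p ≤ 1) (hβ : 0 ≤ β')
    (s : ℝ × ℝ) (t : ℝ) : 0 < vehicleFactor bw RP p α β' s t := by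
  rw [vehicleFactor]
  split_ifs
  · exact factor_pos hp0 hp1 hβ (norm_nonneg _)
  · exact one_pos

theorem vehicleFactor_le_one {bw RP p α β' : ℝ} (hp0 : 0 ≤ p) (hβ : 0 ≤ β') (s : ℝ × ℝ) (t : ℝ) :
    vehicleFactor bw RP p α β' s t ≤ 1 := by
  rw [vehicleFactor]
  split_ifs
  · exact factor_le_one hp0 hβ (norm_nonneg _)
  · exact le_rfl

theorem Interferes.abs_le {bw RP θ r t : ℝ} (h : Interferes bw RP θ (streetPoint θ r t)) :
    |r| ≤ RP ∧ |t| ≤ RP := by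
  have h1 := ((interferes_streetPoint_iff bw RP θ r t).1 h).2.1
  refine ⟨le_trans (Real.abs_le_sqrt ?_) h1, le_trans (Real.abs_le_sqrt ?_) h1⟩ <;>
    nlinarith [sq_nonneg r, sq_nonneg t]

theorem measurable_street {Ω' : Type*} {_ : MeasurableSpace Ω'} {q : ℕ → Ω' → ℝ × ℝ}
    (hq : ∀ n, Measurable (q n)) (i : ℕ) : Measurable (street q i) := by
  cases i with
  | zero => exact measurable_const
  | succ i => exact hq i

open Classical in
/-- The power received from a vehicle at signed distance `t` from the foot point on the street
`s = (θ, r)`, with fading power `h` and access decision `a`. -/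
def vehiclePower (γ Ptx α bw RP : ℝ) (s : ℝ × ℝ) (t h : ℝ) (a : Bool) : ℝ :=
  if Interferes bw RP s.1 (streetPoint s.1 s.2 t) ∧ a = true
  then 4 * Real.pi * γ * Ptx * h * ‖streetPoint s.1 s.2 t‖ ^ (-α) else 0

/-- The signal fraction for a deterministic configuration `x` of streets and vehicles and
deterministic marks `y`. -/
def fractionAt (γ Ptx α R bw RP : ℝ) (x : (ℕ → ℝ × ℝ) × (ℕ → ℕ → ℝ))
    (y : ℝ × (ℕ → ℕ → ℝ) × (ℕ → ℕ → Bool)) : ℝ :=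
  signal γ Ptx α R (fun _ : Unit => y.1) () / (signal γ Ptx α R (fun _ : Unit => y.1) ()
    + ∑' ij : ℕ × ℕ, vehiclePower γ Ptx α bw RP (x.1 ij.1) (x.2 ij.1 ij.2) (y.2.1 ij.1 ij.2)
        (y.2.2 ij.1 ij.2))

theorem measurable_fractionAt (γ Ptx α R bw RP : ℝ) :
    Measurable fun z : ((ℕ → ℝ × ℝ) × (ℕ → ℕ → ℝ)) × (ℝ × (ℕ → ℕ → ℝ) × (ℕ → ℕ → Bool)) =>
      fractionAt γ Ptx α R bw RP z.1 z.2 := by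
  unfold fractionAt signal
  refine Measurable.div (by fun_prop) (Measurable.add (by fun_prop) (Measurable.tsum fun ij => ?_))
  have hx : Measurable fun z : ((ℕ → ℝ × ℝ) × (ℕ → ℕ → ℝ)) × (ℝ × (ℕ → ℕ → ℝ) × (ℕ → ℕ → Bool)) =>
    (z.1.1 ij.1, z.1.2 ij.1 ij.2) := by fun_prop
  have ha : Measurable fun z : ((ℕ → ℝ × ℝ) × (ℕ → ℕ → ℝ)) × (ℝ × (ℕ → ℕ → ℝ) × (ℕ → ℕ → Bool)) =>
    z.2.2.2 ij.1 ij.2 := by fun_prop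
  have hh : Measurable fun z : ((ℕ → ℝ × ℝ) × (ℕ → ℕ → ℝ)) × (ℝ × (ℕ → ℕ → ℝ) × (ℕ → ℕ → Bool)) =>
    z.2.2.1 ij.1 ij.2 := by fun_prop
  refine Measurable.ite ?_ ?_ measurable_const
  · exact (hx (measurableSet_interferes bw RP)).inter (ha (measurableSet_singleton true))
  · exact (hh.const_mul _).mul ((measurable_norm_streetPoint.comp hx).pow_const _)

section Network

variable {Ω : Type*} [MeasurableSpace Ω] {P : Measure Ω} [IsProbabilityMeasure P]
  {lamL lam p sbar : ℝ} {q : ℕ → Ω → ℝ × ℝ} {t : ℕ → ℕ → Ω → ℝ} {rcs : Ω → ℝ}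
  {h : ℕ → ℕ → Ω → ℝ} {act : ℕ → ℕ → Ω → Bool}

theorem vehicles_intensity_Icc_lt_top (lam RP : ℝ) :
    (ENNReal.ofReal lam • (volume : Measure ℝ)) (Icc (-RP) RP) < ⊤ := by
  rw [Measure.smul_apply, Real.volume_Icc, smul_eq_mul]
  exact ENNReal.mul_lt_top ENNReal.ofReal_lt_top ENNReal.ofReal_lt_top

theorem lines_intensity_strip_lt_top (lamL RP : ℝ) :
    (ENNReal.ofReal lamL • (volume : Measure (ℝ × ℝ)).restrict (Ico 0 Real.pi ×ˢ univ))
      (univ ×ˢ Icc (-RP) RP) < ⊤ := by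
  rw [Measure.smul_apply, Measure.restrict_apply (MeasurableSet.univ.prod measurableSet_Icc),
    prod_inter_prod, univ_inter, inter_univ, Measure.volume_eq_prod, Measure.prod_prod,
    Real.volume_Icc, Real.volume_Ico, smul_eq_mul]
  exact ENNReal.mul_lt_top ENNReal.ofReal_lt_top
    (ENNReal.mul_lt_top ENNReal.ofReal_lt_top ENNReal.ofReal_lt_top)

theorem IsNetwork.ae_finite_lines (hnet : IsNetwork P lamL lam p sbar q t rcs h act) (RP : ℝ) :
    ∀ᵐ ω ∂P, {i | |(street q i ω).2| ≤ RP}.Finite := by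
  filter_upwards [hnet.lines.ae_finite (MeasurableSet.univ.prod measurableSet_Icc)
    (lines_intensity_strip_lt_top lamL RP)] with ω hω
  refine ((hω.image Nat.succ).union (finite_singleton 0)).subset fun i hi => ?_
  cases i with
  | zero => exact Or.inr rfl
  | succ i => exact Or.inl ⟨i, ⟨mem_univ _, abs_le.1 hi⟩, rfl⟩

/-- Almost surely, finitely many vehicles are at a distance to the foot point of at most `RP` on a
street at distance at most `RP`. -/
theorem IsNetwork.ae_finite_near (hnet : IsNetwork P lamL lam p sbar q t rcs h act) (RP : ℝ) :
    ∀ᵐ ω ∂P, {ij : ℕ × ℕ | |(street q ij.1 ω).2| ≤ RP ∧ |t ij.1 ij.2 ω| ≤ RP}.Finite := by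
  have h1 : ∀ᵐ ω ∂P, ∀ i, {j | t i j ω ∈ Icc (-RP) RP}.Finite := ae_all_iff.2 fun i =>
    (hnet.vehicles i).ae_finite measurableSet_Icc (vehicles_intensity_Icc_lt_top lam RP)
  filter_upwards [h1, hnet.ae_finite_lines RP] with ω hω hl
  refine (hl.biUnion fun i _ => (hω i).image (Prod.mk i)).subset ?_
  rintro ⟨i, j⟩ ⟨h2, h3⟩
  exact mem_biUnion h2 ⟨j, abs_le.1 h3, rfl⟩

theorem IsNetwork.ae_finite_interferes (hnet : IsNetwork P lamL lam p sbar q t rcs h act)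
    (bw RP : ℝ) :
    ∀ᵐ ω ∂P,
      {ij : ℕ × ℕ | Interferes bw RP (street q ij.1 ω).1 (vehicle q t ij.1 ij.2 ω)}.Finite := by
  filter_upwards [hnet.ae_finite_near RP] with ω hω
  exact hω.subset fun ij hij => Interferes.abs_le hij

theorem scaledThreshold_nonneg {α R sbar β : ℝ} (hR : 0 < R) (hs : 0 < sbar) (hβ0 : 0 ≤ β)
    (hβ1 : β < 1) : 0 ≤ scaledThreshold α R sbar β := by
  have := Real.rpow_pos_of_pos hR (-2 * α)
  have := Real.pi_pos
  exact div_nonneg (by positivity) (mul_nonneg (by positivity) (by linarith))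

/-- The radar cross-section, the fading powers and the access decisions. -/
def marks (rcs : Ω → ℝ) (h : ℕ → ℕ → Ω → ℝ) (act : ℕ → ℕ → Ω → Bool) (ω : Ω) :
    ℝ × (ℕ → ℕ → ℝ) × (ℕ → ℕ → Bool) :=
  (rcs ω, (fun i j => h i j ω), fun i j => act i j ω)

/-- The success probability for a deterministic configuration `x` of streets and vehicles. -/
theorem IsNetwork.measure_success (hnet : IsNetwork P lamL lam p sbar q t rcs h act)
    (hp0 : 0 ≤ p) (hp1 : p ≤ 1) (hs : 0 < sbar) {γ Ptx α R bw RP β : ℝ} (hγ : 0 < γ)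
    (hPtx : 0 < Ptx) (hR : 0 < R) (hβ0 : 0 ≤ β) (hβ1 : β < 1)
    (x : (ℕ → ℝ × ℝ) × (ℕ → ℕ → ℝ))
    (hfin : {ij : ℕ × ℕ | Interferes bw RP (x.1 ij.1).1
      (streetPoint (x.1 ij.1).1 (x.1 ij.1).2 (x.2 ij.1 ij.2))}.Finite) :
    P {ω | β < fractionAt γ Ptx α R bw RP x (marks rcs h act ω)}
      = ENNReal.ofReal (∏ᶠ ij : ℕ × ℕ,
          vehicleFactor bw RP p α (scaledThreshold α R sbar β) (x.1 ij.1) (x.2 ij.1 ij.2)) := by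
  have hβ' := scaledThreshold_nonneg (α := α) hR hs hβ0 hβ1
  set c : ℕ × ℕ → ℝ := fun ij =>
    ‖streetPoint (x.1 ij.1).1 (x.1 ij.1).2 (x.2 ij.1 ij.2)‖ ^ (-α) with hc
  have hc0 : ∀ ij, 0 ≤ c ij := fun ij => Real.rpow_nonneg (norm_nonneg _) _
  have hprod : ∏ᶠ ij : ℕ × ℕ,
        vehicleFactor bw RP p α (scaledThreshold α R sbar β) (x.1 ij.1) (x.2 ij.1 ij.2)
      = ∏ ij ∈ hfin.toFinset, (p / (1 + scaledThreshold α R sbar β * c ij) + 1 - p) := by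
    rw [finprod_eq_prod_of_mulSupport_subset (s := hfin.toFinset)]
    · refine Finset.prod_congr rfl fun ij hij => ?_
      exact if_pos (by simpa using hij)
    · intro ij hij
      by_contra hn
      exact hij (if_neg (by simpa using hn))
  have hterm : ∀ ij, 0 ≤ p / (1 + scaledThreshold α R sbar β * c ij) + 1 - p := fun ij =>
    (factor_pos hp0 hp1 hβ' (norm_nonneg _)).le
  rw [hprod, ENNReal.ofReal_prod_of_nonneg fun ij _ => hterm ij,
    ← hnet.measure_sum_lt_rcs hp0 hp1 hs hβ' hfin.toFinset hc0]
  refine measure_congr ?_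
  filter_upwards [hnet.ae_rcs_pos hs, hnet.ae_fading_pos] with ω hr hh
  refine propext ?_
  change β < signal γ Ptx α R (fun _ : Unit => rcs ω) () /
    (signal γ Ptx α R (fun _ : Unit => rcs ω) () + ∑' ij : ℕ × ℕ, vehiclePower γ Ptx α bw RP
      (x.1 ij.1) (x.2 ij.1 ij.2) (h ij.1 ij.2 ω) (act ij.1 ij.2 ω)) ↔ sbar * _ < rcs ω
  set K := ∑ ij ∈ hfin.toFinset, if act ij.1 ij.2 ω = true then h ij.1 ij.2 ω * c ij else 0 with hK
  have hK0 : 0 ≤ K := Finset.sum_nonneg fun ij _ => by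
    split_ifs
    · exact mul_nonneg (hh _ _).le (hc0 _)
    · exact le_rfl
  have hsum : (∑' ij : ℕ × ℕ, vehiclePower γ Ptx α bw RP (x.1 ij.1) (x.2 ij.1 ij.2)
        (h ij.1 ij.2 ω) (act ij.1 ij.2 ω))
      = 4 * Real.pi * γ * Ptx * K := by
    rw [tsum_eq_sum (s := hfin.toFinset), hK, Finset.mul_sum]
    · refine Finset.sum_congr rfl fun ij hij => ?_
      have hI : Interferes bw RP (x.1 ij.1).1
          (streetPoint (x.1 ij.1).1 (x.1 ij.1).2 (x.2 ij.1 ij.2)) := by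
        simpa using hij
      rw [vehiclePower]
      by_cases ha : act ij.1 ij.2 ω = true
      · rw [if_pos ⟨hI, ha⟩, if_pos ha, mul_assoc]
      · rw [if_neg fun hx => ha hx.2, if_neg ha, mul_zero]
    · intro ij hij
      exact if_neg fun hx => hij (by simpa using hx.1)
  rw [hsum, signal, scaledThreshold]
  have hρ : 0 < R ^ (-2 * α) := Real.rpow_pos_of_pos hR _
  set ρ := R ^ (-2 * α)
  have hpi := Real.pi_pos
  have hβ2 : 0 < 1 - β := by linarith
  have hγP : 0 < γ * Ptx := mul_pos hγ hPtx
  have hS : 0 < γ * rcs ω * Ptx * ρ := by positivity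
  have e1 : sbar * (4 * Real.pi * β / (sbar * ρ * (1 - β)) * K)
      = 4 * Real.pi * β * K / (ρ * (1 - β)) := by
    field_simp
  rw [lt_div_iff₀ (by positivity), e1, div_lt_iff₀ (by positivity)]
  constructor
  · intro h1
    refine lt_of_mul_lt_mul_left (a := γ * Ptx) ?_ hγP.le
    linarith
  · intro h1
    have := mul_lt_mul_of_pos_left h1 hγP
    linarith

/-- The locations of all streets (the ego street included) and of all vehicles. -/
def configuration (q : ℕ → Ω → ℝ × ℝ) (t : ℕ → ℕ → Ω → ℝ) (ω : Ω) :
    (ℕ → ℝ × ℝ) × (ℕ → ℕ → ℝ) :=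
  (fun n => street q n ω, fun i j => t i j ω)

/-- The σ-algebra of the Cox process is generated by the configuration; the deterministic ego street
adds nothing. -/
theorem processSigma_eq_comap :
    processSigma q t = MeasurableSpace.comap (configuration q t) inferInstance := by
  have h1 : MeasurableSpace.comap (configuration q t) inferInstance
      = MeasurableSpace.comap (fun ω n => street q n ω) inferInstance
        ⊔ MeasurableSpace.comap (fun ω i j => t i j ω) inferInstance :=
    MeasurableSpace.comap_prodMk _ _
  have h2 : MeasurableSpace.comap (fun ω n => street q n ω) inferInstance
      = ⨆ n, MeasurableSpace.comap (street q n) inferInstance := by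
    simp only [MeasurableSpace.pi, MeasurableSpace.comap_iSup, MeasurableSpace.comap_comp]
    rfl
  rw [h1, h2, processSigma]
  congr 1
  · refine le_antisymm (iSup_le fun n => le_iSup
      (fun n => MeasurableSpace.comap (street q n) inferInstance) (n + 1)) (iSup_le fun n => ?_)
    cases n with
    | zero =>
      have : MeasurableSpace.comap (street q 0) inferInstance = ⊥ :=
        MeasurableSpace.comap_const (0, 0)
      exact this.le.trans bot_le
    | succ n => exact le_iSup (fun n => MeasurableSpace.comap (q n) inferInstance) n
  · simp only [MeasurableSpace.pi, MeasurableSpace.comap_iSup, MeasurableSpace.comap_comp]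
    rfl

theorem measurable_configuration {Ω' : Type*} {_ : MeasurableSpace Ω'} {q : ℕ → Ω' → ℝ × ℝ}
    {t : ℕ → ℕ → Ω' → ℝ} (hq : ∀ n, Measurable (q n)) (ht : ∀ i j, Measurable (t i j)) :
    Measurable (configuration q t) :=
  (measurable_pi_lambda _ (measurable_street hq)).prodMk
    (measurable_pi_lambda _ fun i => measurable_pi_lambda _ fun j => ht i j)

theorem measurable_marks {Ω' : Type*} {_ : MeasurableSpace Ω'} {rcs : Ω' → ℝ}
    {h : ℕ → ℕ → Ω' → ℝ} {act : ℕ → ℕ → Ω' → Bool} (hr : Measurable rcs)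
    (hh : ∀ i j, Measurable (h i j)) (ha : ∀ i j, Measurable (act i j)) :
    Measurable (marks rcs h act) :=
  hr.prodMk ((measurable_pi_lambda _ fun i => measurable_pi_lambda _ fun j => hh i j).prodMk
    (measurable_pi_lambda _ fun i => measurable_pi_lambda _ fun j => ha i j))

theorem IsNetwork.indepFun_configuration (hnet : IsNetwork P lamL lam p sbar q t rcs h act) :
    configuration q t ⟂ᵢ[P] marks rcs h act := by
  set S : Set Source := {Source.lines} ∪ range Source.vehicles with hS
  have h1 : Measurable[sourcesSigma q t rcs h act S] (configuration q t) := by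
    have hq : ∀ n, Measurable[sourcesSigma q t rcs h act S] (q n) := fun n =>
      measurable_line_of_mem (Or.inl rfl) n
    have ht : ∀ i j, Measurable[sourcesSigma q t rcs h act S] (t i j) := fun i j =>
      measurable_vehicles_of_mem (Or.inr ⟨i, rfl⟩) j
    exact measurable_configuration hq ht
  have h2 : Measurable[sourcesSigma q t rcs h act Sᶜ] (marks rcs h act) := by
    have hr : Measurable[sourcesSigma q t rcs h act Sᶜ] rcs :=
      measurable_rcs_of_mem (by simp [hS])
    have hh : ∀ i j, Measurable[sourcesSigma q t rcs h act Sᶜ] (h i j) := fun i j =>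
      measurable_fading_of_mem (by simp [hS])
    have ha : ∀ i j, Measurable[sourcesSigma q t rcs h act Sᶜ] (act i j) := fun i j =>
      measurable_access_of_mem (by simp [hS])
    exact measurable_marks hr hh ha
  rw [IndepFun_iff_Indep]
  exact indep_of_indep_of_le_left (indep_of_indep_of_le_right
    (hnet.indep_of_disjoint disjoint_compl_right) h2.comap_le) h1.comap_le

/-- The conditional success probability, as a product over all vehicles. -/
def successProduct (bw RP p α β' : ℝ) (q : ℕ → Ω → ℝ × ℝ) (t : ℕ → ℕ → Ω → ℝ) (ω : Ω) : ℝ :=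
  ∏ᶠ ij : ℕ × ℕ, vehicleFactor bw RP p α β' (street q ij.1 ω) (t ij.1 ij.2 ω)

theorem successProduct_nonneg {bw RP α β' : ℝ} (hp0 : 0 ≤ p) (hp1 : p ≤ 1) (hβ : 0 ≤ β') (ω : Ω) :
    0 ≤ successProduct bw RP p α β' q t ω :=
  finprod_nonneg fun _ => (vehicleFactor_pos hp0 hp1 hβ _ _).le

theorem successProduct_le_one {bw RP α β' : ℝ} (hp0 : 0 ≤ p) (hp1 : p ≤ 1) (hβ : 0 ≤ β') (ω : Ω) :
    successProduct bw RP p α β' q t ω ≤ 1 := by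
  classical
  rw [successProduct, finprod_def]
  split_ifs
  · exact Finset.prod_le_one (fun _ _ => (vehicleFactor_pos hp0 hp1 hβ _ _).le)
      fun _ _ => vehicleFactor_le_one hp0 hβ _ _
  · exact le_rfl

theorem measurable_successProduct {Ω' : Type*} {_ : MeasurableSpace Ω'} (bw RP p α β' : ℝ)
    {q : ℕ → Ω' → ℝ × ℝ} {t : ℕ → ℕ → Ω' → ℝ} (hq : ∀ n, Measurable (q n))
    (ht : ∀ i j, Measurable (t i j)) : Measurable (successProduct bw RP p α β' q t) := by
  have h1 : ∀ ij : ℕ × ℕ,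
      Measurable fun ω => vehicleFactor bw RP p α β' (street q ij.1 ω) (t ij.1 ij.2 ω) :=
    fun ij => by
      have h2 := (measurable_vehicleFactor bw RP p α β').comp
        ((measurable_street hq ij.1).prodMk (ht ij.1 ij.2))
      exact h2
  exact measurable_finprod h1

/-- Given the streets and the vehicles, the success probability is the product of the factors of the
interfering vehicles: integrate out the independent marks by Fubini's theorem. -/
theorem IsNetwork.condSuccess_ae_eq (hnet : IsNetwork P lamL lam p sbar q t rcs h act)
    (hp0 : 0 ≤ p) (hp1 : p ≤ 1) (hs : 0 < sbar) {γ Ptx α R bw RP β : ℝ} (hγ : 0 < γ)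
    (hPtx : 0 < Ptx) (hR : 0 < R) (hβ0 : 0 ≤ β) (hβ1 : β < 1) :
    condSuccess P γ Ptx α R bw RP β q t rcs h act
      =ᵐ[P] successProduct bw RP p α (scaledThreshold α R sbar β) q t := by
  have hβ' := scaledThreshold_nonneg (α := α) hR hs hβ0 hβ1
  have hXm := measurable_configuration hnet.lines.measurable
    fun i => (hnet.vehicles i).measurable
  have hm : processSigma q t ≤ ‹MeasurableSpace Ω› := by
    rw [processSigma_eq_comap]
    exact hXm.comap_le
  have hYm : Measurable (marks rcs h act) :=
    measurable_marks hnet.rcs_measurable hnet.fading_measurable hnet.access_measurable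
  have hEm := measurableSet_lt (measurable_const (a := β)) (measurable_fractionAt γ Ptx α R bw RP)
  set E : Set (((ℕ → ℝ × ℝ) × (ℕ → ℕ → ℝ)) × (ℝ × (ℕ → ℕ → ℝ) × (ℕ → ℕ → Bool))) :=
    {z | β < fractionAt γ Ptx α R bw RP z.1 z.2} with hE
  have hAm : MeasurableSet {ω | β < signalFraction γ Ptx α R bw RP q t rcs h act ω} :=
    (hXm.prodMk hYm) hEm
  have hpm : Measurable[processSigma q t]
      (successProduct bw RP p α (scaledThreshold α R sbar β) q t) := by
    refine measurable_successProduct _ _ _ _ _ (fun n => ?_) (fun i j => ?_)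
    · exact (comap_measurable (q n)).mono
        ((le_iSup (fun n => MeasurableSpace.comap (q n) inferInstance) n).trans le_sup_left) le_rfl
    · exact (comap_measurable (t i j)).mono ((le_iSup₂
        (f := fun i j => MeasurableSpace.comap (t i j) inferInstance) i j).trans
          le_sup_right) le_rfl
  have hpi : Integrable (successProduct bw RP p α (scaledThreshold α R sbar β) q t) P := by
    refine Integrable.of_bound (hpm.mono hm le_rfl).aestronglyMeasurable 1 (ae_of_all _ fun ω => ?_)
    rw [Real.norm_of_nonneg (successProduct_nonneg hp0 hp1 hβ' ω)]
    exact successProduct_le_one hp0 hp1 hβ' ω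
  refine (ae_eq_condExp_of_forall_setIntegral_eq hm ((integrable_const (1 : ℝ)).indicator hAm)
    (fun _ _ _ => hpi.integrableOn) (fun B hB _ => ?_) hpm.aestronglyMeasurable).symm
  have hBm := hm B hB
  rw [processSigma_eq_comap] at hB
  obtain ⟨C, hC, rfl⟩ := hB
  have hsection : ∀ᵐ ω ∂P, P.map (marks rcs h act) (Prod.mk (configuration q t ω) ⁻¹' E)
      = ENNReal.ofReal (successProduct bw RP p α (scaledThreshold α R sbar β) q t ω) := by
    filter_upwards [hnet.ae_finite_interferes bw RP] with ω hω
    rw [Measure.map_apply hYm (measurable_prodMk_left hEm)]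
    exact hnet.measure_success hp0 hp1 hs hγ hPtx hR hβ0 hβ1 (configuration q t ω) hω
  have hkey : P ({ω | β < signalFraction γ Ptx α R bw RP q t rcs h act ω} ∩ configuration q t ⁻¹' C)
      = ∫⁻ ω in configuration q t ⁻¹' C,
          ENNReal.ofReal (successProduct bw RP p α (scaledThreshold α R sbar β) q t ω) ∂P := by
    have : IsProbabilityMeasure (P.map (marks rcs h act)) :=
      Measure.isProbabilityMeasure_map hYm.aemeasurable
    have h1 : {ω | β < signalFraction γ Ptx α R bw RP q t rcs h act ω} ∩ configuration q t ⁻¹' C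
        = (fun ω => (configuration q t ω, marks rcs h act ω)) ⁻¹' (E ∩ C ×ˢ univ) := by
      ext ω
      exact and_congr_right fun _ => (and_iff_left (mem_univ _)).symm
    rw [h1, ← Measure.map_apply (hXm.prodMk hYm) (hEm.inter (hC.prod MeasurableSet.univ)),
      (indepFun_iff_map_prod_eq_prod_map_map hXm.aemeasurable hYm.aemeasurable).1
        hnet.indepFun_configuration, Measure.prod_apply (hEm.inter (hC.prod MeasurableSet.univ)),
      lintegral_map (measurable_measure_prodMk_left (hEm.inter (hC.prod MeasurableSet.univ))) hXm,
      ← lintegral_indicator hBm]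
    refine lintegral_congr_ae ?_
    filter_upwards [hsection] with ω hω
    by_cases hc : configuration q t ω ∈ C
    · rw [indicator_of_mem (show ω ∈ configuration q t ⁻¹' C from hc), ← hω]
      congr 1
      ext y
      simp [hc]
    · rw [indicator_of_notMem (show ω ∉ configuration q t ⁻¹' C from hc)]
      convert measure_empty (μ := P.map (marks rcs h act))
      ext y
      simp [hc]
  rw [setIntegral_indicator hAm, setIntegral_const, smul_eq_mul, mul_one, inter_comm,
    measureReal_def, hkey, ← integral_eq_lintegral_of_nonneg_ae
      (ae_of_all _ fun ω => successProduct_nonneg hp0 hp1 hβ' ω)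
      (hpm.mono hm le_rfl).aestronglyMeasurable]

end Network

/-! ### Functionals of the Cox process -/

section Network

variable {Ω : Type*} [MeasurableSpace Ω] {P : Measure Ω} [IsProbabilityMeasure P]
  {lamL lam p sbar : ℝ} {q : ℕ → Ω → ℝ × ℝ} {t : ℕ → ℕ → Ω → ℝ} {rcs : Ω → ℝ}
  {h : ℕ → ℕ → Ω → ℝ} {act : ℕ → ℕ → Ω → Bool}

theorem IsNetwork.measurable_vehicleSeq (hnet : IsNetwork P lamL lam p sbar q t rcs h act) (i : ℕ) :
    Measurable fun ω j => t i j ω :=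
  measurable_pi_lambda _ (hnet.vehicles i).measurable

theorem IsNetwork.iIndepFun_vehicles (hnet : IsNetwork P lamL lam p sbar q t rcs h act) :
    iIndepFun (fun i ω j => t i j ω) P := by
  have h1 := hnet.indep.precomp (g := Source.vehicles) fun i j hij => by simpa using hij
  have h2 : sourceSigma q t rcs h act ∘ Source.vehicles
      = fun i => MeasurableSpace.comap (fun ω j => t i j ω) inferInstance := by
    funext i
    simp only [MeasurableSpace.pi, MeasurableSpace.comap_iSup, MeasurableSpace.comap_comp]
    rfl
  rw [h2] at h1
  exact h1

theorem IsNetwork.indepFun_streets_vehicles (hnet : IsNetwork P lamL lam p sbar q t rcs h act) :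
    (fun ω i => street q i ω) ⟂ᵢ[P] fun ω i j => t i j ω := by
  have h1 : Measurable[sourcesSigma q t rcs h act {Source.lines}] fun ω i => street q i ω := by
    have hq : ∀ n, Measurable[sourcesSigma q t rcs h act {Source.lines}] (q n) := fun n =>
      measurable_line_of_mem (mem_singleton _) n
    exact @measurable_pi_lambda _ _ _ (_) _ _ (measurable_street hq)
  have h2 : Measurable[sourcesSigma q t rcs h act {Source.lines}ᶜ] fun ω i j => t i j ω := by
    have ht : ∀ i j, Measurable[sourcesSigma q t rcs h act {Source.lines}ᶜ] (t i j) := fun i j =>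
      measurable_vehicles_of_mem (by simp) j
    exact @measurable_pi_lambda _ _ _ (_) _ _ fun i => @measurable_pi_lambda _ _ _ (_) _ _ (ht i)
  rw [IndepFun_iff_Indep]
  exact indep_of_indep_of_le_left (indep_of_indep_of_le_right
    (hnet.indep_of_disjoint disjoint_compl_right) h2.comap_le) h1.comap_le

theorem IsNetwork.measurable_streets (hnet : IsNetwork P lamL lam p sbar q t rcs h act) :
    Measurable fun ω i => street q i ω :=
  measurable_pi_lambda _ (measurable_street hnet.lines.measurable)

theorem IsNetwork.measurable_vehicles (hnet : IsNetwork P lamL lam p sbar q t rcs h act) :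
    Measurable fun ω i j => t i j ω :=
  measurable_pi_lambda _ hnet.measurable_vehicleSeq

/-- Given the streets, the vehicles on different streets are independent: nonnegative functions. -/
theorem IsNetwork.lintegral_prod_streets (hnet : IsNetwork P lamL lam p sbar q t rcs h act)
    {F : ℝ × ℝ → (ℕ → ℝ) → ℝ≥0∞} (hF : Measurable fun x : (ℝ × ℝ) × (ℕ → ℝ) => F x.1 x.2) (N : ℕ) :
    ∫⁻ ω, ∏ i ∈ Finset.range N, F (street q i ω) (fun j => t i j ω) ∂P
      = ∫⁻ ω, ∏ i ∈ Finset.range N, ∫⁻ ω', F (street q i ω) (fun j => t i j ω') ∂P ∂P := by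
  have hQ := hnet.measurable_streets
  have hT := hnet.measurable_vehicles
  have hΦ : Measurable fun z : (ℕ → ℝ × ℝ) × (ℕ → ℕ → ℝ) =>
      ∏ i ∈ Finset.range N, F (z.1 i) (z.2 i) :=
    Finset.measurable_fun_prod _ fun i _ => by
      have h1 : Measurable fun z : (ℕ → ℝ × ℝ) × (ℕ → ℕ → ℝ) => (z.1 i, z.2 i) := by fun_prop
      exact hF.comp h1
  have h1 := lintegral_map (μ := P) hΦ (hQ.prodMk hT)
  rw [(indepFun_iff_map_prod_eq_prod_map_map hQ.aemeasurable hT.aemeasurable).1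
    hnet.indepFun_streets_vehicles, lintegral_prod _ hΦ.aemeasurable,
    lintegral_map hΦ.lintegral_prod_right' hQ] at h1
  rw [← h1]
  refine lintegral_congr fun ω => ?_
  have hFs : ∀ s, Measurable (F s) := fun s => hF.comp measurable_prodMk_left
  have hΦω : Measurable fun y : ℕ → ℕ → ℝ => ∏ i ∈ Finset.range N, F (street q i ω) (y i) :=
    Finset.measurable_fun_prod _ fun i _ => (hFs _).comp (measurable_pi_apply i)
  rw [lintegral_map hΦω hT]
  exact lintegral_prod_eq_prod_lintegral_of_indepFun (Finset.range N) _
    (hnet.iIndepFun_vehicles.comp (fun i => F (street q i ω)) (fun i => hFs _))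
    (fun i => (hFs _).comp (hnet.measurable_vehicleSeq i))

/-- Given the streets, the vehicles on different streets are independent: complex functions. -/
theorem IsNetwork.integral_prod_streets (hnet : IsNetwork P lamL lam p sbar q t rcs h act)
    {F : ℝ × ℝ → (ℕ → ℝ) → ℂ} (hF : Measurable fun x : (ℝ × ℝ) × (ℕ → ℝ) => F x.1 x.2) (N : ℕ)
    (hi : Integrable (fun ω => ∏ i ∈ Finset.range N, F (street q i ω) (fun j => t i j ω)) P) :
    ∫ ω, ∏ i ∈ Finset.range N, F (street q i ω) (fun j => t i j ω) ∂P
      = ∫ ω, ∏ i ∈ Finset.range N, ∫ ω', F (street q i ω) (fun j => t i j ω') ∂P ∂P := by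
  have hQ := hnet.measurable_streets
  have hT := hnet.measurable_vehicles
  have hΦ : Measurable fun z : (ℕ → ℝ × ℝ) × (ℕ → ℕ → ℝ) =>
      ∏ i ∈ Finset.range N, F (z.1 i) (z.2 i) :=
    Finset.measurable_fun_prod _ fun i _ => by
      have h1 : Measurable fun z : (ℕ → ℝ × ℝ) × (ℕ → ℕ → ℝ) => (z.1 i, z.2 i) := by fun_prop
      exact hF.comp h1
  have hi' := (integrable_map_measure (μ := P) hΦ.aestronglyMeasurable
    (hQ.prodMk hT).aemeasurable).2 hi
  have h1 := integral_map (μ := P) (hQ.prodMk hT).aemeasurable hΦ.aestronglyMeasurable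
  have hprod := (indepFun_iff_map_prod_eq_prod_map_map hQ.aemeasurable hT.aemeasurable).1
    hnet.indepFun_streets_vehicles
  rw [hprod] at h1 hi'
  have hT' : IsProbabilityMeasure (P.map fun ω i j => t i j ω) :=
    Measure.isProbabilityMeasure_map hT.aemeasurable
  rw [integral_prod _ hi', integral_map hQ.aemeasurable
    hΦ.stronglyMeasurable.integral_prod_right'.aestronglyMeasurable] at h1
  rw [← h1]
  refine integral_congr_ae (ae_of_all _ fun ω => ?_)
  have hFs : ∀ s, Measurable (F s) := fun s => hF.comp measurable_prodMk_left
  have hΦω : Measurable fun y : ℕ → ℕ → ℝ => ∏ i ∈ Finset.range N, F (street q i ω) (y i) :=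
    Finset.measurable_fun_prod _ fun i _ => (hFs _).comp (measurable_pi_apply i)
  simp only
  rw [integral_map hT.aemeasurable hΦω.aestronglyMeasurable]
  simp_rw [Finset.prod_range]
  exact (hnet.iIndepFun_vehicles.precomp (g := fun i : Fin N => (i : ℕ))
    Fin.val_injective).integral_fun_prod_comp (f := fun i : Fin N => F (street q i ω))
    (fun i => (hnet.measurable_vehicleSeq i).aemeasurable)
    (fun i => (hFs _).aestronglyMeasurable)

theorem measurable_finprod_seq {R : Type*} [CommMonoid R] [MeasurableSpace R] [MeasurableMul₂ R]
    [MeasurableSingletonClass R] {f : ℝ × ℝ → ℝ → R}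
    (hf : Measurable fun x : (ℝ × ℝ) × ℝ => f x.1 x.2) :
    Measurable fun x : (ℝ × ℝ) × (ℕ → ℝ) => ∏ᶠ j, f x.1 (x.2 j) := by
  have h1 : ∀ j, Measurable fun x : (ℝ × ℝ) × (ℕ → ℝ) => f x.1 (x.2 j) := fun j => by
    have h2 : Measurable fun x : (ℝ × ℝ) × (ℕ → ℝ) => (x.1, x.2 j) := by fun_prop
    exact hf.comp h2
  exact measurable_finprod h1

/-- For large `N` the product over the first `N` streets is the product over all vehicles. -/
theorem eventually_prod_streets_eq {R : Type*} [CommMonoid R] {f : ℝ × ℝ → ℝ → R} {RP : ℝ}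
    (hf : ∀ s τ, ¬ (|s.2| ≤ RP ∧ |τ| ≤ RP) → f s τ = 1) {ω : Ω}
    (hfin : {ij : ℕ × ℕ | |(street q ij.1 ω).2| ≤ RP ∧ |t ij.1 ij.2 ω| ≤ RP}.Finite) :
    ∀ᶠ N in atTop, ∏ i ∈ Finset.range N, ∏ᶠ j, f (street q i ω) (t i j ω)
      = ∏ᶠ ij : ℕ × ℕ, f (street q ij.1 ω) (t ij.1 ij.2 ω) := by
  have hms : Function.mulSupport (fun ij : ℕ × ℕ => f (street q ij.1 ω) (t ij.1 ij.2 ω))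
      ⊆ {ij : ℕ × ℕ | |(street q ij.1 ω).2| ≤ RP ∧ |t ij.1 ij.2 ω| ≤ RP} := fun ij hij => by
    by_contra hn
    exact hij (hf _ _ hn)
  obtain ⟨N₀, hN₀⟩ := (hfin.image Prod.fst).bddAbove
  have hle : ∀ i j, f (street q i ω) (t i j ω) ≠ 1 → i ≤ N₀ := fun i j hij =>
    hN₀ (mem_image_of_mem Prod.fst (hms (a := (i, j)) hij))
  filter_upwards [eventually_gt_atTop N₀] with N hN
  rw [finprod_curry _ (hfin.subset hms)]
  refine (finprod_eq_prod_of_mulSupport_subset _ fun i hi => ?_).symm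
  rw [Finset.coe_range, mem_Iio]
  by_contra hn
  refine hi (finprod_eq_one_of_forall_eq_one fun j => ?_)
  by_contra hj
  exact absurd (hle i j hj) (not_le.2 (hN.trans_le (not_lt.1 hn)))

/-- For large `N` the product over the first `N` streets of a function that is `1` outside the strip
`|r| ≤ RP` is the product over the ego street and all streets in the strip. -/
theorem eventually_prod_range_succ_street_eq {R : Type*} [CommMonoid R] {G : ℝ × ℝ → R} {RP : ℝ}
    (hG : ∀ s, ¬ |s.2| ≤ RP → G s = 1) {ω : Ω} (hfin : {i | |(street q i ω).2| ≤ RP}.Finite) :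
    ∀ᶠ N in atTop, ∏ i ∈ Finset.range N, G (street q i ω)
      = G (0, 0) * ∏ᶠ n, (univ ×ˢ Icc (-RP) RP : Set (ℝ × ℝ)).mulIndicator G (q n ω) := by
  obtain ⟨N₀, hN₀⟩ := hfin.bddAbove
  filter_upwards [eventually_gt_atTop N₀] with N hN
  obtain ⟨K, rfl⟩ : ∃ K, N = K + 1 := ⟨N - 1, by omega⟩
  have hind : ∀ n, (univ ×ˢ Icc (-RP) RP : Set (ℝ × ℝ)).mulIndicator G (q n ω) = G (q n ω) := by
    intro n
    by_cases hn : |(q n ω).2| ≤ RP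
    · exact mulIndicator_of_mem
        (show q n ω ∈ univ ×ˢ Icc (-RP) RP from ⟨mem_univ _, abs_le.1 hn⟩) _
    · rw [mulIndicator_of_notMem (fun hx : q n ω ∈ univ ×ˢ Icc (-RP) RP => hn (abs_le.2 hx.2)),
        hG _ hn]
  rw [Finset.prod_range_succ', mul_comm]
  simp_rw [hind]
  congr 1
  refine (finprod_eq_prod_of_mulSupport_subset _ fun n hn => ?_).symm
  rw [Finset.coe_range, mem_Iio]
  by_contra hc
  refine hn (hG _ fun hx => ?_)
  have : n + 1 ≤ N₀ := hN₀ (show n + 1 ∈ {i | |(street q i ω).2| ≤ RP} from hx)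
  omega

/-- A bound that is uniform in the number of streets: streets beyond the strip `|r| ≤ RP` contribute
at most `1`, the ego street and each street in the strip at most `C`. -/
theorem prod_range_le_of_le_strip {G : ℝ × ℝ → ℝ≥0∞} {RP : ℝ} (hRP : 0 ≤ RP) {C : ℝ≥0∞}
    (hC : 1 ≤ C) (hG1 : ∀ s, ¬ |s.2| ≤ RP → G s ≤ 1) (hGC : ∀ s, G s ≤ C) {ω : Ω}
    (hfin : {n | q n ω ∈ (univ ×ˢ Icc (-RP) RP : Set (ℝ × ℝ))}.Finite) (N : ℕ) :
    ∏ i ∈ Finset.range N, G (street q i ω)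
      ≤ C * ∏ᶠ n, (univ ×ˢ Icc (-RP) RP : Set (ℝ × ℝ)).mulIndicator (fun _ => C) (q n ω) := by
  classical
  set H : ℝ × ℝ → ℝ≥0∞ := (univ ×ˢ Icc (-RP) RP : Set (ℝ × ℝ)).mulIndicator (fun _ => C) with hH
  have hH1 : ∀ s, 1 ≤ H s := fun s => one_le_mulIndicator (fun _ _ => hC) s
  have hGH : ∀ s, G s ≤ H s := by
    intro s
    by_cases hs : |s.2| ≤ RP
    · rw [hH, mulIndicator_of_mem (show s ∈ univ ×ˢ Icc (-RP) RP from ⟨mem_univ _, abs_le.1 hs⟩)]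
      exact hGC s
    · exact (hG1 s hs).trans (hH1 s)
  have h1 : ∏ i ∈ Finset.range N, G (street q i ω) ≤ ∏ i ∈ Finset.range (N + 1), H (street q i ω) :=
    (Finset.prod_le_prod' fun i _ => hGH _).trans
      (Finset.prod_le_prod_of_subset_of_one_le'
        (Finset.range_subset_range.2 (Nat.le_succ N)) fun i _ _ => hH1 _)
  refine h1.trans ?_
  rw [Finset.prod_range_succ', mul_comm]
  refine mul_le_mul' ?_ ?_
  · change H (0, 0) ≤ C
    rw [hH, mulIndicator_of_mem (show ((0 : ℝ), (0 : ℝ)) ∈ univ ×ˢ Icc (-RP) RP from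
      ⟨mem_univ _, by constructor <;> linarith⟩)]
  · rw [finprod_mulIndicator_eq_prod hfin]
    have h2 : ∏ n ∈ hfin.toFinset, C = ∏ n ∈ hfin.toFinset, H (q n ω) :=
      Finset.prod_congr rfl fun n hn => (mulIndicator_of_mem (show q n ω ∈ univ ×ˢ Icc (-RP) RP from
        hfin.mem_toFinset.1 hn) (fun _ => C)).symm
    rw [h2]
    calc ∏ n ∈ Finset.range N, H (q n ω)
        ≤ ∏ n ∈ Finset.range N ∪ hfin.toFinset, H (q n ω) :=
          Finset.prod_le_prod_of_subset_of_one_le' Finset.subset_union_left fun _ _ _ => hH1 _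
      _ = ∏ n ∈ hfin.toFinset, H (q n ω) := by
          refine (Finset.prod_subset Finset.subset_union_right fun n _ hn => ?_).symm
          exact mulIndicator_of_notMem (s := univ ×ˢ Icc (-RP) RP) (a := q n ω)
            (fun hx => hn (hfin.mem_toFinset.2 hx)) (fun _ => C)

/-- The expected product of `f s` over the vehicles of the street `s` within the range `RP`, in the
closed form given by the probability generating functional. -/
def streetMoment (lam RP : ℝ) (f : ℝ × ℝ → ℝ → ℂ) (s : ℝ × ℝ) : ℂ :=
  Complex.exp (∫ τ in Icc (-RP) RP, (f s τ - 1) ∂(ENNReal.ofReal lam • (volume : Measure ℝ)))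

theorem measurable_streetMoment (lam RP : ℝ) {f : ℝ × ℝ → ℝ → ℂ}
    (hf : Measurable fun x : (ℝ × ℝ) × ℝ => f x.1 x.2) : Measurable (streetMoment lam RP f) := by
  have h1 : StronglyMeasurable fun x : (ℝ × ℝ) × ℝ => f x.1 x.2 - 1 :=
    (hf.sub_const 1).stronglyMeasurable
  have : IsFiniteMeasure ((ENNReal.ofReal lam • (volume : Measure ℝ)).restrict (Icc (-RP) RP)) :=
    ⟨by simpa using vehicles_intensity_Icc_lt_top lam RP⟩
  exact Complex.measurable_exp.comp (h1.integral_prod_right'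
    (ν := (ENNReal.ofReal lam • (volume : Measure ℝ)).restrict (Icc (-RP) RP))).measurable

theorem streetMoment_eq_one {lam RP : ℝ} {f : ℝ × ℝ → ℝ → ℂ}
    (hf1 : ∀ s τ, ¬ (|s.2| ≤ RP ∧ |τ| ≤ RP) → f s τ = 1) {s : ℝ × ℝ} (hs : ¬ |s.2| ≤ RP) :
    streetMoment lam RP f s = 1 := by
  have : ∀ τ, f s τ - 1 = 0 := fun τ => sub_eq_zero.2 (hf1 _ _ fun hx => hs hx.1)
  simp [streetMoment, this]

theorem norm_streetMoment_le {lam RP : ℝ} {f : ℝ × ℝ → ℝ → ℂ} {M : ℝ × ℝ → ℝ → ℝ≥0∞}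
    (hfM : ∀ s τ, ‖f s τ‖ₑ ≤ M s τ) {K : ℝ≥0∞} (hK : K ≠ ⊤)
    (hMK : ∀ s, ∫⁻ τ in Icc (-RP) RP, M s τ ∂(ENNReal.ofReal lam • (volume : Measure ℝ)) ≤ K)
    (s : ℝ × ℝ) :
    ‖streetMoment lam RP f s‖ ≤ Real.exp
      (K + (ENNReal.ofReal lam • (volume : Measure ℝ)) (Icc (-RP) RP)).toReal := by
  have hν := vehicles_intensity_Icc_lt_top lam RP
  rw [streetMoment]
  refine (Complex.norm_exp_le_exp_norm _).trans (Real.exp_le_exp.2 ?_)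
  rw [← toReal_enorm]
  refine ENNReal.toReal_mono (ENNReal.add_ne_top.2 ⟨hK, hν.ne⟩) ?_
  refine (enorm_integral_le_lintegral_enorm _).trans ?_
  calc ∫⁻ τ in Icc (-RP) RP, ‖f s τ - 1‖ₑ ∂(ENNReal.ofReal lam • (volume : Measure ℝ))
      ≤ ∫⁻ τ in Icc (-RP) RP, (M s τ + 1) ∂(ENNReal.ofReal lam • (volume : Measure ℝ)) := by
        refine lintegral_mono fun τ => (enorm_sub_le).trans ?_
        simpa using hfM s τ
    _ ≤ _ := by
        rw [lintegral_add_right _ measurable_const, setLIntegral_const, one_mul]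
        exact add_le_add_left (hMK s) _

/-- The moment functional of the Cox process. A function `f` of street and position that is `1`
beyond the range `RP` is dominated by `M ≥ 1`, whose integral over every street is at most `K`. The
Poisson formula is applied on every street and then to the streets. -/
theorem IsNetwork.integrable_and_integral_finprod
    (hnet : IsNetwork P lamL lam p sbar q t rcs h act) {RP : ℝ} (hRP : 0 ≤ RP)
    {f : ℝ × ℝ → ℝ → ℂ} (hf : Measurable fun x : (ℝ × ℝ) × ℝ => f x.1 x.2)
    {M : ℝ × ℝ → ℝ → ℝ≥0∞} (hM : Measurable fun x : (ℝ × ℝ) × ℝ => M x.1 x.2)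
    (hf1 : ∀ s τ, ¬ (|s.2| ≤ RP ∧ |τ| ≤ RP) → f s τ = 1)
    (hM1 : ∀ s τ, ¬ (|s.2| ≤ RP ∧ |τ| ≤ RP) → M s τ = 1)
    (hMone : ∀ s τ, 1 ≤ M s τ) (hMtop : ∀ s τ, M s τ ≠ ⊤) (hfM : ∀ s τ, ‖f s τ‖ₑ ≤ M s τ)
    {K : ℝ≥0∞} (hK : K ≠ ⊤)
    (hMK : ∀ s, ∫⁻ τ in Icc (-RP) RP, M s τ ∂(ENNReal.ofReal lam • (volume : Measure ℝ)) ≤ K) :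
    Integrable (fun ω => ∏ᶠ ij : ℕ × ℕ, f (street q ij.1 ω) (t ij.1 ij.2 ω)) P ∧
    ∫ ω, ∏ᶠ ij : ℕ × ℕ, f (street q ij.1 ω) (t ij.1 ij.2 ω) ∂P
      = streetMoment lam RP f (0, 0) * Complex.exp (∫ s in univ ×ˢ Icc (-RP) RP,
          (streetMoment lam RP f s - 1)
          ∂(ENNReal.ofReal lamL •
            (volume : Measure (ℝ × ℝ)).restrict (Ico 0 Real.pi ×ˢ univ))) := by
  set I : Set ℝ := Icc (-RP) RP with hI
  set ν : Measure ℝ := ENNReal.ofReal lam • volume with hν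
  set μL : Measure (ℝ × ℝ) :=
    ENNReal.ofReal lamL • (volume : Measure (ℝ × ℝ)).restrict (Ico 0 Real.pi ×ˢ univ) with hμL
  set strip : Set (ℝ × ℝ) := univ ×ˢ I with hstrip
  have hIm : MeasurableSet I := measurableSet_Icc
  have hSm : MeasurableSet strip := MeasurableSet.univ.prod measurableSet_Icc
  have hνI : ν I < ⊤ := vehicles_intensity_Icc_lt_top lam RP
  have hμS : μL strip < ⊤ := lines_intensity_strip_lt_top lamL RP
  have hfs : ∀ s, Measurable (f s) := fun s => hf.comp measurable_prodMk_left
  have hMs : ∀ s, Measurable (M s) := fun s => hM.comp measurable_prodMk_left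
  have hindM : ∀ s, I.mulIndicator (M s) = M s := fun s => by
    refine mulIndicator_eq_self.2 fun τ hτ => ?_
    by_contra hn
    exact hτ (hM1 s τ fun hx => hn (abs_le.1 hx.2))
  have hindf : ∀ s, I.mulIndicator (f s) = f s := fun s => by
    refine mulIndicator_eq_self.2 fun τ hτ => ?_
    by_contra hn
    exact hτ (hf1 s τ fun hx => hn (abs_le.1 hx.2))
  set G : ℝ × ℝ → ℂ := streetMoment lam RP f with hG
  set C : ℝ≥0∞ := EReal.exp K with hC
  have hC1 : 1 ≤ C := EReal.one_le_exp_iff.2 (EReal.coe_ennreal_nonneg K)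
  have hCtop : C ≠ ⊤ := by simpa [hC] using hK
  -- Moments on a single street with fixed parameters.
  have hMst : ∀ s i, ∫⁻ ω, ∏ᶠ j, M s (t i j ω) ∂P ≤ C := by
    intro s i
    have h1 := (hnet.vehicles i).lintegral_finprod (hMs s) (hMtop s) hIm hνI
    simp_rw [hindM] at h1
    rw [h1]
    calc _ ≤ C * 1 := mul_le_mul' (EReal.exp_monotone (by exact_mod_cast hMK s)) ?_
      _ = C := mul_one C
    rw [EReal.exp_le_one_iff]
    exact_mod_cast neg_nonpos.2 ENNReal.toReal_nonneg
  have hMst1 : ∀ s i, ¬ |s.2| ≤ RP → ∫⁻ ω, ∏ᶠ j, M s (t i j ω) ∂P ≤ 1 := by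
    intro s i hs
    have : ∀ ω, ∏ᶠ j, M s (t i j ω) = 1 := fun ω =>
      finprod_eq_one_of_forall_eq_one fun j => hM1 _ _ fun hx => hs hx.1
    simp [this]
  have hGst : ∀ s i, ∫ ω, ∏ᶠ j, f s (t i j ω) ∂P = G s := by
    intro s i
    have hi : IntegrableOn (f s) I ν := by
      refine ⟨(hfs s).aestronglyMeasurable, ?_⟩
      exact ((lintegral_mono (hfM s)).trans (hMK s)).trans_lt (lt_top_iff_ne_top.2 hK)
    have h1 := ((hnet.vehicles i).integrable_and_integral_finprod (hfs s) hIm hνI hi).2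
    simp_rw [hindf] at h1
    exact h1
  have hfprod : ∀ s i, ∀ᵐ ω ∂P, ‖∏ᶠ j, f s (t i j ω)‖ₑ ≤ ∏ᶠ j, M s (t i j ω) := by
    intro s i
    filter_upwards [(hnet.vehicles i).ae_finite hIm hνI] with ω hω
    rw [← hindf s, ← hindM s, finprod_mulIndicator_eq_prod hω, finprod_mulIndicator_eq_prod hω,
      ← ofReal_norm, norm_prod, ENNReal.ofReal_prod_of_nonneg fun _ _ => norm_nonneg _]
    exact Finset.prod_le_prod' fun n _ => by rw [ofReal_norm]; exact hfM _ _
  have hGC : ∀ s, ‖G s‖ₑ ≤ C := by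
    intro s
    rw [← hGst s 0]
    exact (enorm_integral_le_lintegral_enorm _).trans
      ((lintegral_mono_ae (hfprod s 0)).trans (hMst s 0))
  have hG1 : ∀ s : ℝ × ℝ, ¬ |s.2| ≤ RP → G s = 1 := fun s hs => streetMoment_eq_one hf1 hs
  have hGm : Measurable G := measurable_streetMoment lam RP hf
  -- The dominating random variable on the side of the streets.
  set D : Ω → ℝ≥0∞ := fun ω => C * ∏ᶠ n, strip.mulIndicator (fun _ => C) (q n ω) with hD
  have hDm' : Measurable fun ω => ∏ᶠ n, strip.mulIndicator (fun _ => C) (q n ω) :=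
    measurable_finprod fun n =>
      (measurable_mulIndicator measurable_const hSm).comp (hnet.lines.measurable n)
  have hDm : Measurable D := hDm'.const_mul C
  have hDi : ∫⁻ ω, D ω ∂P < ⊤ := by
    rw [hD, lintegral_const_mul _ hDm']
    refine ENNReal.mul_lt_top (lt_top_iff_ne_top.2 hCtop) ?_
    refine hnet.lines.lintegral_finprod_lt_top measurable_const (fun _ => hCtop) hSm hμS ?_
    rw [setLIntegral_const]
    exact ENNReal.mul_lt_top (lt_top_iff_ne_top.2 hCtop) hμS
  -- The dominating random variable on the side of the vehicles.
  set W : ℕ → Ω → ℝ≥0∞ := fun N ω =>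
    ∏ i ∈ Finset.range N, ∏ᶠ j, M (street q i ω) (t i j ω) with hW
  have hWm : ∀ N, Measurable (W N) := fun N => Finset.measurable_fun_prod _ fun i _ => by
    have h1 := (measurable_finprod_seq hM).comp
      ((measurable_street hnet.lines.measurable i).prodMk (hnet.measurable_vehicleSeq i))
    exact h1
  have hWmono : Monotone W := fun a b hab ω =>
    Finset.prod_le_prod_of_subset_of_one_le' (Finset.range_subset_range.2 hab)
      fun i _ _ => one_le_finprod' fun j => hMone _ _
  have hWi : ∫⁻ ω, ⨆ N, W N ω ∂P < ⊤ := by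
    rw [lintegral_iSup hWm hWmono]
    refine (iSup_le fun N => ?_).trans_lt hDi
    have h1 := hnet.lintegral_prod_streets (F := fun s τ => ∏ᶠ j, M s (τ j))
      (measurable_finprod_seq hM) N
    rw [hW, h1]
    refine lintegral_mono_ae ?_
    filter_upwards [hnet.lines.ae_finite hSm hμS] with ω hω
    refine le_trans (Finset.prod_le_prod' fun i _ => ?_) (prod_range_le_of_le_strip
      (G := fun s => if |s.2| ≤ RP then C else 1) hRP hC1 (fun s hs => (if_neg hs).le)
      (fun s => by split_ifs; exacts [le_rfl, hC1]) hω N)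
    split_ifs with hs
    · exact hMst _ i
    · exact hMst1 _ i hs
  have hWm' : Measurable fun ω => ⨆ N, W N ω := Measurable.iSup hWm
  have hWtop : ∀ᵐ ω ∂P, ⨆ N, W N ω < ⊤ := ae_lt_top hWm' hWi.ne
  have hbr : Integrable (fun ω => (⨆ N, W N ω).toReal) P :=
    integrable_toReal_of_lintegral_ne_top hWm'.aemeasurable hWi.ne
  set Z : ℕ → Ω → ℂ := fun N ω =>
    ∏ i ∈ Finset.range N, ∏ᶠ j, f (street q i ω) (t i j ω) with hZ
  have hZm : ∀ N, Measurable (Z N) := fun N => Finset.measurable_fun_prod _ fun i _ => by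
    have h1 := (measurable_finprod_seq hf).comp
      ((measurable_street hnet.lines.measurable i).prodMk (hnet.measurable_vehicleSeq i))
    exact h1
  have hZW : ∀ N, ∀ᵐ ω ∂P, ‖Z N ω‖ ≤ (⨆ N, W N ω).toReal := by
    intro N
    have h1 : ∀ᵐ ω ∂P, ∀ i, {j | t i j ω ∈ I}.Finite := ae_all_iff.2 fun i =>
      (hnet.vehicles i).ae_finite hIm hνI
    filter_upwards [h1, hWtop] with ω hω hω'
    rw [← toReal_enorm]
    refine ENNReal.toReal_mono hω'.ne (le_trans ?_ (le_iSup (fun N => W N ω) N))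
    rw [← ofReal_norm, hZ, norm_prod, ENNReal.ofReal_prod_of_nonneg fun _ _ => norm_nonneg _]
    refine Finset.prod_le_prod' fun i _ => ?_
    rw [← hindf, ← hindM, finprod_mulIndicator_eq_prod (hω i), finprod_mulIndicator_eq_prod (hω i),
      norm_prod, ENNReal.ofReal_prod_of_nonneg fun _ _ => norm_nonneg _]
    exact Finset.prod_le_prod' fun n _ => by rw [ofReal_norm]; exact hfM _ _
  have hlim : ∀ᵐ ω ∂P, Tendsto (fun N => Z N ω) atTop
      (𝓝 (∏ᶠ ij : ℕ × ℕ, f (street q ij.1 ω) (t ij.1 ij.2 ω))) := by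
    filter_upwards [hnet.ae_finite_near RP] with ω hω
    exact tendsto_const_nhds.congr'
      ((eventually_prod_streets_eq hf1 hω).mono fun N hN => hN.symm)
  have hZlim : Tendsto (fun N => ∫ ω, Z N ω ∂P) atTop
      (𝓝 (∫ ω, ∏ᶠ ij : ℕ × ℕ, f (street q ij.1 ω) (t ij.1 ij.2 ω) ∂P)) :=
    tendsto_integral_of_dominated_convergence _ (fun N => (hZm N).aestronglyMeasurable) hbr hZW hlim
  have hZi : ∀ N, Integrable (Z N) P := fun N => hbr.mono' (hZm N).aestronglyMeasurable (hZW N)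
  have hZG : ∀ N, ∫ ω, Z N ω ∂P = ∫ ω, ∏ i ∈ Finset.range N, G (street q i ω) ∂P := by
    intro N
    have h1 := hnet.integral_prod_streets (F := fun s τ => ∏ᶠ j, f s (τ j))
      (measurable_finprod_seq hf) N (hZi N)
    refine h1.trans ?_
    simp_rw [hGst]
  have hGlim : Tendsto (fun N => ∫ ω, ∏ i ∈ Finset.range N, G (street q i ω) ∂P) atTop
      (𝓝 (∫ ω, G (0, 0) * ∏ᶠ n, strip.mulIndicator G (q n ω) ∂P)) := by
    refine tendsto_integral_of_dominated_convergence (fun ω => (D ω).toReal)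
      (fun N => (Finset.measurable_fun_prod _ fun i _ => hGm.comp
        (measurable_street hnet.lines.measurable i)).aestronglyMeasurable)
      (integrable_toReal_of_lintegral_ne_top hDm.aemeasurable hDi.ne) (fun N => ?_) ?_
    · filter_upwards [hnet.lines.ae_finite hSm hμS, ae_lt_top hDm hDi.ne] with ω hω hω'
      rw [← toReal_enorm]
      refine ENNReal.toReal_mono hω'.ne ?_
      rw [← ofReal_norm, norm_prod, ENNReal.ofReal_prod_of_nonneg fun _ _ => norm_nonneg _]
      simp_rw [ofReal_norm]
      exact prod_range_le_of_le_strip (G := fun s => ‖G s‖ₑ) hRP hC1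
        (fun s hs => by rw [hG1 s hs]; simp) hGC hω N
    · filter_upwards [hnet.ae_finite_lines RP] with ω hω
      exact tendsto_const_nhds.congr'
        ((eventually_prod_range_succ_street_eq hG1 hω).mono fun N hN => hN.symm)
  have hGi : IntegrableOn G strip μL := by
    have : IsFiniteMeasure (μL.restrict strip) := ⟨by simpa using hμS⟩
    refine Integrable.of_bound hGm.aestronglyMeasurable C.toReal (ae_of_all _ fun s => ?_)
    rw [← toReal_enorm]
    exact ENNReal.toReal_mono hCtop (hGC s)
  constructor
  · refine hbr.mono' (aestronglyMeasurable_of_tendsto_ae atTop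
      (fun N => (hZm N).aestronglyMeasurable) hlim) ?_
    filter_upwards [hlim, ae_all_iff.2 hZW] with ω h1 h2
    exact le_of_tendsto h1.norm (Eventually.of_forall h2)
  · simp_rw [hZG] at hZlim
    rw [tendsto_nhds_unique hZlim hGlim, integral_const_mul,
      (hnet.lines.integrable_and_integral_finprod hGm hSm hμS hGi).2]

end Network

/-! ### Powers of the factors and their domination -/

/-- The power `b` of the factor of a vehicle. -/
def powFactor (bw RP p α β' : ℝ) (b : ℂ) (s : ℝ × ℝ) (τ : ℝ) : ℂ :=
  (vehicleFactor bw RP p α β' s τ : ℂ) ^ b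

/-- The dominating function `max 1 |factor ^ b|` at distance `w`. -/
def boundAt (p α β' : ℝ) (b : ℂ) (w : ℝ) : ℝ≥0∞ :=
  ENNReal.ofReal (max 1 (factor p α β' w ^ b.re))

/-- The dominating function `max 1 |factor ^ b|` of a vehicle. -/
def powBound (bw RP p α β' : ℝ) (b : ℂ) (s : ℝ × ℝ) (τ : ℝ) : ℝ≥0∞ :=
  ENNReal.ofReal (max 1 (vehicleFactor bw RP p α β' s τ ^ b.re))

section Factors

variable {bw RP p α β' : ℝ}

theorem measurable_powFactor (bw RP p α β' : ℝ) (b : ℂ) :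
    Measurable fun x : (ℝ × ℝ) × ℝ => powFactor bw RP p α β' b x.1 x.2 :=
  (Complex.measurable_ofReal.comp (measurable_vehicleFactor bw RP p α β')).pow_const b

theorem measurable_powBound (bw RP p α β' : ℝ) (b : ℂ) :
    Measurable fun x : (ℝ × ℝ) × ℝ => powBound bw RP p α β' b x.1 x.2 :=
  (measurable_const.max ((measurable_vehicleFactor bw RP p α β').pow_const b.re)).ennreal_ofReal

theorem vehicleFactor_eq_one {s : ℝ × ℝ} {τ : ℝ} (h : ¬ (|s.2| ≤ RP ∧ |τ| ≤ RP)) :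
    vehicleFactor bw RP p α β' s τ = 1 :=
  if_neg fun hI => h hI.abs_le

theorem powFactor_eq_one (b : ℂ) (s : ℝ × ℝ) (τ : ℝ) (h : ¬ (|s.2| ≤ RP ∧ |τ| ≤ RP)) :
    powFactor bw RP p α β' b s τ = 1 := by
  rw [powFactor, vehicleFactor_eq_one h, Complex.ofReal_one, Complex.one_cpow]

theorem powBound_eq_one (b : ℂ) (s : ℝ × ℝ) (τ : ℝ) (h : ¬ (|s.2| ≤ RP ∧ |τ| ≤ RP)) :
    powBound bw RP p α β' b s τ = 1 := by
  rw [powBound, vehicleFactor_eq_one h, Real.one_rpow, max_self, ENNReal.ofReal_one]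

theorem one_le_powBound (b : ℂ) (s : ℝ × ℝ) (τ : ℝ) : 1 ≤ powBound bw RP p α β' b s τ :=
  ENNReal.one_le_ofReal.2 (le_max_left _ _)

theorem enorm_powFactor (hp0 : 0 ≤ p) (hp1 : p ≤ 1) (hβ : 0 ≤ β') (b : ℂ) (s : ℝ × ℝ) (τ : ℝ) :
    ‖powFactor bw RP p α β' b s τ‖ₑ = ENNReal.ofReal (vehicleFactor bw RP p α β' s τ ^ b.re) := by
  rw [powFactor, ← ofReal_norm,
    Complex.norm_cpow_eq_rpow_re_of_pos (vehicleFactor_pos hp0 hp1 hβ s τ)]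

theorem enorm_powFactor_le (hp0 : 0 ≤ p) (hp1 : p ≤ 1) (hβ : 0 ≤ β') (b : ℂ) (s : ℝ × ℝ) (τ : ℝ) :
    ‖powFactor bw RP p α β' b s τ‖ₑ ≤ powBound bw RP p α β' b s τ := by
  rw [enorm_powFactor hp0 hp1 hβ]
  exact ENNReal.ofReal_le_ofReal (le_max_right _ _)

theorem factor_mono (hp0 : 0 ≤ p) (hβ : 0 ≤ β') (hα : 0 < α) {v w : ℝ} (hv : 0 < v) (hvw : v ≤ w) :
    factor p α β' v ≤ factor p α β' w := by
  have h1 : w ^ (-α) ≤ v ^ (-α) := Real.rpow_le_rpow_of_nonpos hv hvw (by linarith)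
  have h2 : 0 ≤ w ^ (-α) := Real.rpow_nonneg (hv.le.trans hvw) _
  have h3 : β' * w ^ (-α) ≤ β' * v ^ (-α) := mul_le_mul_of_nonneg_left h1 hβ
  have h4 : 0 ≤ β' * w ^ (-α) := mul_nonneg hβ h2
  have h5 : p / (1 + β' * v ^ (-α)) ≤ p / (1 + β' * w ^ (-α)) :=
    div_le_div_of_nonneg_left hp0 (by linarith) (by linarith)
  simp only [factor]
  linarith

theorem boundAt_of_nonneg (hp0 : 0 ≤ p) (hp1 : p ≤ 1) (hβ : 0 ≤ β') {b : ℂ} (hb : 0 ≤ b.re) {w : ℝ}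
    (hw : 0 ≤ w) : boundAt p α β' b w = 1 := by
  rw [boundAt, max_eq_left (Real.rpow_le_one (factor_pos hp0 hp1 hβ hw).le
    (factor_le_one hp0 hβ hw) hb), ENNReal.ofReal_one]

/-- A vehicle at signed distance `τ` from the foot point is not closer than `|τ|`, hence its
contribution is dominated by that of a vehicle at distance `|τ|`. -/
theorem powBound_le (hp0 : 0 ≤ p) (hp1 : p ≤ 1) (hβ : 0 ≤ β') (hα : 0 < α) (hbw0 : 0 < bw)
    (hbw1 : bw ≤ Real.pi / 4) (b : ℂ) (s : ℝ × ℝ) (τ : ℝ) :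
    powBound bw RP p α β' b s τ ≤ boundAt p α β' b |τ| := by
  rcases le_or_gt 0 b.re with hb | hb
  · rw [boundAt_of_nonneg hp0 hp1 hβ hb (abs_nonneg τ), powBound,
      max_eq_left (Real.rpow_le_one (vehicleFactor_pos hp0 hp1 hβ s τ).le
        (vehicleFactor_le_one hp0 hβ s τ) hb), ENNReal.ofReal_one]
  by_cases hI : Interferes bw RP s.1 (streetPoint s.1 s.2 τ)
  · refine ENNReal.ofReal_le_ofReal (max_le_max le_rfl ?_)
    rw [vehicleFactor, if_pos hI]
    have hpi := Real.pi_pos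
    have hc : 0 < Real.cos bw := Real.cos_pos_of_mem_Ioo ⟨by linarith, by linarith⟩
    have hτ : 0 < |τ| := by
      refine abs_pos.2 fun h0 => ?_
      have h1 := ((interferes_streetPoint_iff _ _ _ _ _).1 hI).2.2
      simp only [h0, neg_zero, zero_div] at h1
      rcases h1 with h1 | h1 <;> linarith
    have hle : |τ| ≤ ‖streetPoint s.1 s.2 τ‖ := by
      rw [norm_streetPoint]
      exact Real.abs_le_sqrt (by nlinarith [sq_nonneg s.2])
    have hf := factor_mono (p := p) (α := α) hp0 hβ hα hτ hle
    have hfp := factor_pos (p := p) (α := α) hp0 hp1 hβ hτ.le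
    exact Real.rpow_le_rpow_of_nonpos hfp hf hb.le
  · rw [powBound, vehicleFactor, if_neg hI, Real.one_rpow, max_self]
    exact ENNReal.ofReal_le_ofReal (le_max_left _ _)

theorem lintegral_abs_le (g : ℝ → ℝ≥0∞) (RP : ℝ) :
    ∫⁻ τ in Icc (-RP) RP, g |τ| ≤ 2 * ∫⁻ v in Ioc 0 RP, g v := by
  have h1 : Icc (-RP) RP ⊆ (Ico (-RP) 0 ∪ Ioc 0 RP) ∪ {0} := by
    rintro τ ⟨h1, h2⟩
    rcases lt_trichotomy τ 0 with h | h | h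
    · exact Or.inl (Or.inl ⟨h1, h⟩)
    · exact Or.inr h
    · exact Or.inl (Or.inr ⟨h, h2⟩)
  have h2 : ∫⁻ τ in Ioc 0 RP, g |τ| = ∫⁻ v in Ioc 0 RP, g v :=
    setLIntegral_congr_fun measurableSet_Ioc fun τ hτ => by simp only [abs_of_pos hτ.1]
  have h3 : ∫⁻ τ in Ico (-RP) 0, g |τ| = ∫⁻ v in Ioc 0 RP, g v := by
    rw [← h2, ← lintegral_indicator measurableSet_Ico, ← lintegral_indicator measurableSet_Ioc,
      ← lintegral_neg_eq_self]
    refine lintegral_congr fun τ => ?_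
    by_cases hτ : τ ∈ Ioc 0 RP
    · have hτ' : -τ ∈ Ico (-RP) 0 := ⟨by linarith [hτ.2], by linarith [hτ.1]⟩
      rw [indicator_of_mem hτ, indicator_of_mem hτ', abs_neg]
    · have hτ' : -τ ∉ Ico (-RP) 0 := fun hx => hτ ⟨by linarith [hx.2], by linarith [hx.1]⟩
      rw [indicator_of_notMem hτ, indicator_of_notMem hτ']
  calc ∫⁻ τ in Icc (-RP) RP, g |τ| ≤ ∫⁻ τ in (Ico (-RP) 0 ∪ Ioc 0 RP) ∪ {0}, g |τ| :=
        lintegral_mono_set h1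
    _ ≤ (∫⁻ τ in (Ico (-RP) 0 ∪ Ioc 0 RP), g |τ|) + ∫⁻ τ in {0}, g |τ| :=
        lintegral_union_le _ _ _
    _ ≤ ((∫⁻ τ in Ico (-RP) 0, g |τ|) + ∫⁻ τ in Ioc 0 RP, g |τ|) + 0 := by
        refine add_le_add (lintegral_union_le _ _ _) ?_
        rw [Measure.restrict_singleton]
        simp
    _ = _ := by rw [h2, h3, add_zero, two_mul]

/-- Every street is dominated by the two halves of the ego street, which gives a bound that is
uniform in the street. -/
theorem lintegral_powBound_le (hp0 : 0 ≤ p) (hp1 : p ≤ 1) (hβ : 0 ≤ β') (hα : 0 < α) (hbw0 : 0 < bw)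
    (hbw1 : bw ≤ Real.pi / 4) (b : ℂ) (lam : ℝ) (s : ℝ × ℝ) :
    ∫⁻ τ in Icc (-RP) RP, powBound bw RP p α β' b s τ ∂(ENNReal.ofReal lam • (volume : Measure ℝ))
      ≤ ENNReal.ofReal lam * (2 * ∫⁻ v in Ioc 0 RP, boundAt p α β' b v) := by
  rw [Measure.restrict_smul, lintegral_smul_measure, smul_eq_mul]
  gcongr
  exact (lintegral_mono fun τ => powBound_le hp0 hp1 hβ hα hbw0 hbw1 b s τ).trans
    (lintegral_abs_le _ RP)

/-- The dominating function is integrable over the ego street if `p < 1`, where the factors are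
bounded below, and if `α Re b > -1`, where the singularity at the origin is integrable. -/
theorem lintegral_boundAt_lt_top (hp0 : 0 ≤ p) (hp1 : p ≤ 1) (hβ : 0 ≤ β') (hα : 0 < α)
    {b : ℂ} (hb : p < 1 ∨ -1 < α * b.re) :
    ∫⁻ v in Ioc 0 RP, boundAt p α β' b v < ⊤ := by
  rcases le_or_gt 0 b.re with hb0 | hb0
  · rw [setLIntegral_congr_fun (g := fun _ => 1) measurableSet_Ioc
      fun v hv => boundAt_of_nonneg hp0 hp1 hβ hb0 hv.1.le]
    simp
  rcases hp1.lt_or_eq with hp | rfl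
  · calc ∫⁻ v in Ioc 0 RP, boundAt p α β' b v
        ≤ ∫⁻ v in Ioc 0 RP, ENNReal.ofReal (max 1 ((1 - p) ^ b.re)) := by
          refine setLIntegral_mono measurable_const fun v hv => ?_
          refine ENNReal.ofReal_le_ofReal (max_le_max le_rfl ?_)
          refine Real.rpow_le_rpow_of_nonpos (by linarith) ?_ hb0.le
          have := div_nonneg hp0 (by
            have := mul_nonneg hβ (Real.rpow_nonneg hv.1.le (-α))
            linarith : 0 ≤ 1 + β' * v ^ (-α))
          rw [factor]
          linarith
      _ < ⊤ := by
          rw [setLIntegral_const, Real.volume_Ioc]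
          exact ENNReal.mul_lt_top ENNReal.ofReal_lt_top ENNReal.ofReal_lt_top
  · replace hb : -1 < α * b.re := hb.resolve_left (lt_irrefl 1)
    have hint : IntegrableOn (fun v : ℝ => v ^ (α * b.re)) (Ioc 0 RP) :=
      (intervalIntegral.intervalIntegrable_rpow' (a := 0) (b := RP) hb).1
    have hbd : ∀ v ∈ Ioc 0 RP, boundAt 1 α β' b v
        ≤ 1 + ENNReal.ofReal ((RP ^ α + β')⁻¹ ^ b.re) * ENNReal.ofReal (v ^ (α * b.re)) := by
      intro v hv
      have hvα : 0 < v ^ α := Real.rpow_pos_of_pos hv.1 _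
      have hle : v ^ α ≤ RP ^ α := Real.rpow_le_rpow hv.1.le hv.2 hα.le
      have hC : 0 < RP ^ α + β' := by linarith
      have hfac : factor 1 α β' v = v ^ α / (v ^ α + β') := by
        rw [factor, Real.rpow_neg hv.1.le]
        field_simp
        ring
      have hge : (RP ^ α + β')⁻¹ * v ^ α ≤ factor 1 α β' v := by
        rw [hfac, inv_mul_eq_div]
        exact div_le_div_of_nonneg_left hvα.le (by linarith) (by linarith)
      have hpow : factor 1 α β' v ^ b.re ≤ (RP ^ α + β')⁻¹ ^ b.re * v ^ (α * b.re) := by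
        rw [Real.rpow_mul hv.1.le, ← Real.mul_rpow (inv_pos.2 hC).le hvα.le]
        exact Real.rpow_le_rpow_of_nonpos (mul_pos (inv_pos.2 hC) hvα) hge hb0.le
      have hnn : 0 ≤ (RP ^ α + β')⁻¹ ^ b.re := Real.rpow_nonneg (inv_pos.2 hC).le _
      have hnn' : 0 ≤ v ^ (α * b.re) := Real.rpow_nonneg hv.1.le _
      rw [boundAt, ← ENNReal.ofReal_mul hnn, ← ENNReal.ofReal_one,
        ← ENNReal.ofReal_add zero_le_one (mul_nonneg hnn hnn')]
      refine ENNReal.ofReal_le_ofReal (max_le ?_ ?_)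
      · linarith [mul_nonneg hnn hnn']
      · linarith
    calc ∫⁻ v in Ioc 0 RP, boundAt 1 α β' b v
        ≤ ∫⁻ v in Ioc 0 RP,
          (1 + ENNReal.ofReal ((RP ^ α + β')⁻¹ ^ b.re) * ENNReal.ofReal (v ^ (α * b.re))) :=
          setLIntegral_mono (by fun_prop) hbd
      _ < ⊤ := by
          rw [lintegral_add_left measurable_const, lintegral_const_mul _ (by fun_prop)]
          refine ENNReal.add_lt_top.2 ⟨by simp, ENNReal.mul_lt_top ENNReal.ofReal_lt_top ?_⟩
          exact hint.lintegral_lt_top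

end Factors

/-! ### Integrability of the moments -/

section Moments

variable {Ω : Type*} [MeasurableSpace Ω] {P : Measure Ω} [IsProbabilityMeasure P]
  {lamL lam p sbar : ℝ} {q : ℕ → Ω → ℝ × ℝ} {t : ℕ → ℕ → Ω → ℝ} {rcs : Ω → ℝ}
  {h : ℕ → ℕ → Ω → ℝ} {act : ℕ → ℕ → Ω → Bool} {bw RP α β' : ℝ}

/-- Complex powers of nonnegative reals are multiplicative. -/
theorem prod_ofReal_cpow {ι : Type*} (s : Finset ι) {x : ι → ℝ} (hx : ∀ i, 0 ≤ x i) (b : ℂ) :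
    ((∏ i ∈ s, x i : ℝ) : ℂ) ^ b = ∏ i ∈ s, (x i : ℂ) ^ b := by
  classical
  induction s using Finset.induction_on with
  | empty => simp
  | insert i s hi ih =>
    rw [Finset.prod_insert hi, Finset.prod_insert hi, Complex.ofReal_mul,
      Complex.mul_cpow_ofReal_nonneg (hx i) (Finset.prod_nonneg fun j _ => hx j), ih]

theorem finprod_eq_prod_near {R : Type*} [CommMonoid R] {f : ℝ × ℝ → ℝ → R} {RP : ℝ}
    (hf : ∀ s τ, ¬ (|s.2| ≤ RP ∧ |τ| ≤ RP) → f s τ = 1) {ω : Ω}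
    (hfin : {ij : ℕ × ℕ | |(street q ij.1 ω).2| ≤ RP ∧ |t ij.1 ij.2 ω| ≤ RP}.Finite) :
    ∏ᶠ ij : ℕ × ℕ, f (street q ij.1 ω) (t ij.1 ij.2 ω)
      = ∏ ij ∈ hfin.toFinset, f (street q ij.1 ω) (t ij.1 ij.2 ω) := by
  refine finprod_eq_prod_of_mulSupport_subset _ fun ij hij => ?_
  rw [Finite.coe_toFinset]
  by_contra hn
  exact hij (hf _ _ hn)

theorem IsNetwork.successProduct_cpow_ae_eq (hnet : IsNetwork P lamL lam p sbar q t rcs h act)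
    (hp0 : 0 ≤ p) (hp1 : p ≤ 1) (hβ : 0 ≤ β') (b : ℂ) :
    (fun ω => (successProduct bw RP p α β' q t ω : ℂ) ^ b)
      =ᵐ[P] fun ω => ∏ᶠ ij : ℕ × ℕ, powFactor bw RP p α β' b (street q ij.1 ω) (t ij.1 ij.2 ω) := by
  filter_upwards [hnet.ae_finite_near RP] with ω hω
  rw [finprod_eq_prod_near (f := powFactor bw RP p α β' b) (powFactor_eq_one b) hω, successProduct,
    finprod_eq_prod_near (f := vehicleFactor bw RP p α β') (fun _ _ => vehicleFactor_eq_one) hω,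
    prod_ofReal_cpow _ fun ij => (vehicleFactor_pos hp0 hp1 hβ _ _).le]
  rfl

/-- On the ego street exactly the vehicles ahead and within the range interfere. -/
theorem vehicleFactor_ego (hbw0 : 0 < bw) (hbw1 : bw ≤ Real.pi / 4) (τ : ℝ) :
    vehicleFactor bw RP p α β' (0, 0) τ = if τ ∈ Ioc 0 RP then factor p α β' τ else 1 := by
  have hpi := Real.pi_pos
  have hc : 0 < Real.cos bw := Real.cos_pos_of_mem_Ioo ⟨by linarith, by linarith⟩
  have hc1 : Real.cos bw < 1 := by
    rw [← Real.cos_zero]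
    exact Real.cos_lt_cos_of_nonneg_of_le_pi_div_two le_rfl (by linarith) hbw0
  have hI : Interferes bw RP 0 (streetPoint 0 0 τ) ↔ τ ∈ Ioc 0 RP := by
    rw [interferes_streetPoint_iff]
    simp only [zero_mul, Real.cos_zero, mul_one, zero_add, ne_eq, OfNat.ofNat_ne_zero,
      not_false_eq_true, zero_pow, Real.sqrt_sq_eq_abs]
    constructor
    · rintro ⟨h1, h2, -⟩
      have hτ : 0 < τ := by
        by_contra hn
        linarith [div_nonpos_of_nonpos_of_nonneg (not_lt.1 hn) (abs_nonneg τ)]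
      exact ⟨hτ, (le_abs_self τ).trans h2⟩
    · rintro ⟨h1, h2⟩
      rw [abs_of_pos h1, div_self h1.ne']
      exact ⟨hc1, h2, Or.inr hc1⟩
  rw [vehicleFactor]
  simp only [hI]
  split_ifs with hτ
  · rw [norm_streetPoint]
    simp [Real.sqrt_sq hτ.1.le]
  · rfl

/-- The product over the vehicles of the ego street of a function `g ≥ 1` that is the modulus of
`f` is at most the modulus of the product of `f` over all vehicles. -/
theorem IsNetwork.finprod_ego_le_enorm_finprod (hnet : IsNetwork P lamL lam p sbar q t rcs h act)
    (hRP : 0 ≤ RP) {f : ℝ × ℝ → ℝ → ℂ} (hf : ∀ s τ, ¬ (|s.2| ≤ RP ∧ |τ| ≤ RP) → f s τ = 1)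
    {g : ℝ × ℝ → ℝ → ℝ≥0∞} (hg : ∀ s τ, 1 ≤ g s τ) (hfg : ∀ s τ, ‖f s τ‖ₑ = g s τ) :
    ∀ᵐ ω ∂P, ∏ᶠ j, (Icc (-RP) RP).mulIndicator (g (0, 0)) (t 0 j ω)
      ≤ ‖∏ᶠ ij : ℕ × ℕ, f (street q ij.1 ω) (t ij.1 ij.2 ω)‖ₑ := by
  filter_upwards [hnet.ae_finite_near RP] with ω hω
  have hstreet : |(street q 0 ω).2| ≤ RP := by simpa [street] using hRP
  have hfin : {j | t 0 j ω ∈ Icc (-RP) RP}.Finite :=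
    (hω.preimage (Prod.mk_right_injective 0).injOn).subset fun j hj => ⟨hstreet, abs_le.2 hj⟩
  rw [finprod_eq_prod_near hf hω, finprod_mulIndicator_eq_prod hfin, ← ofReal_norm, norm_prod,
    ENNReal.ofReal_prod_of_nonneg fun _ _ => norm_nonneg _]
  simp_rw [ofReal_norm, hfg]
  calc ∏ j ∈ hfin.toFinset, g (0, 0) (t 0 j ω)
      = ∏ ij ∈ hfin.toFinset.map ⟨Prod.mk 0, Prod.mk_right_injective 0⟩,
          g (street q ij.1 ω) (t ij.1 ij.2 ω) := by
        rw [Finset.prod_map]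
        rfl
    _ ≤ _ := by
        refine Finset.prod_le_prod_of_subset_of_one_le' (fun ij hij => ?_) fun _ _ _ => hg _ _
        obtain ⟨j, hj, rfl⟩ := Finset.mem_map.1 hij
        exact hω.mem_toFinset.2 ⟨hstreet, abs_le.2 (hfin.mem_toFinset.1 hj)⟩

/-- A moment that is integrable has an integrable dominating function: for `Re b < 0` the modulus
of the moment is at least the product over the ego street alone, whose expectation is the
exponential of the integral of the dominating function. -/
theorem IsNetwork.lintegral_boundAt_lt_top_of_integrable
    (hnet : IsNetwork P lamL lam p sbar q t rcs h act) (hp0 : 0 ≤ p) (hp1 : p ≤ 1) (hβ : 0 ≤ β')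
    (hlam : 0 < lam) (hRP : 0 < RP) (hbw0 : 0 < bw) (hbw1 : bw ≤ Real.pi / 4) {b : ℂ}
    (hint : Integrable (fun ω => ∏ᶠ ij : ℕ × ℕ,
      powFactor bw RP p α β' b (street q ij.1 ω) (t ij.1 ij.2 ω)) P) :
    ∫⁻ v in Ioc 0 RP, boundAt p α β' b v < ⊤ := by
  rcases le_or_gt 0 b.re with hb0 | hb0
  · rw [setLIntegral_congr_fun (g := fun _ => 1) measurableSet_Ioc
      fun v hv => boundAt_of_nonneg hp0 hp1 hβ hb0 hv.1.le]
    simp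
  have hnorm : ∀ s τ, ‖powFactor bw RP p α β' b s τ‖ₑ = powBound bw RP p α β' b s τ := by
    intro s τ
    rw [enorm_powFactor hp0 hp1 hβ, powBound, max_eq_right]
    exact Real.one_le_rpow_of_pos_of_le_one_of_nonpos (vehicleFactor_pos hp0 hp1 hβ s τ)
      (vehicleFactor_le_one hp0 hβ s τ) hb0.le
  have hge := hnet.finprod_ego_le_enorm_finprod hRP.le (powFactor_eq_one b)
    (one_le_powBound b) hnorm
  have hlt : ∫⁻ ω, ∏ᶠ j, (Icc (-RP) RP).mulIndicator (powBound bw RP p α β' b (0, 0)) (t 0 j ω) ∂P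
      < ⊤ := (lintegral_mono_ae hge).trans_lt (hasFiniteIntegral_iff_enorm.1 hint.hasFiniteIntegral)
  have hν := vehicles_intensity_Icc_lt_top lam RP
  have hm : Measurable (powBound bw RP p α β' b (0, 0)) := by
    have h1 : Measurable fun τ : ℝ => (((0, 0) : ℝ × ℝ), τ) := measurable_prodMk_left
    have h2 := (measurable_powBound bw RP p α β' b).comp h1
    exact h2
  rw [(hnet.vehicles 0).lintegral_finprod hm
    (fun _ => ENNReal.ofReal_ne_top) measurableSet_Icc hν] at hlt
  have hI : ∫⁻ τ in Icc (-RP) RP, powBound bw RP p α β' b (0, 0) τ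
      ∂(ENNReal.ofReal lam • (volume : Measure ℝ)) < ⊤ := by
    by_contra hn
    rw [not_lt_top_iff.1 hn] at hlt
    refine hlt.ne ?_
    rw [EReal.coe_ennreal_top, EReal.exp_top, ENNReal.top_mul]
    rw [EReal.exp_coe]
    exact (ENNReal.ofReal_pos.2 (Real.exp_pos _)).ne'
  rw [Measure.restrict_smul, lintegral_smul_measure, smul_eq_mul] at hI
  have hfinal : ∫⁻ τ in Icc (-RP) RP, powBound bw RP p α β' b (0, 0) τ < ⊤ := by
    rcases ENNReal.mul_lt_top_iff.1 hI with h1 | h1 | h1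
    · exact h1.2
    · exact absurd h1 (ENNReal.ofReal_pos.2 hlam).ne'
    · rw [h1]
      exact ENNReal.zero_lt_top
  refine lt_of_le_of_lt ?_ hfinal
  calc ∫⁻ v in Ioc 0 RP, boundAt p α β' b v
      = ∫⁻ τ in Ioc 0 RP, powBound bw RP p α β' b (0, 0) τ := by
        refine setLIntegral_congr_fun measurableSet_Ioc fun v hv => ?_
        simp only [powBound, boundAt, vehicleFactor_ego hbw0 hbw1, if_pos hv]
    _ ≤ ∫⁻ τ in Icc (-RP) RP, powBound bw RP p α β' b (0, 0) τ :=
        lintegral_mono_set ((Ioc_subset_Icc_self).trans (Icc_subset_Icc_left (by linarith)))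

/-- The moment is integrable and equals the moment functional of the Cox process as soon as the
dominating function is integrable. -/
theorem IsNetwork.integrable_and_integral_powFactor
    (hnet : IsNetwork P lamL lam p sbar q t rcs h act) (hp0 : 0 ≤ p) (hp1 : p ≤ 1) (hβ : 0 ≤ β')
    (hα : 0 < α) (hRP : 0 < RP) (hbw0 : 0 < bw) (hbw1 : bw ≤ Real.pi / 4) {b : ℂ}
    (hb : ∫⁻ v in Ioc 0 RP, boundAt p α β' b v < ⊤) :
    Integrable (fun ω => ∏ᶠ ij : ℕ × ℕ,
      powFactor bw RP p α β' b (street q ij.1 ω) (t ij.1 ij.2 ω)) P ∧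
    ∫ ω, ∏ᶠ ij : ℕ × ℕ, powFactor bw RP p α β' b (street q ij.1 ω) (t ij.1 ij.2 ω) ∂P
      = streetMoment lam RP (powFactor bw RP p α β' b) (0, 0) *
        Complex.exp (∫ s in univ ×ˢ Icc (-RP) RP,
          (streetMoment lam RP (powFactor bw RP p α β' b) s - 1)
          ∂(ENNReal.ofReal lamL • (volume : Measure (ℝ × ℝ)).restrict (Ico 0 Real.pi ×ˢ univ))) :=
  hnet.integrable_and_integral_finprod hRP.le (measurable_powFactor bw RP p α β' b)
    (measurable_powBound bw RP p α β' b) (powFactor_eq_one b) (powBound_eq_one b)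
    (one_le_powBound b) (fun _ _ => ENNReal.ofReal_ne_top) (enorm_powFactor_le hp0 hp1 hβ b)
    (ENNReal.mul_ne_top ENNReal.ofReal_ne_top (ENNReal.mul_ne_top (by simp) hb.ne))
    (lintegral_powBound_le hp0 hp1 hβ hα hbw0 hbw1 b lam)

end Moments

/-! ### The moment of a single street -/

section Street

variable {lam p bw RP α β' : ℝ}

theorem streetMoment_eq_exp_integral (hlam : 0 < lam) {f : ℝ × ℝ → ℝ → ℂ}
    (hf : ∀ s τ, ¬ (|s.2| ≤ RP ∧ |τ| ≤ RP) → f s τ = 1) (s : ℝ × ℝ) :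
    streetMoment lam RP f s = Complex.exp (-(lam : ℂ) * ∫ τ, (1 - f s τ)) := by
  rw [streetMoment, Measure.restrict_smul, integral_smul_measure, ENNReal.toReal_ofReal hlam.le,
    setIntegral_eq_integral_of_forall_compl_eq_zero, Complex.real_smul, neg_mul, ← mul_neg,
    ← integral_neg]
  · simp_rw [neg_sub]
  · exact fun τ hτ => sub_eq_zero.2 (hf s τ fun hx => hτ (abs_le.1 hx.2))

theorem streetMoment_ego (hlam : 0 < lam) (hRP : 0 < RP) (hbw0 : 0 < bw) (hbw1 : bw ≤ Real.pi / 4)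
    (b : ℂ) :
    streetMoment lam RP (powFactor bw RP p α β' b) (0, 0)
      = Complex.exp (-(lam : ℂ) * ∫ v in (0 : ℝ)..RP, (1 - (factor p α β' v : ℂ) ^ b)) := by
  rw [streetMoment_eq_exp_integral hlam (powFactor_eq_one b),
    intervalIntegral.integral_of_le hRP.le, ← integral_indicator measurableSet_Ioc]
  congr 3
  funext τ
  rw [powFactor, vehicleFactor_ego hbw0 hbw1]
  by_cases hτ : τ ∈ Ioc 0 RP
  · rw [if_pos hτ, indicator_of_mem hτ]
  · rw [if_neg hτ, indicator_of_notMem hτ, Complex.ofReal_one, Complex.one_cpow, sub_self]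

theorem sectionStart_le_sectionEnd (bw RP θ r : ℝ) :
    sectionStart bw θ r ≤ sectionEnd bw RP θ r := by
  rw [sectionEnd]
  split_ifs
  exacts [le_max_left _ _, le_max_left _ _, le_max_left _ _, le_rfl]

/-- The interfering section is an interval up to its end points. -/
theorem interferingSection_ae_eq (hRP : 0 < RP) (hbw0 : 0 < bw) (hbw1 : bw ≤ Real.pi / 4)
    {θ r : ℝ} (hr : 0 < r) (hθ : Real.sin θ ≠ 0) :
    interferingSection bw RP θ r
      =ᵐ[volume] Ioc (sectionStart bw θ r) (sectionEnd bw RP θ r) := by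
  obtain ⟨h1, h2⟩ := interferingSection_bounds hRP hbw0 hbw1 θ r hr hθ
  refine EventuallyLE.antisymm ?_ ?_
  · exact h2.eventuallyLE.trans Ioc_ae_eq_Icc.symm.le
  · exact Ioo_ae_eq_Ioc.symm.le.trans h1.eventuallyLE

/-- The moment of a street in terms of the distance `v` from its intersection with the ego street,
which differs from the distance `τ` to the foot point by a shift and possibly a reflection. -/
theorem streetMoment_eq_exp_section (hlam : 0 < lam) (hRP : 0 < RP) (hbw0 : 0 < bw)
    (hbw1 : bw ≤ Real.pi / 4) (b : ℂ) {θ r : ℝ} (hr : 0 < r) (hθ : Real.sin θ ≠ 0) :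
    streetMoment lam RP (powFactor bw RP p α β' b) (θ, r)
      = Complex.exp (-(lam : ℂ) * ∫ v in (sectionStart bw θ r)..(sectionEnd bw RP θ r),
          (1 - (factor p α β' (interfererDist θ r v) : ℂ) ^ b)) := by
  classical
  set ε : ℝ := if 0 ≤ Real.cos θ then 1 else -1 with hε
  set c : ℝ := crossing θ r * |Real.cos θ|
  have hsub : ∫ τ, (1 - powFactor bw RP p α β' b (θ, r) τ)
      = ∫ v, (1 - powFactor bw RP p α β' b (θ, r) (ε * (v + c))) := by
    rw [integral_add_right_eq_self (μ := volume)
      (fun v => 1 - powFactor bw RP p α β' b (θ, r) (ε * v)) c]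
    rw [hε]
    split_ifs
    · simp only [one_mul]
    · simp only [neg_mul, one_mul]
      exact (integral_neg_eq_self (μ := volume)
        (fun v => 1 - powFactor bw RP p α β' b (θ, r) v)).symm
  have hpt : ∀ v, 1 - powFactor bw RP p α β' b (θ, r) (ε * (v + c))
      = (interferingSection bw RP θ r).indicator
        (fun v => 1 - (factor p α β' (interfererDist θ r v) : ℂ) ^ b) v := by
    intro v
    have hcp : crossingPoint θ r v = streetPoint θ r (ε * (v + c)) :=
      crossingPoint_eq_streetPoint r v hθ
    have hmem : v ∈ interferingSection bw RP θ r
        ↔ Interferes bw RP θ (streetPoint θ r (ε * (v + c))) := by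
      rw [← hcp]
      rfl
    by_cases hv : v ∈ interferingSection bw RP θ r
    · rw [indicator_of_mem hv, powFactor, vehicleFactor, if_pos (hmem.1 hv), norm_streetPoint,
        interfererDist_eq r v hθ]
      have hε2 : ε ^ 2 = 1 := by
        rw [hε]
        split_ifs <;> norm_num
      rw [mul_pow, hε2, one_mul]
    · rw [indicator_of_notMem hv, powFactor, vehicleFactor, if_neg fun hx => hv (hmem.2 hx),
        Complex.ofReal_one, Complex.one_cpow, sub_self]
  have hms : MeasurableSet (interferingSection bw RP θ r) := by
    have hmap : Measurable fun v : ℝ => ((θ, r), ε * (v + c)) := by fun_prop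
    convert hmap (measurableSet_interferes bw RP) using 1
    ext v
    exact iff_of_eq (congrArg (Interferes bw RP θ) (crossingPoint_eq_streetPoint r v hθ))
  rw [streetMoment_eq_exp_integral hlam (powFactor_eq_one b), hsub]
  simp_rw [hpt]
  rw [integral_indicator hms, setIntegral_congr_set (interferingSection_ae_eq hRP hbw0 hbw1 hr hθ),
    ← intervalIntegral.integral_of_le (sectionStart_le_sectionEnd bw RP θ r)]

end Street

/-! ### Integration over the streets -/

section Lines

variable {lam p bw RP α β' : ℝ}

/-- The parameters `(θ + π, r)` and `(θ, -r)` describe the same street with opposite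
directions, and a vehicle looks along both directions. -/
theorem streetMoment_add_pi (hlam : 0 < lam) (b : ℂ) (θ r : ℝ) :
    streetMoment lam RP (powFactor bw RP p α β' b) (θ + Real.pi, r)
      = streetMoment lam RP (powFactor bw RP p α β' b) (θ, -r) := by
  have hf : ∀ τ, powFactor bw RP p α β' b (θ + Real.pi, r) (-τ)
      = powFactor bw RP p α β' b (θ, -r) τ := by
    intro τ
    have hI : Interferes bw RP (θ + Real.pi) (streetPoint (θ + Real.pi) r (-τ))
        ↔ Interferes bw RP θ (streetPoint θ (-r) τ) := by
      rw [interferes_streetPoint_iff, interferes_streetPoint_iff, Real.sin_add_pi,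
        Real.cos_add_pi, neg_sq, neg_sq, neg_neg, or_comm (a := _ < τ / _), neg_mul_neg,
        mul_neg, neg_mul]
    have hn : ‖streetPoint (θ + Real.pi) r (-τ)‖ = ‖streetPoint θ (-r) τ‖ := by
      rw [norm_streetPoint, norm_streetPoint, neg_sq, neg_sq]
    rw [powFactor, powFactor, vehicleFactor, vehicleFactor]
    dsimp only
    rw [hn]
    by_cases hx : Interferes bw RP θ (streetPoint θ (-r) τ)
    · rw [if_pos hx, if_pos (hI.2 hx)]
    · rw [if_neg hx, if_neg (hx ∘ hI.1)]
  rw [streetMoment_eq_exp_integral hlam (powFactor_eq_one b),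
    streetMoment_eq_exp_integral hlam (powFactor_eq_one b), ← integral_neg_eq_self]
  simp_rw [hf]

/-- An integral over the line parameters in `[0, π) × ℝ` as an integral over `r > 0` and over a
full turn of the angle. -/
theorem integral_strip_eq {lamL C : ℝ} (hlamL : 0 < lamL) {H : ℝ × ℝ → ℂ} (hH : Measurable H)
    (hHC : ∀ s, ‖H s‖ ≤ C) (hH0 : ∀ s, ¬ |s.2| ≤ RP → H s = 0)
    (hHπ : ∀ θ r, H (θ + Real.pi, r) = H (θ, -r)) :
    ∫ s in univ ×ˢ Icc (-RP) RP, H s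
        ∂(ENNReal.ofReal lamL • (volume : Measure (ℝ × ℝ)).restrict (Ico 0 Real.pi ×ˢ univ))
      = (lamL : ℂ) * ∫ r in Ioi (0 : ℝ), ∫ θ in (0 : ℝ)..(2 * Real.pi), H (θ, r) := by
  have hpi := Real.pi_pos
  have hii : ∀ r a c, IntervalIntegrable (fun θ => H (θ, r)) volume a c := fun r a c =>
    (intervalIntegrable_const (c := C)).mono_fun
      (hH.comp measurable_prodMk_right).aestronglyMeasurable
      (ae_of_all _ fun θ => (hHC _).trans (le_abs_self C))
  set J : ℝ → ℂ := fun r => ∫ θ in (0 : ℝ)..Real.pi, H (θ, r) with hJ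
  have hJ0 : ∀ r, r ∉ Icc (-RP) RP → J r = 0 := fun r hr => by
    have : ∀ θ, H (θ, r) = 0 := fun θ => hH0 _ fun hx => hr (abs_le.1 hx)
    simp [hJ, this]
  have hprod : ((volume : Measure ℝ).restrict (Ico 0 Real.pi)).prod
      ((volume : Measure ℝ).restrict (Icc (-RP) RP))
      = (volume : Measure (ℝ × ℝ)).restrict (Ico 0 Real.pi ×ˢ Icc (-RP) RP) := by
    rw [Measure.prod_restrict, Measure.volume_eq_prod]
  have hint : Integrable H (((volume : Measure ℝ).restrict (Ico 0 Real.pi)).prod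
      ((volume : Measure ℝ).restrict (Icc (-RP) RP))) :=
    Integrable.of_bound hH.aestronglyMeasurable C (ae_of_all _ hHC)
  have hJeq : ∀ r, ∫ θ in Ico 0 Real.pi, H (θ, r) = J r := fun r => by
    rw [integral_Ico_eq_integral_Ioc, ← intervalIntegral.integral_of_le hpi.le]
  have hJint : Integrable J := by
    have h1 : IntegrableOn J (Icc (-RP) RP) := by
      have h2 := hint.integral_prod_right
      simp_rw [hJeq] at h2
      exact h2
    refine (integrableOn_iff_integrable_of_support_subset fun r hr => ?_).1 h1
    by_contra hn
    exact hr (hJ0 r hn)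
  have hset : (Ico 0 Real.pi ×ˢ univ : Set (ℝ × ℝ)) ∩ (univ ×ˢ Icc (-RP) RP)
      = Ico 0 Real.pi ×ˢ Icc (-RP) RP := by
    rw [prod_inter_prod, inter_univ, univ_inter]
  -- Negative `r` correspond to the second half of the turn.
  have hJneg : ∀ r, J (-r) = ∫ θ in Real.pi..(2 * Real.pi), H (θ, r) := fun r => by
    simp_rw [hJ, ← hHπ]
    rw [intervalIntegral.integral_comp_add_right fun θ => H (θ, r)]
    congr 1 <;> ring
  rw [Measure.restrict_smul, Measure.restrict_restrict (MeasurableSet.univ.prod measurableSet_Icc),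
    inter_comm, hset, integral_smul_measure, ENNReal.toReal_ofReal hlamL.le, Complex.real_smul,
    ← hprod, integral_prod_symm _ hint]
  simp_rw [hJeq]
  congr 1
  rw [setIntegral_eq_integral_of_forall_compl_eq_zero hJ0,
    ← intervalIntegral.integral_Iic_add_Ioi hJint.integrableOn hJint.integrableOn (b := 0)]
  have hneg : ∫ r in Iic (0 : ℝ), J r = ∫ r in Ioi (0 : ℝ), J (-r) := by
    rw [integral_comp_neg_Ioi, neg_zero]
  rw [hneg, ← integral_add hJint.comp_neg.integrableOn hJint.integrableOn]
  refine integral_congr_ae (ae_of_all _ fun r => ?_)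
  simp only [hJneg]
  rw [add_comm, hJ, intervalIntegral.integral_add_adjacent_intervals (hii r _ _) (hii r _ _)]

theorem ae_sin_ne_zero : ∀ᵐ θ : ℝ, Real.sin θ ≠ 0 := by
  have h1 : {θ : ℝ | Real.sin θ = 0}.Countable := by
    refine (countable_range fun n : ℤ => (n : ℝ) * Real.pi).mono fun θ hθ => ?_
    exact Real.sin_eq_zero_iff.1 hθ
  filter_upwards [h1.ae_notMem volume] with θ hθ using hθ

/-- The exponent contributed by the streets of the Poisson line process. -/
theorem integral_streetMoment_sub_one {lamL : ℝ} (hlamL : 0 < lamL) (hlam : 0 < lam)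
    (hp0 : 0 ≤ p) (hp1 : p ≤ 1) (hβ : 0 ≤ β') (hα : 0 < α) (hRP : 0 < RP) (hbw0 : 0 < bw)
    (hbw1 : bw ≤ Real.pi / 4) {b : ℂ} (hb : ∫⁻ v in Ioc 0 RP, boundAt p α β' b v < ⊤) :
    ∫ s in univ ×ˢ Icc (-RP) RP, (streetMoment lam RP (powFactor bw RP p α β' b) s - 1)
        ∂(ENNReal.ofReal lamL • (volume : Measure (ℝ × ℝ)).restrict (Ico 0 Real.pi ×ˢ univ))
      = -((lamL : ℂ) * ∫ r in Ioi (0 : ℝ), ∫ θ in (0 : ℝ)..(2 * Real.pi),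
          (1 - Complex.exp (-(lam : ℂ) *
            ∫ v in (sectionStart bw θ r)..(sectionEnd bw RP θ r),
              (1 - (factor p α β' (interfererDist θ r v) : ℂ) ^ b)))) := by
  have hK : ENNReal.ofReal lam * (2 * ∫⁻ v in Ioc 0 RP, boundAt p α β' b v) ≠ ⊤ :=
    ENNReal.mul_ne_top ENNReal.ofReal_ne_top (ENNReal.mul_ne_top (by simp) hb.ne)
  have hbound := norm_streetMoment_le (f := powFactor bw RP p α β' b)
    (enorm_powFactor_le (bw := bw) (RP := RP) (α := α) hp0 hp1 hβ b) hK
    (lintegral_powBound_le hp0 hp1 hβ hα hbw0 hbw1 b lam)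
  rw [integral_strip_eq hlamL
    ((measurable_streetMoment lam RP (measurable_powFactor bw RP p α β' b)).sub_const 1)
    (fun s => (norm_sub_le _ _).trans (add_le_add_left (hbound s) _))
    (fun s hs => sub_eq_zero.2 (streetMoment_eq_one (powFactor_eq_one b) hs))
    (fun θ r => by rw [streetMoment_add_pi hlam]), ← mul_neg, ← integral_neg]
  congr 1
  refine setIntegral_congr_fun measurableSet_Ioi fun r hr => ?_
  rw [← intervalIntegral.integral_neg]
  refine intervalIntegral.integral_congr_ae ?_
  filter_upwards [ae_sin_ne_zero] with θ hθ _
  rw [streetMoment_eq_exp_section hlam hRP hbw0 hbw1 b hr hθ, neg_sub]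

end Lines

end RadarPLCP

end

open RadarPLCP in
theorem mainTheorem3 {Ω : Type*} [MeasurableSpace Ω] (P : Measure Ω) [IsProbabilityMeasure P]
    (lamL lam p sbar α Gt Ae Ptx R RP bw β : ℝ)
    (hlamL : 0 < lamL) (hlam : 0 < lam) (hp0 : 0 ≤ p) (hp1 : p ≤ 1) (hsbar : 0 < sbar)
    (hα : 0 < α) (hGt : 0 < Gt) (hAe : 0 < Ae) (hPtx : 0 < Ptx) (hR : 0 < R) (hRP : 0 < RP)
    (hbw0 : 0 < bw) (hbw1 : bw ≤ Real.pi / 4) (hβ0 : 0 ≤ β) (hβ1 : β < 1)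
    (q : ℕ → Ω → ℝ × ℝ) (t : ℕ → ℕ → Ω → ℝ) (rcs : Ω → ℝ)
    (h : ℕ → ℕ → Ω → ℝ) (act : ℕ → ℕ → Ω → Bool)
    (hnet : IsNetwork P lamL lam p sbar q t rcs h act) :
    (∀ θ r : ℝ, 0 < r → Real.sin θ ≠ 0 →
      Ioo (sectionStart bw θ r) (sectionEnd bw RP θ r) ⊆ interferingSection bw RP θ r ∧
      interferingSection bw RP θ r ⊆ Icc (sectionStart bw θ r) (sectionEnd bw RP θ r)) ∧
    ∀ b : ℂ,
      ((p < 1 ∨ -1 < α * b.re) → Integrable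
        (fun ω => (condSuccess P (gainConst Gt Ae) Ptx α R bw RP β q t rcs h act ω : ℂ) ^ b) P) ∧
      (Integrable
        (fun ω => (condSuccess P (gainConst Gt Ae) Ptx α R bw RP β q t rcs h act ω : ℂ) ^ b) P →
        ∫ ω, (condSuccess P (gainConst Gt Ae) Ptx α R bw RP β q t rcs h act ω : ℂ) ^ b ∂P =
          Complex.exp
            (-(lam : ℂ) * (∫ v in (0 : ℝ)..RP,
                (1 - (factor p α (scaledThreshold α R sbar β) v : ℂ) ^ b))
              - (lamL : ℂ) * ∫ r in Ioi (0 : ℝ), ∫ θ in (0 : ℝ)..(2 * Real.pi),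
                (1 - Complex.exp (-(lam : ℂ) *
                  ∫ v in (sectionStart bw θ r)..(sectionEnd bw RP θ r),
                    (1 - (factor p α (scaledThreshold α R sbar β)
                      (interfererDist θ r v) : ℂ) ^ b))))) := by
  refine ⟨fun θ r hr hθ => interferingSection_bounds hRP hbw0 hbw1 θ r hr hθ, fun b => ?_⟩
  have hγ : 0 < gainConst Gt Ae := by
    have := Real.pi_pos
    rw [gainConst]
    positivity
  have hβ' := scaledThreshold_nonneg (α := α) hR hsbar hβ0 hβ1
  have hae : (fun ω =>
        (condSuccess P (gainConst Gt Ae) Ptx α R bw RP β q t rcs h act ω : ℂ) ^ b) =ᵐ[P]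
      fun ω => ∏ᶠ ij : ℕ × ℕ, powFactor bw RP p α (scaledThreshold α R sbar β) b
        (street q ij.1 ω) (t ij.1 ij.2 ω) := by
    refine Filter.EventuallyEq.trans ?_ (hnet.successProduct_cpow_ae_eq hp0 hp1 hβ' b)
    filter_upwards [hnet.condSuccess_ae_eq (bw := bw) (RP := RP) (α := α)
      hp0 hp1 hsbar hγ hPtx hR hβ0 hβ1] with ω hω
    rw [hω]
  rw [integrable_congr hae, integral_congr_ae hae]
  refine ⟨fun hb => (hnet.integrable_and_integral_powFactor hp0 hp1 hβ' hα hRP hbw0 hbw1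
    (lintegral_boundAt_lt_top hp0 hp1 hβ' hα hb)).1, fun hint => ?_⟩
  have hb := hnet.lintegral_boundAt_lt_top_of_integrable hp0 hp1 hβ' hlam hRP hbw0 hbw1 hint
  rw [(hnet.integrable_and_integral_powFactor hp0 hp1 hβ' hα hRP hbw0 hbw1 hb).2,
    streetMoment_ego hlam hRP hbw0 hbw1,
    integral_streetMoment_sub_one hlamL hlam hp0 hp1 hβ' hα hRP hbw0 hbw1 hb,
    ← Complex.exp_add, ← sub_eq_add_neg]
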